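/- **Theorem 3.** *Setting.* Let $d\ge 1$ and $\epsilon\in(0,1/2)$. Let $X_1,X_2,\dots$ be a strictly stationary sequence of integrable random vectors in $\mathbb R^d$ with $E X_t=0$, and assume the invariance principle $$n^{-1/2}\sum_{t=1}^{\lfloor nr\rfloor}X_t\ \Rightarrow\ \Sigma_X^{1/2}\mathcal B_d(r)\qquad\text{in } D([0,1],\mathbb R^d)\text{ with the Skorokhod topology},$$ where $\Sigma_X$ is a positive definite matrix and $\mathcal B_d$ is a $d$-dimensional Brownian motion with independent standard coordinates. *Statistics.* For data $Y_1,\dots,Y_n\in\mathbb R^d$ let $\hat\theta_{a,b}=(b-a+1)^{-1}\sum_{t=a}^bY_t$ and, for $1\le t_1\le k<t_2\le n$, $$D_n^*(t_1,k,t_2)=\frac{(k-t_1+1)(t_2-k)}{(t_2-t_1+1)^{3/2}}\bigl(\hat\theta_{t_1,k}-\hat\theta_{k+1,t_2}\bigr),\qquad V_n^*=L_n^*+R_n^*,$$ $$L_n^*(t_1,k,t_2)=\sum_{i=t_1}^{k}\frac{(i-t_1+1)^2(k-i)^2}{(t_2-t_1+1)^2(k-t_1+1)^2}(\hat\theta_{t_1,i}-\hat\theta_{i+1,k})(\hat\theta_{t_1,i}-\hat\theta_{i+1,k})^\top,$$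 $$R_n^*(t_1,k,t_2)=\sum_{i=k+1}^{t_2}\frac{(t_2-i+1)^2(i-1-k)^2}{(t_2-t_1+1)^2(t_2-k)^2}(\hat\theta_{i,t_2}-\hat\theta_{k+1,i-1})(\hat\theta_{i,t_2}-\hat\theta_{k+1,i-1})^\top$$ (terms with weight $0$ being $0$), and $T_n^*(t_1,k,t_2)=D_n^{*\top}V_n^{*-1}D_n^*$. With the window size $h=\lfloor n\epsilon\rfloor$ let $$H_{1:n}(k)=\{(k-j_1h+1,\,k+j_2h): 1\le j_1\le\lfloor k/h\rfloor,\ 1\le j_2\le\lfloor (n-k)/h\rfloor\},$$ $H_{s:e}(k)=\{(t_1,t_2)\in H_{1:n}(k): s\le t_1<t_2\le e\}$ and $T^*_{s,e}(k)=\max_{(t_1,t_2)\in H_{s:e}(k)}T_n^*(t_1,k,t_2)$, with $\max_\varnothing:=0$. *Algorithm.* For a threshold $K_n$, SNCP$(s,e)$ returns no change-point if $e-s+1<2h$. Otherwise it picks a maximizer $\hat k$ of $T^*_{s,e}(k)$ over $k=s,\dots,e$; if $T^*_{s,e}(\hat k)\le K_n$ it returns no change-point, and otherwise it returns $\hat k$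 together with the outputs of SNCP$(s,\hat k)$ and SNCP$(\hat k+1,e)$. Let $\hat k_1<\dots<\hat k_{\hat m}$ be the output of SNCP$(1,n)$ (the result holds simultaneously for all ways of breaking ties among maximizers). **(i)** Suppose $Y_t=X_t+\theta$ for $1\le t\le n$ (no change-point; $\theta\in\mathbb R^d$ may depend on $n$). Then, as $n\to\infty$, $$\max_{k=1,\dots,n}T^*_{1,n}(k)\ \xrightarrow{\ \mathcal D\ }\ G^*_{\epsilon,d}=\sup_{u\in[\epsilon,1-\epsilon]}\ \max_{(u_1,u_2)\in H_\epsilon(u)}D^*(u_1,u,u_2)^\top V^*(u_1,u,u_2)^{-1}D^*(u_1,u,u_2),$$ where $H_\epsilon(u)=\{(u-j_1\epsilon,u+j_2\epsilon):1\le j_1\le\lfloor u/\epsilon\rfloor,\ 1\le j_2\le\lfloor(1-u)/\epsilon\rfloor\}$, $\Delta(u_1,u,u_2)=\mathcal B_d(u)-\mathcal B_d(u_1)-\frac{u-u_1}{u_2-u_1}\{\mathcal B_d(u_2)-\mathcal B_d(u_1)\}$, $D^*(u_1,u,u_2)=(u_2-u_1)^{-1/2}\Delta(u_1,u,u_2)$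 and $$V^*(u_1,u,u_2)=\frac1{(u_2-u_1)^2}\Bigl(\int_{u_1}^{u}\Delta(u_1,s,u)\Delta(u_1,s,u)^\top ds+\int_u^{u_2}\Delta(u,s,u_2)\Delta(u,s,u_2)^\top ds\Bigr).$$ If $1/\epsilon$ is not an integer, the same holds with the supremum taken over the open interval $(\epsilon,1-\epsilon)$. **(ii)** Let $m_o\ge 0$ and suppose $Y_t=X_t+\theta_i$ for $k_{i-1}<t\le k_i$, $i=1,\dots,m_o+1$, where $0=k_0<k_1<\dots<k_{m_o}<k_{m_o+1}=n$ (the $k_i$ and $\theta_i$ may depend on $n$), $k_i/n\to\tau_i$, $\tau_0=0$, $\tau_{m_o+1}=1$, $\min_{1\le i\le m_o+1}(\tau_i-\tau_{i-1})=\epsilon_o>\epsilon$, and $\theta_{i+1}-\theta_i=\delta\,\eta_i$ with fixed nonzero vectors $\eta_i\in\mathbb R^d$ and real $\delta=\delta_n$. Suppose $n\delta^2\to\infty$ and $K_n=(n\delta^2)^\kappa$ for some $\kappa\in(1/2,1)$. Then $$\lim_{n\to\infty}P\Bigl(\hat m=m_o\ \text{ and }\ \max_{1\le i\le m_o}|\hat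 k_i-k_i|\le\iota_n\Bigr)=1$$ for any sequence $\iota_n>0$ such that $\iota_n/n\to0$ and $\iota_n^{-2}\delta^{-2}n\to0$. -/

import Mathlib

open MeasureTheory ProbabilityTheory Filter Topology
open scoped NNReal ENNReal MatrixOrder Matrix.Norms.L2Operator

noncomputable section

namespace SNCP

/-! ### Self-normalized statistics of a finite stretch of `ℝ^d`-valued data `y 1, …, y n` -/

section Statistic

variable {d : ℕ}

/-- The sample mean `θ̂_{a,b}` of `y a, …, y b` (only used with positive weight for `a ≤ b`). -/
def sampleMean (y : ℕ → Fin d → ℝ) (a b : ℕ) : Fin d → ℝ :=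
  ((b : ℝ) - a + 1)⁻¹ • ∑ t ∈ Finset.Icc a b, y t

/-- The contrast `D*_n(t₁, k, t₂)`. -/
def contrast (y : ℕ → Fin d → ℝ) (t₁ k t₂ : ℕ) : Fin d → ℝ :=
  ((((k : ℝ) - t₁ + 1) * ((t₂ : ℝ) - k)) / ((t₂ : ℝ) - t₁ + 1) ^ (3 / 2 : ℝ)) •
    (sampleMean y t₁ k - sampleMean y (k + 1) t₂)

/-- The left part `L*_n(t₁, k, t₂)` of the self-normalizer. -/
def leftNormalizer (y : ℕ → Fin d → ℝ) (t₁ k t₂ : ℕ) : Matrix (Fin d) (Fin d) ℝ :=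
  ∑ i ∈ Finset.Icc t₁ k,
    ((((i : ℝ) - t₁ + 1) ^ 2 * ((k : ℝ) - i) ^ 2) /
        (((t₂ : ℝ) - t₁ + 1) ^ 2 * ((k : ℝ) - t₁ + 1) ^ 2)) •
      Matrix.vecMulVec (sampleMean y t₁ i - sampleMean y (i + 1) k)
        (sampleMean y t₁ i - sampleMean y (i + 1) k)

/-- The right part `R*_n(t₁, k, t₂)` of the self-normalizer. -/
def rightNormalizer (y : ℕ → Fin d → ℝ) (t₁ k t₂ : ℕ) : Matrix (Fin d) (Fin d) ℝ :=
  ∑ i ∈ Finset.Icc (k + 1) t₂,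
    ((((t₂ : ℝ) - i + 1) ^ 2 * ((i : ℝ) - 1 - k) ^ 2) /
        (((t₂ : ℝ) - t₁ + 1) ^ 2 * ((t₂ : ℝ) - k) ^ 2)) •
      Matrix.vecMulVec (sampleMean y i t₂ - sampleMean y (k + 1) (i - 1))
        (sampleMean y i t₂ - sampleMean y (k + 1) (i - 1))

/-- The self-normalizer `V*_n = L*_n + R*_n`. -/
def normalizer (y : ℕ → Fin d → ℝ) (t₁ k t₂ : ℕ) : Matrix (Fin d) (Fin d) ℝ :=
  leftNormalizer y t₁ k t₂ + rightNormalizer y t₁ k t₂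

/-- The self-normalized statistic `T*_n(t₁, k, t₂) = D*ᵀ V*⁻¹ D*`. -/
def snStat (y : ℕ → Fin d → ℝ) (t₁ k t₂ : ℕ) : ℝ :=
  contrast y t₁ k t₂ ⬝ᵥ ((normalizer y t₁ k t₂)⁻¹).mulVec (contrast y t₁ k t₂)

/-- The maximum of `f` over the finite set `s`, with the convention that it is `0` for `s = ∅`. -/
def maxOrZero {α : Type*} (s : Finset α) (f : α → ℝ) : ℝ :=
  if hs : s.Nonempty then s.sup' hs f else 0

/-- The nested window set `H_{1:n}(k)` for the window size `h`: all pairs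
`(k - j₁ h + 1, k + j₂ h)` with `1 ≤ j₁ ≤ ⌊k / h⌋` and `1 ≤ j₂ ≤ ⌊(n - k) / h⌋`. -/
def nestedWindows (n h k : ℕ) : Finset (ℕ × ℕ) :=
  (Finset.Icc 1 (k / h) ×ˢ Finset.Icc 1 ((n - k) / h)).image
    fun j => (k + 1 - j.1 * h, k + j.2 * h)

/-- `H_{s:e}(k)`: the windows of `H_{1:n}(k)` that lie in `{s, …, e}`. -/
def nestedWindowsIn (n h s e k : ℕ) : Finset (ℕ × ℕ) :=
  (nestedWindows n h k).filter fun p => s ≤ p.1 ∧ p.1 < p.2 ∧ p.2 ≤ e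

/-- The maximal statistic `T*_{s,e}(k)` on the subsample `{s, …, e}`. -/
def maxStat (y : ℕ → Fin d → ℝ) (n h s e k : ℕ) : ℝ :=
  maxOrZero (nestedWindowsIn n h s e k) fun p => snStat y p.1 k p.2

/-- `max_{k = 1, …, n} T*_{1,n}(k)`. -/
def globalMaxStat (y : ℕ → Fin d → ℝ) (n h : ℕ) : ℝ :=
  maxOrZero (Finset.Icc 1 n) fun k => maxStat y n h 1 n k

end Statistic

/-- The window size `h = ⌊n ε⌋`. -/
def windowSize (ε : ℝ) (n : ℕ) : ℕ := ⌊(n : ℝ) * ε⌋₊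

/-! ### The segmentation algorithm -/

/-- `IsOutput T K h s e S`: the recursive procedure `SNCP(s, e, K, h)`, run with the subsample
statistics `T s e k`, can return the set `S` of estimated change-points.
An arbitrary maximizer may be picked wherever the `argmax` is not unique. -/
inductive IsOutput (T : ℕ → ℕ → ℕ → ℝ) (K : ℝ) (h : ℕ) : ℕ → ℕ → Finset ℕ → Prop
  | tooShort {s e : ℕ} (hlen : e + 1 < s + 2 * h) : IsOutput T K h s e ∅
  | noChange {s e k : ℕ} (hlen : ¬ e + 1 < s + 2 * h) (hk : k ∈ Finset.Icc s e)
      (hmax : ∀ k' ∈ Finset.Icc s e, T s e k' ≤ T s e k) (hle : T s e k ≤ K) :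
      IsOutput T K h s e ∅
  | change {s e k : ℕ} {S₁ S₂ : Finset ℕ} (hlen : ¬ e + 1 < s + 2 * h)
      (hk : k ∈ Finset.Icc s e) (hmax : ∀ k' ∈ Finset.Icc s e, T s e k' ≤ T s e k)
      (hgt : K < T s e k) (hleft : IsOutput T K h s k S₁)
      (hright : IsOutput T K h (k + 1) e S₂) :
      IsOutput T K h s e (insert k (S₁ ∪ S₂))

/-- `S` is an output of SNCP on the data `y 1, …, y n` with threshold `K` and window parameter
`ε`. -/
def IsEstimate {d : ℕ} (ε : ℝ) (y : ℕ → Fin d → ℝ) (n : ℕ) (K : ℝ) (S : Finset ℕ) : Prop :=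
  IsOutput (maxStat y n (windowSize ε n)) K (windowSize ε n) 1 n S

/-! ### The multiple mean change model -/

/-- Data with piecewise constant mean: `x t + θ i` for `k i < t ≤ k (i + 1)`, `i = 0, …, m`
(the change-points are `k 1, …, k m`, with `k 0 = 0` and `k (m + 1) = n`). -/
def piecewiseShift {d m : ℕ} (k : Fin (m + 2) → ℕ) (θ : Fin (m + 1) → Fin d → ℝ)
    (x : ℕ → Fin d → ℝ) (t : ℕ) : Fin d → ℝ :=
  x t + ∑ i : Fin (m + 1), if k i.castSucc < t ∧ t ≤ k i.succ then θ i else 0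

/-- Strict stationarity of `X 1, X 2, …`. -/
def IsStationary {Ω : Type*} [MeasurableSpace Ω] {d : ℕ} (X : ℕ → Ω → Fin d → ℝ)
    (P : Measure Ω) : Prop :=
  ∀ s : ℕ, IdentDistrib (fun ω (t : ℕ) => X (t + 1 + s) ω) (fun ω (t : ℕ) => X (t + 1) ω) P P

/-! ### The space `D([0,1], ℝ^d)` with the Skorokhod topology -/

/-- Càdlàg functions `[0,1] → ℝ^d`: right-continuous with left limits. -/
structure Cadlag (d : ℕ) where
  /-- The underlying function. -/
  toFun : unitInterval → Fin d → ℝ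
  right_cont : ∀ t, ContinuousWithinAt toFun (Set.Ici t) t
  left_lim : ∀ t, ∃ l, Tendsto toFun (𝓝[<] t) (𝓝 l)

namespace Cadlag

variable {d : ℕ}

/-- The size of the time change `l` together with the uniform distance after the time change. -/
def timeChangeDist (f g : Cadlag d) (l : unitInterval ≃o unitInterval) : ℝ≥0∞ :=
  max (⨆ t, edist (l t) t) (⨆ t, edist (f.toFun t) (g.toFun (l t)))

/-- Skorokhod's (J1) distance: the infimum over the increasing bijections of `[0,1]`. -/
def skorokhodDist (f g : Cadlag d) : ℝ≥0∞ := ⨅ l, timeChangeDist f g l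

theorem timeChangeDist_symm (f g : Cadlag d) (l : unitInterval ≃o unitInterval) :
    timeChangeDist g f l.symm ≤ timeChangeDist f g l := by
  refine max_le_max (iSup_le fun t => ?_) (iSup_le fun t => ?_)
  · refine le_iSup_of_le (l.symm t) ?_
    rw [l.apply_symm_apply, edist_comm]
  · refine le_iSup_of_le (l.symm t) ?_
    rw [l.apply_symm_apply, edist_comm]

theorem timeChangeDist_trans (f g k : Cadlag d) (l l' : unitInterval ≃o unitInterval) :
    timeChangeDist f k (l.trans l') ≤ timeChangeDist f g l + timeChangeDist g k l' := by
  refine max_le (iSup_le fun t => ?_) (iSup_le fun t => ?_)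
  · rw [add_comm]
    refine (edist_triangle _ (l t) _).trans (add_le_add ?_ ?_)
    · exact le_max_of_le_left (le_iSup (fun t => edist (l' t) t) (l t))
    · exact le_max_of_le_left (le_iSup (fun t => edist (l t) t) t)
  · refine (edist_triangle _ (g.toFun (l t)) _).trans (add_le_add ?_ ?_)
    · exact le_max_of_le_right (le_iSup (fun t => edist (f.toFun t) (g.toFun (l t))) t)
    · exact le_max_of_le_right
        (le_iSup (fun t => edist (g.toFun t) (k.toFun (l' t))) (l t))

/-- The topology of `D([0,1], ℝ^d)` is the one of Skorokhod's distance. -/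
instance instPseudoEMetricSpace : PseudoEMetricSpace (Cadlag d) where
  edist := skorokhodDist
  edist_self f := by
    refine le_antisymm ((iInf_le _ (OrderIso.refl _)).trans ?_) (zero_le)
    simp [timeChangeDist]
  edist_comm f g := by
    refine le_antisymm (le_iInf fun l => ?_) (le_iInf fun l => ?_)
    · exact (iInf_le _ l.symm).trans (timeChangeDist_symm g f l)
    · exact (iInf_le _ l.symm).trans (timeChangeDist_symm f g l)
  edist_triangle f g k := by
    refine ENNReal.le_iInf_add_iInf fun l l' => ?_
    exact (iInf_le _ (l.trans l')).trans (timeChangeDist_trans f g k l l')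

/-- Its Borel `σ`-algebra. -/
instance instMeasurableSpace : MeasurableSpace (Cadlag d) := borel (Cadlag d)

instance instBorelSpace : BorelSpace (Cadlag d) := ⟨rfl⟩

/-- A continuous function as an element of `D([0,1], ℝ^d)`. -/
def ofContinuous (f : unitInterval → Fin d → ℝ) (hf : Continuous f) : Cadlag d where
  toFun := f
  right_cont _ := hf.continuousWithinAt
  left_lim t := ⟨f t, hf.continuousAt.mono_left nhdsWithin_le_nhds⟩

end Cadlag

theorem floor_eventually_right (n : ℕ) (t : unitInterval) :
    ∀ᶠ r : unitInterval in 𝓝[≥] t, ⌊(n : ℝ) * r⌋₊ = ⌊(n : ℝ) * t⌋₊ := by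
  have hc : Continuous fun r : unitInterval => (n : ℝ) * r := by fun_prop
  have h1 : ∀ᶠ r : unitInterval in 𝓝[≥] t, (n : ℝ) * r < ⌊(n : ℝ) * t⌋₊ + 1 :=
    (hc.continuousAt.eventually_lt continuousAt_const (Nat.lt_floor_add_one _)).filter_mono
      nhdsWithin_le_nhds
  filter_upwards [h1, self_mem_nhdsWithin] with r hr htr
  have h0 : (0 : ℝ) ≤ (n : ℝ) * t := mul_nonneg (Nat.cast_nonneg _) t.2.1
  have hle : (n : ℝ) * t ≤ (n : ℝ) * r :=
    mul_le_mul_of_nonneg_left (Subtype.coe_le_coe.2 htr) (Nat.cast_nonneg _)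
  exact (Nat.floor_eq_iff (h0.trans hle)).2 ⟨(Nat.floor_le h0).trans hle, hr⟩

theorem floor_eventually_left (n : ℕ) (t : unitInterval) :
    ∃ c : ℕ, ∀ᶠ r : unitInterval in 𝓝[<] t, ⌊(n : ℝ) * r⌋₊ = c := by
  rcases Nat.eq_zero_or_pos n with rfl | hn
  · exact ⟨0, by simp⟩
  have hn' : (0 : ℝ) < n := Nat.cast_pos.2 hn
  have hc : Continuous fun r : unitInterval => (n : ℝ) * r := by fun_prop
  have h1 : ∀ᶠ r : unitInterval in 𝓝[<] t, (⌈(n : ℝ) * t⌉₊ : ℝ) - 1 < (n : ℝ) * r :=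
    (continuousAt_const.eventually_lt hc.continuousAt (by
      have := Nat.ceil_lt_add_one (mul_nonneg (Nat.cast_nonneg n) t.2.1)
      linarith)).filter_mono nhdsWithin_le_nhds
  refine ⟨⌈(n : ℝ) * t⌉₊ - 1, ?_⟩
  filter_upwards [h1, self_mem_nhdsWithin] with r hr hrt
  have hlt : (n : ℝ) * r < (n : ℝ) * t := mul_lt_mul_of_pos_left (Subtype.coe_lt_coe.2 hrt) hn'
  have h0 : (0 : ℝ) ≤ (n : ℝ) * r := mul_nonneg (Nat.cast_nonneg _) r.2.1
  have hpos : 1 ≤ ⌈(n : ℝ) * t⌉₊ := Nat.ceil_pos.2 (h0.trans_lt hlt)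
  refine (Nat.floor_eq_iff h0).2 ⟨?_, ?_⟩
  · push_cast [Nat.cast_sub hpos]
    exact hr.le
  · push_cast [Nat.cast_sub hpos]
    have := Nat.le_ceil ((n : ℝ) * t)
    linarith

/-- The partial sum path `r ↦ n^{-1/2} ∑_{t = 1}^{⌊n r⌋} x t`, an element of `D([0,1], ℝ^d)`. -/
def partialSumPath {d : ℕ} (x : ℕ → Fin d → ℝ) (n : ℕ) : Cadlag d where
  toFun r := (Real.sqrt n)⁻¹ • ∑ t ∈ Finset.Icc 1 ⌊(n : ℝ) * r⌋₊, x t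
  right_cont t := by
    refine tendsto_const_nhds.congr' ?_
    filter_upwards [floor_eventually_right n t] with r hr
    rw [hr]
  left_lim t := by
    obtain ⟨c, hc⟩ := floor_eventually_left n t
    refine ⟨(Real.sqrt n)⁻¹ • ∑ t ∈ Finset.Icc 1 c, x t, tendsto_const_nhds.congr' ?_⟩
    filter_upwards [hc] with r hr
    rw [hr]

/-! ### Brownian motion and the limiting null distribution -/

/-- A `d`-dimensional standard Brownian motion with continuous paths: independent real standard
Brownian motions as coordinates. -/
structure IsBrownianVec {Ω : Type*} [MeasurableSpace Ω] {d : ℕ} (B : Fin d → ℝ≥0 → Ω → ℝ)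
    (P : Measure Ω) : Prop where
  coord : ∀ a, IsBrownianReal (B a) P
  indep : iIndepFun (fun a ω (t : ℝ≥0) => B a t ω) P
  cont : ∀ a ω, Continuous fun t => B a t ω

/-- The path `r ↦ A B(r)`, `0 ≤ r ≤ 1`, as an element of `D([0,1], ℝ^d)`. -/
def brownianPath {Ω : Type*} [MeasurableSpace Ω] {d : ℕ} {B : Fin d → ℝ≥0 → Ω → ℝ}
    {P : Measure Ω} (hB : IsBrownianVec B P) (A : Matrix (Fin d) (Fin d) ℝ) (ω : Ω) : Cadlag d :=
  Cadlag.ofContinuous (fun r => A.mulVec fun a => B a (unitInterval.toNNReal r) ω)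
    (Continuous.matrix_mulVec continuous_const
      (continuous_pi fun a => (hB.cont a ω).comp unitInterval.toNNReal_continuous))

section Limit

variable {d : ℕ}

/-- `Δ(u₁, u, u₂) = w(u) - w(u₁) - (u - u₁) / (u₂ - u₁) (w(u₂) - w(u₁))`. -/
def bridge (w : ℝ → Fin d → ℝ) (u₁ u u₂ : ℝ) : Fin d → ℝ :=
  w u - w u₁ - ((u - u₁) / (u₂ - u₁)) • (w u₂ - w u₁)

/-- `D*(u₁, u, u₂)`. -/
def limContrast (w : ℝ → Fin d → ℝ) (u₁ u u₂ : ℝ) : Fin d → ℝ :=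
  (Real.sqrt (u₂ - u₁))⁻¹ • bridge w u₁ u u₂

/-- `V*(u₁, u, u₂)`, entry by entry. -/
def limNormalizer (w : ℝ → Fin d → ℝ) (u₁ u u₂ : ℝ) : Matrix (Fin d) (Fin d) ℝ :=
  Matrix.of fun a b => ((u₂ - u₁) ^ 2)⁻¹ *
    ((∫ s in u₁..u, bridge w u₁ s u a * bridge w u₁ s u b) +
      ∫ s in u..u₂, bridge w u s u₂ a * bridge w u s u₂ b)

/-- `D*ᵀ V*⁻¹ D*` at `(u₁, u, u₂)`. -/
def limStat (w : ℝ → Fin d → ℝ) (u₁ u u₂ : ℝ) : ℝ :=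
  limContrast w u₁ u u₂ ⬝ᵥ ((limNormalizer w u₁ u u₂)⁻¹).mulVec (limContrast w u₁ u u₂)

/-- The scaled nested window set `H_ε(u)`. -/
def limWindows (ε u : ℝ) : Set (ℝ × ℝ) :=
  {p | ∃ j₁ j₂ : ℕ, 1 ≤ j₁ ∧ j₁ ≤ ⌊u / ε⌋₊ ∧ 1 ≤ j₂ ∧ j₂ ≤ ⌊(1 - u) / ε⌋₊ ∧
    p = (u - j₁ * ε, u + j₂ * ε)}

/-- `sup_{u ∈ U} max_{(u₁, u₂) ∈ H_ε(u)} D*ᵀ V*⁻¹ D*` along the path `w`. -/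
def supLimStat (U : Set ℝ) (ε : ℝ) (w : ℝ → Fin d → ℝ) : ℝ :=
  sSup {x | ∃ u ∈ U, ∃ p ∈ limWindows ε u, x = limStat w p.1 u p.2}

end Limit

end SNCP

end

namespace SNCP

/-! ### The statistic in terms of partial sums -/

section PartialSums

variable {d : ℕ}

/-! Write the data as `y t = √n (Z t - Z (t - 1))`. Contrast and normalizer are then built from
discrete bridges of `Z` alone (`contrast_eq`, `normalizer_eq`), and a bridge ignores affine
summands, so a constant mean drops out. Every statistic thus becomes a functional of the partial sum
path, and both claims reduce to deterministic statements about paths that converge to a continuous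
path `f`.

The property required of `f` is `Nondegenerate`: no nontrivial combination of its coordinates is
affine on an interval. It makes the limiting normalizer positive definite. Brownian paths have it
almost surely (`IsBrownianVec.ae_nondegenerate`), by a strong law for normalized increments over
shrinking intervals. Deterministic convergence is transferred to probability by a mapping theorem
for functionals that depend on `n` (`limsup_measure_mem_le`).

For (i), only finitely many window types `(j₁, j₂)` occur and the location varies in a compact set,
so the discrete maximum converges to the supremum (`ContConv.tendsto_globalMaxStat`). A linear map
`A` turns `D` into `A D` and `V` into `A V Aᵀ`, which removes the covariance from the limit.

For (ii), in the smallest symmetric window around a change-point the mean is constant on each half.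
The normalizer does not see the jump while the contrast is shifted by order `√n δ`, so the statistic
is at least of order `n δ²` (`MeanChange.exists_signal_le_snStat`). Elsewhere a window may contain
several changes that inflate contrast and normalizer together. The bound comes from
self-normalization: with `w = V⁻¹ D` one has `T = w ⬝ D = wᵀ V w`, and `(w ⬝ D)²` is bounded by a
constant times `wᵀ V w`, using only the part of `V` near `k`; hence `T² ≤ C T`
(`snStat_le_of_kink`). The constant is of order `(1 + 1/x)²` if the nearest change-point is at
relative distance `x`. At distance more than `ι` this is `o(n δ²)`; at distance of almost a window
it is bounded, hence below `K_n`.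

These three bounds suffice for the algorithm (`isOutput_correct`): each segment it visits has
endpoints near true change-points (or `0`, `n`), and it splits exactly when a true change-point lies
strictly between, at a point close to such a one. -/

/-- The discrete bridge `Z i - Z a - (i - a) / (k - a) (Z k - Z a)`. -/
noncomputable def dbridge (Z : ℕ → Fin d → ℝ) (a i k : ℕ) : Fin d → ℝ :=
  Z i - Z a - (((i : ℝ) - a) / ((k : ℝ) - a)) • (Z k - Z a)

/-- The matrix `∑_{i ∈ (a, k]} Z_{a,i,k} Z_{a,i,k}ᵀ + ∑_{i ∈ (k, e]} Z_{k,i,e} Z_{k,i,e}ᵀ` of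
discrete bridges, divided by `n`. -/
noncomputable def bridgeGram (Z : ℕ → Fin d → ℝ) (n a k e : ℕ) : Matrix (Fin d) (Fin d) ℝ :=
  (n : ℝ)⁻¹ • (∑ i ∈ Finset.Ioc a k, Matrix.vecMulVec (dbridge Z a i k) (dbridge Z a i k) +
    ∑ i ∈ Finset.Ioc k e, Matrix.vecMulVec (dbridge Z k i e) (dbridge Z k i e))

theorem dbridge_left (Z : ℕ → Fin d → ℝ) (a k : ℕ) : dbridge Z a a k = 0 := by
  simp [dbridge]

theorem dbridge_right (Z : ℕ → Fin d → ℝ) {a k : ℕ} (h : a < k) : dbridge Z a k k = 0 := by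
  have : (k : ℝ) - a ≠ 0 := sub_ne_zero.2 (by exact_mod_cast h.ne')
  simp [dbridge, div_self this]

/-- Subtracting the chord cancels an affine summand. The relation is required at the three indices
only, so it can be used on a single linear piece of a piecewise linear drift. -/
theorem dbridge_add_affine {Z Z' : ℕ → Fin d → ℝ} {a i k : ℕ} (P Q : Fin d → ℝ) (c : ℝ)
    (hak : a < k) (ha : Z' a = Z a + P + ((a : ℝ) / c) • Q)
    (hi : Z' i = Z i + P + ((i : ℝ) / c) • Q) (hk : Z' k = Z k + P + ((k : ℝ) / c) • Q) :
    dbridge Z' a i k = dbridge Z a i k := by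
  have : (k : ℝ) - a ≠ 0 := sub_ne_zero.2 (by exact_mod_cast hak.ne')
  ext j
  simp only [dbridge, ha, hi, hk, Pi.sub_apply, Pi.add_apply, Pi.smul_apply, smul_eq_mul]
  rcases eq_or_ne c 0 with rfl | hc
  · simp
  · field_simp
    ring

theorem dbridge_comp_div (w : ℝ → Fin d → ℝ) {n : ℕ} (hn : n ≠ 0) (a i k : ℕ) :
    dbridge (fun m => w ((m : ℝ) / n)) a i k =
      bridge w ((a : ℝ) / n) ((i : ℝ) / n) ((k : ℝ) / n) := by
  have : (n : ℝ) ≠ 0 := by exact_mod_cast hn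
  simp only [dbridge, bridge]
  rw [← sub_div, ← sub_div, div_div_div_cancel_right₀ this]

theorem bridgeGram_congr {Z Z' : ℕ → Fin d → ℝ} {n a k e : ℕ}
    (h₁ : ∀ i ∈ Finset.Ioc a k, dbridge Z a i k = dbridge Z' a i k)
    (h₂ : ∀ i ∈ Finset.Ioc k e, dbridge Z k i e = dbridge Z' k i e) :
    bridgeGram Z n a k e = bridgeGram Z' n a k e := by
  unfold bridgeGram
  congr 2
  · exact Finset.sum_congr rfl fun i hi => by rw [h₁ i hi]
  · exact Finset.sum_congr rfl fun i hi => by rw [h₂ i hi]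

theorem dotProduct_bridgeGram_mulVec (Z : ℕ → Fin d → ℝ) (n a k e : ℕ) (x : Fin d → ℝ) :
    x ⬝ᵥ (bridgeGram Z n a k e).mulVec x =
      (n : ℝ)⁻¹ * (∑ i ∈ Finset.Ioc a k, (x ⬝ᵥ dbridge Z a i k) ^ 2 +
        ∑ i ∈ Finset.Ioc k e, (x ⬝ᵥ dbridge Z k i e) ^ 2) := by
  have key : ∀ v : Fin d → ℝ, x ⬝ᵥ (Matrix.vecMulVec v v).mulVec x = (x ⬝ᵥ v) ^ 2 := by
    intro v
    rw [Matrix.vecMulVec_mulVec]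
    simp [dotProduct_comm v x, sq]
  simp only [bridgeGram, Matrix.smul_mulVec, Matrix.add_mulVec, Matrix.sum_mulVec,
    dotProduct_smul, dotProduct_add, dotProduct_sum, key, smul_eq_mul]

/-! ### Contrast and normalizer as bridges of rescaled partial sums -/

variable {y Z : ℕ → Fin d → ℝ} {n : ℕ}

theorem sum_Icc_eq (hy : ∀ t, 1 ≤ t → t ≤ n → y t = Real.sqrt n • (Z t - Z (t - 1)))
    {a k : ℕ} (hak : a ≤ k) (hk : k ≤ n) :
    ∑ t ∈ Finset.Icc (a + 1) k, y t = Real.sqrt n • (Z k - Z a) := by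
  induction k, hak using Nat.le_induction with
  | base => simp
  | succ k hak ih =>
    rw [Finset.sum_Icc_succ_top (by omega), ih (by omega), hy (k + 1) (by omega) hk, ← smul_add]
    simp

theorem sampleMean_eq (hy : ∀ t, 1 ≤ t → t ≤ n → y t = Real.sqrt n • (Z t - Z (t - 1)))
    {a k : ℕ} (hak : a ≤ k) (hk : k ≤ n) :
    sampleMean y (a + 1) k = ((k : ℝ) - a)⁻¹ • Real.sqrt n • (Z k - Z a) := by
  rw [sampleMean, sum_Icc_eq hy hak hk]
  congr 2
  push_cast
  ring

/-- `(k - a)(e - k)/(e - a)` times the difference of the two chord slopes is the bridge at `k`; the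
remaining powers of `e - a` and `n` form the square root. -/
theorem contrast_eq (hy : ∀ t, 1 ≤ t → t ≤ n → y t = Real.sqrt n • (Z t - Z (t - 1)))
    {a k e : ℕ} (hak : a < k) (hke : k < e) (he : e ≤ n) :
    contrast y (a + 1) k e = (Real.sqrt (((e : ℝ) - a) / n))⁻¹ • dbridge Z a k e := by
  rw [contrast, sampleMean_eq hy hak.le (by omega), sampleMean_eq hy hke.le he]
  have hak' : (0 : ℝ) < (k : ℝ) - a := sub_pos.2 (by exact_mod_cast hak)
  have hke' : (0 : ℝ) < (e : ℝ) - k := sub_pos.2 (by exact_mod_cast hke)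
  have hae' : (0 : ℝ) < (e : ℝ) - a := by linarith
  have hn : (0 : ℝ) < n := by exact_mod_cast (show 0 < n by omega)
  have hs : (0 : ℝ) < Real.sqrt ((e : ℝ) - a) := Real.sqrt_pos.2 hae'
  have hsn : (0 : ℝ) < Real.sqrt n := Real.sqrt_pos.2 hn
  have h32 : ((e : ℝ) - a) ^ (3 / 2 : ℝ) = ((e : ℝ) - a) * Real.sqrt ((e : ℝ) - a) := by
    rw [Real.sqrt_eq_rpow, ← Real.rpow_one_add' hae'.le (by norm_num)]
    norm_num
  rw [Real.sqrt_div hae'.le]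
  push_cast
  rw [show (e : ℝ) - (a + 1) + 1 = e - a by ring, show (k : ℝ) - (a + 1) + 1 = k - a by ring, h32]
  ext j
  simp only [dbridge, Pi.sub_apply, Pi.smul_apply, smul_eq_mul]
  field_simp
  ring

theorem leftNormalizer_eq (hy : ∀ t, 1 ≤ t → t ≤ n → y t = Real.sqrt n • (Z t - Z (t - 1)))
    {a k e : ℕ} (hak : a < k) (hke : k < e) (he : e ≤ n) :
    leftNormalizer y (a + 1) k e = ((((e : ℝ) - a) / n) ^ 2)⁻¹ • (n : ℝ)⁻¹ •
      ∑ i ∈ Finset.Ioc a k, Matrix.vecMulVec (dbridge Z a i k) (dbridge Z a i k) := by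
  have hak' : (0 : ℝ) < (k : ℝ) - a := sub_pos.2 (by exact_mod_cast hak)
  have hke' : (0 : ℝ) < (e : ℝ) - k := sub_pos.2 (by exact_mod_cast hke)
  have hae' : (0 : ℝ) < (e : ℝ) - a := by linarith
  have hn : (0 : ℝ) < n := by exact_mod_cast (show 0 < n by omega)
  have hsn : (0 : ℝ) < Real.sqrt n := Real.sqrt_pos.2 hn
  have hsq : Real.sqrt n * Real.sqrt n = n := Real.mul_self_sqrt hn.le
  rw [leftNormalizer, Finset.smul_sum, Finset.smul_sum]
  refine Finset.sum_congr (by ext; simp) fun i hi => ?_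
  obtain ⟨hi1, hi2⟩ := Finset.mem_Ioc.1 hi
  have hai : (0 : ℝ) < (i : ℝ) - a := sub_pos.2 (by exact_mod_cast hi1)
  rcases hi2.eq_or_lt with rfl | hik
  -- The last index has weight zero on one side and a vanishing bridge on the other.
  · simp [dbridge_right Z hak]
  have hik' : (0 : ℝ) < (k : ℝ) - i := sub_pos.2 (by exact_mod_cast hik)
  rw [sampleMean_eq hy (by omega) (by omega), sampleMean_eq hy hi2 (by omega)]
  push_cast
  rw [show (e : ℝ) - (a + 1) + 1 = e - a by ring, show (k : ℝ) - (a + 1) + 1 = k - a by ring,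
    show (i : ℝ) - (a + 1) + 1 = i - a by ring]
  have hv : ((i : ℝ) - a)⁻¹ • Real.sqrt n • (Z i - Z a) - ((k : ℝ) - i)⁻¹ •
      Real.sqrt n • (Z k - Z i) = (Real.sqrt n * ((k : ℝ) - a) / (((i : ℝ) - a) * ((k : ℝ) - i))) •
        dbridge Z a i k := by
    ext j
    simp only [dbridge, Pi.sub_apply, Pi.smul_apply, smul_eq_mul]
    field_simp
    ring
  rw [hv]
  simp only [Matrix.smul_vecMulVec, Matrix.vecMulVec_smul, smul_smul]
  congr 1
  have : Real.sqrt n ^ 2 = n := Real.sq_sqrt hn.le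
  field_simp
  rw [this]

theorem rightNormalizer_eq (hy : ∀ t, 1 ≤ t → t ≤ n → y t = Real.sqrt n • (Z t - Z (t - 1)))
    {a k e : ℕ} (hak : a < k) (hke : k < e) (he : e ≤ n) :
    rightNormalizer y (a + 1) k e = ((((e : ℝ) - a) / n) ^ 2)⁻¹ • (n : ℝ)⁻¹ •
      ∑ i ∈ Finset.Ioc k e, Matrix.vecMulVec (dbridge Z k i e) (dbridge Z k i e) := by
  have hak' : (0 : ℝ) < (k : ℝ) - a := sub_pos.2 (by exact_mod_cast hak)
  have hke' : (0 : ℝ) < (e : ℝ) - k := sub_pos.2 (by exact_mod_cast hke)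
  have hae' : (0 : ℝ) < (e : ℝ) - a := by linarith
  have hn : (0 : ℝ) < n := by exact_mod_cast (show 0 < n by omega)
  have hsn : (0 : ℝ) < Real.sqrt n := Real.sqrt_pos.2 hn
  -- The right normalizer splits the block after `i - 1`, so its sum is the bridge sum shifted by
  -- one; both boundary terms vanish.
  have hshift : ∑ i ∈ Finset.Ioc k e, Matrix.vecMulVec (dbridge Z k i e) (dbridge Z k i e) =
      ∑ i ∈ Finset.Icc (k + 1) e,
        Matrix.vecMulVec (dbridge Z k (i - 1) e) (dbridge Z k (i - 1) e) := by
    rw [show Finset.Icc (k + 1) e = Finset.Ico (k + 1) (e + 1) from rfl,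
      ← Finset.sum_Ico_add' _ k e 1, show Finset.Ioc k e = Finset.Ico (k + 1) (e + 1) by ext; simp,
      Finset.sum_Ico_succ_top (by omega), Finset.sum_eq_sum_Ico_succ_bot hke]
    simp [dbridge_left, dbridge_right Z hke]
  rw [rightNormalizer, hshift, Finset.smul_sum, Finset.smul_sum]
  refine Finset.sum_congr rfl fun i hi => ?_
  obtain ⟨hi1, hi2⟩ := Finset.mem_Icc.1 hi
  obtain ⟨i, rfl⟩ : ∃ i', i = i' + 1 := ⟨i - 1, by omega⟩
  have hki : k ≤ i := by omega
  simp only [Nat.add_sub_cancel]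
  rcases hki.eq_or_lt with rfl | hki
  · simp [dbridge_left]
  have hie' : (0 : ℝ) < (e : ℝ) - i := sub_pos.2 (by exact_mod_cast hi2)
  have hki' : (0 : ℝ) < (i : ℝ) - k := sub_pos.2 (by exact_mod_cast hki)
  rw [sampleMean_eq hy (by omega) he, sampleMean_eq hy (by omega) (by omega)]
  push_cast
  rw [show (e : ℝ) - (a + 1) + 1 = e - a by ring, show (e : ℝ) - (i + 1) + 1 = e - i by ring,
    show (i : ℝ) + 1 - 1 - k = i - k by ring]
  have hv : ((e : ℝ) - i)⁻¹ • Real.sqrt n • (Z e - Z i) - ((i : ℝ) - k)⁻¹ •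
      Real.sqrt n • (Z i - Z k) = (-(Real.sqrt n * ((e : ℝ) - k) / (((i : ℝ) - k) * ((e : ℝ) - i)))) •
        dbridge Z k i e := by
    ext j
    simp only [dbridge, Pi.sub_apply, Pi.smul_apply, smul_eq_mul]
    field_simp
    ring
  rw [hv]
  simp only [Matrix.smul_vecMulVec, Matrix.vecMulVec_smul, smul_smul]
  congr 1
  have : Real.sqrt n ^ 2 = n := Real.sq_sqrt hn.le
  field_simp
  rw [this]

theorem normalizer_eq (hy : ∀ t, 1 ≤ t → t ≤ n → y t = Real.sqrt n • (Z t - Z (t - 1)))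
    {a k e : ℕ} (hak : a < k) (hke : k < e) (he : e ≤ n) :
    normalizer y (a + 1) k e = ((((e : ℝ) - a) / n) ^ 2)⁻¹ • bridgeGram Z n a k e := by
  rw [normalizer, leftNormalizer_eq hy hak hke he, rightNormalizer_eq hy hak hke he, bridgeGram,
    ← smul_add, ← smul_add]

end PartialSums

end SNCP

namespace SNCP

/-! ### Continuous convergence and Riemann sums -/

section ContinuousConvergence

variable {ι : Type*} {L : Filter ι} {N : ι → ℕ}

/-- Continuous convergence of the functions `F i` on `ℝ` to `f` along `L`. -/
def ContConv {E : Type*} [TopologicalSpace E] (L : Filter ι) (F : ι → ℝ → E) (f : ℝ → E) : Prop :=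
  ∀ x, Tendsto (fun p : ι × ℝ => F p.1 p.2) (L ×ˢ 𝓝 x) (𝓝 (f x))

theorem ContConv.tendsto_comp {E : Type*} [TopologicalSpace E] {F : ι → ℝ → E} {f : ℝ → E}
    (h : ContConv L F f) {u : ι → ℝ} {x : ℝ} (hu : Tendsto u L (𝓝 x)) :
    Tendsto (fun i => F i (u i)) L (𝓝 (f x)) :=
  (h x).comp (tendsto_id.prodMk hu)

theorem ContConv.mono {E : Type*} [TopologicalSpace E] {F : ι → ℝ → E} {f : ℝ → E}
    (h : ContConv L F f) {L' : Filter ι} (hL : L' ≤ L) : ContConv L' F f :=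
  fun x => (h x).mono_left (Filter.prod_mono hL le_rfl)

/-- Local statements along `L ×ˢ 𝓝 x` become uniform on compact sets by passing to finitely many
neighbourhoods. -/
theorem eventually_forall_mem_of_isCompact {E : Type*} [TopologicalSpace E] {K : Set E}
    (hK : IsCompact K) {p : ι → E → Prop}
    (h : ∀ x ∈ K, ∀ᶠ q : ι × E in L ×ˢ 𝓝 x, p q.1 q.2) : ∀ᶠ i in L, ∀ x ∈ K, p i x := by
  refine hK.induction_on (p := fun s => ∀ᶠ i in L, ∀ x ∈ s, p i x) (by simp)
    (fun s t hst ht => ht.mono fun i hi x hx => hi x (hst hx))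
    (fun s t hs ht => ?_) fun x hx => ?_
  · filter_upwards [hs, ht] with i h1 h2 x hx
    exact hx.elim (h1 x) (h2 x)
  · obtain ⟨pa, ha, pb, hb, hab⟩ := Filter.eventually_prod_iff.1 (h x hx)
    exact ⟨{y | pb y}, mem_nhdsWithin_of_mem_nhds hb, ha.mono fun i hi y hy => hab hi hy⟩

theorem abs_riemannSum_sub_integral_le {φ ψ : ℝ → ℝ} (hψ : Continuous ψ) {n a k : ℕ} {c : ℝ}
    (hak : a ≤ k) (hk : k ≤ n) (hn : n ≠ 0)
    (h : ∀ m ∈ Finset.Ioc a k, ∀ s ∈ Set.Icc (((m : ℝ) - 1) / n) ((m : ℝ) / n),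
      |φ ((m : ℝ) / n) - ψ s| ≤ c) :
    |(n : ℝ)⁻¹ * ∑ m ∈ Finset.Ioc a k, φ ((m : ℝ) / n) - ∫ s in ((a : ℝ) / n)..((k : ℝ) / n), ψ s|
      ≤ (n : ℝ)⁻¹ * ((k : ℝ) - a) * c := by
  have hn' : (0 : ℝ) < n := by exact_mod_cast Nat.pos_of_ne_zero hn
  induction k, hak using Nat.le_induction with
  | base => simp
  | succ k hak ih =>
    have ih' := ih (by omega) fun m hm => h m (by
      rw [Finset.mem_Ioc] at hm ⊢
      omega)
    rw [← Finset.insert_Ioc_right_eq_Ioc_add_one hak, Finset.sum_insert (by simp),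
      ← intervalIntegral.integral_add_adjacent_intervals (b := (k : ℝ) / n)
        (hψ.intervalIntegrable _ _) (hψ.intervalIntegrable _ _)]
    have hstep : |(n : ℝ)⁻¹ * φ (((k + 1 : ℕ) : ℝ) / n) -
        ∫ s in ((k : ℝ) / n)..(((k + 1 : ℕ) : ℝ) / n), ψ s| ≤ (n : ℝ)⁻¹ * c := by
      have hlen : ((k + 1 : ℕ) : ℝ) / n - (k : ℝ) / n = (n : ℝ)⁻¹ := by
        push_cast
        field_simp
        ring
      have hle : (k : ℝ) / n ≤ ((k + 1 : ℕ) : ℝ) / n := by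
        have := inv_pos.2 hn'
        linarith
      have h1 : (n : ℝ)⁻¹ * φ (((k + 1 : ℕ) : ℝ) / n) -
          ∫ s in ((k : ℝ) / n)..(((k + 1 : ℕ) : ℝ) / n), ψ s =
          ∫ s in ((k : ℝ) / n)..(((k + 1 : ℕ) : ℝ) / n), (φ (((k + 1 : ℕ) : ℝ) / n) - ψ s) := by
        rw [intervalIntegral.integral_sub (by simp) (hψ.intervalIntegrable _ _),
          intervalIntegral.integral_const, hlen, smul_eq_mul]
      rw [h1, ← Real.norm_eq_abs]
      refine (intervalIntegral.norm_integral_le_of_norm_le_const (C := c) fun s hs => ?_).trans ?_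
      · rw [Set.uIoc_of_le hle] at hs
        refine h (k + 1) (Finset.mem_Ioc.2 ⟨by omega, le_rfl⟩) s ⟨?_, hs.2⟩
        have := hs.1.le
        push_cast
        simpa using this
      · rw [hlen, abs_of_pos (inv_pos.2 hn'), mul_comm]
    calc _ = |((n : ℝ)⁻¹ * ∑ m ∈ Finset.Ioc a k, φ ((m : ℝ) / n) -
          ∫ s in ((a : ℝ) / n)..((k : ℝ) / n), ψ s) + ((n : ℝ)⁻¹ * φ (((k + 1 : ℕ) : ℝ) / n) -
        ∫ s in ((k : ℝ) / n)..(((k + 1 : ℕ) : ℝ) / n), ψ s)| := by congr 1; ring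
      _ ≤ _ := (abs_add_le _ _).trans (add_le_add ih' hstep)
      _ = _ := by push_cast; ring

/-- By compactness, `F i x` is uniformly close to `f s` for `x` in `[0, 1]` and `s` within one grid
cell of `x`. The sum is therefore compared with the integral over `[a i / N i, k i / N i]`, whose
endpoints then converge. -/
theorem ContConv.tendsto_riemannSum {F : ι → ℝ → ℝ} {f : ℝ → ℝ} (h : ContConv L F f)
    (hf : Continuous f) (hN : Tendsto N L atTop) {a k : ι → ℕ} {α β : ℝ}
    (ha : Tendsto (fun i => (a i : ℝ) / N i) L (𝓝 α))
    (hk : Tendsto (fun i => (k i : ℝ) / N i) L (𝓝 β))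
    (hak : ∀ᶠ i in L, a i ≤ k i) (hkN : ∀ᶠ i in L, k i ≤ N i) :
    Tendsto (fun i => (N i : ℝ)⁻¹ * ∑ m ∈ Finset.Ioc (a i) (k i), F i ((m : ℝ) / N i)) L
      (𝓝 (∫ s in α..β, f s)) := by
  have hint : Tendsto (fun i => ∫ s in ((a i : ℝ) / N i)..((k i : ℝ) / N i), f s) L
      (𝓝 (∫ s in α..β, f s)) := by
    have hc : Continuous fun x => ∫ s in (0 : ℝ)..x, f s :=
      intervalIntegral.continuous_primitive (fun _ _ => hf.intervalIntegrable _ _) 0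
    have := ((hc.tendsto β).comp hk).sub ((hc.tendsto α).comp ha)
    simp only [Function.comp_def] at this
    simp only [intervalIntegral.integral_interval_sub_left (hf.intervalIntegrable _ _)
      (hf.intervalIntegrable _ _)] at this
    exact this
  have hdiff : Tendsto (fun i => (N i : ℝ)⁻¹ * ∑ m ∈ Finset.Ioc (a i) (k i), F i ((m : ℝ) / N i) -
      ∫ s in ((a i : ℝ) / N i)..((k i : ℝ) / N i), f s) L (𝓝 0) := by
    rw [Metric.tendsto_nhds]
    intro c hc
    -- closeness of `F i x` and `f s` for `x`, `s` close to each other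
    have hev : ∀ᶠ i in L, ∀ x ∈ Set.Icc (0 : ℝ) 1, ∀ s ∈ Set.Icc (x - 1 / N i) x,
        |F i x - f s| < c / 2 := by
      refine eventually_forall_mem_of_isCompact isCompact_Icc fun x _ => ?_
      have h1 : ∀ᶠ q : ι × ℝ in L ×ˢ 𝓝 x, |F q.1 q.2 - f x| < c / 4 :=
        (Metric.tendsto_nhds.1 (h x) (c / 4) (by positivity))
      obtain ⟨r, hr, hrf⟩ := Metric.continuous_iff.1 hf x (c / 4) (by positivity)
      have h2 : ∀ᶠ q : ι × ℝ in L ×ˢ 𝓝 x, dist q.2 x < r / 2 :=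
        tendsto_snd.eventually (Metric.ball_mem_nhds x (half_pos hr))
      have h3 : ∀ᶠ q : ι × ℝ in L ×ˢ 𝓝 x, 1 / (N q.1 : ℝ) < r / 2 := by
        have : Tendsto (fun i => 1 / (N i : ℝ)) L (𝓝 0) :=
          tendsto_const_nhds.div_atTop (tendsto_natCast_atTop_atTop.comp hN)
        exact tendsto_fst.eventually (this.eventually_lt_const (half_pos hr))
      filter_upwards [h1, h2, h3] with q h1 h2 h3 s hs
      have hs' : dist s x < r := by
        rw [Real.dist_eq, abs_lt] at h2 ⊢
        constructor <;> linarith [hs.1, hs.2, h2.1, h2.2]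
      have h4 := hrf s hs'
      rw [Real.dist_eq, abs_lt] at h4
      rw [abs_lt] at h1 ⊢
      constructor <;> linarith [h1.1, h1.2, h4.1, h4.2]
    filter_upwards [hev, hak, hkN, hN.eventually_ge_atTop 1] with i hi hak hkN hN1
    have hn' : (0 : ℝ) < N i := by exact_mod_cast hN1
    have := abs_riemannSum_sub_integral_le hf hak hkN (by omega) (φ := F i) (c := c / 2)
      fun m hm s hs => by
        rw [Finset.mem_Ioc] at hm
        refine (hi ((m : ℝ) / N i) ⟨by positivity, ?_⟩ s ⟨?_, hs.2⟩).le
        · rw [div_le_one hn']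
          exact_mod_cast hm.2.trans hkN
        · rw [← sub_div]
          exact hs.1
    rw [Real.dist_eq, sub_zero]
    refine this.trans_lt ?_
    have h1 : (N i : ℝ)⁻¹ * ((k i : ℝ) - a i) ≤ 1 := by
      rw [inv_mul_le_iff₀ hn', mul_one]
      have : (k i : ℝ) ≤ N i := by exact_mod_cast hkN
      linarith [Nat.cast_nonneg (α := ℝ) (a i)]
    nlinarith
  simpa using hdiff.add hint

/-- Uniform lower bound for the quadratic forms of Riemann sums of products of functions that
converge to functions which are linearly independent on `[p, q]`. -/
theorem ContConv.exists_quadratic_lower_bound {J : Type*} [Fintype J] {F : ι → ℝ → J → ℝ}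
    {f : ℝ → J → ℝ} (h : ContConv L F f) (hf : Continuous f) (hN : Tendsto N L atTop) {p q : ℝ}
    (hp : 0 ≤ p) (hpq : p < q) (hq : q ≤ 1)
    (hli : ∀ c : J → ℝ, (∀ s ∈ Set.Icc p q, c ⬝ᵥ f s = 0) → c = 0) :
    ∃ c₀ > 0, ∀ᶠ i in L, ∀ c : J → ℝ, c₀ * (c ⬝ᵥ c) ≤
      (N i : ℝ)⁻¹ * ∑ m ∈ Finset.Ioc ⌊p * N i⌋₊ ⌊q * N i⌋₊, (c ⬝ᵥ F i ((m : ℝ) / N i)) ^ 2 := by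
  have hfc : ∀ c : J → ℝ, Continuous fun s => (c ⬝ᵥ f s) ^ 2 :=
    fun c => (continuous_const.dotProduct hf).pow 2
  have hpos : ∀ c : J → ℝ, c ≠ 0 → 0 < ∫ s in p..q, (c ⬝ᵥ f s) ^ 2 := by
    intro c hc
    have hne : ∃ s ∈ Set.Icc p q, c ⬝ᵥ f s ≠ 0 := by
      by_contra! hcon
      exact hc (hli c hcon)
    obtain ⟨s, hs, hs0⟩ := hne
    exact intervalIntegral.integral_pos hpq (hfc c).continuousOn (fun _ _ => sq_nonneg _)
      ⟨s, hs, by positivity⟩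
  -- The coefficient vector varies along with the index, which is what the compactness argument on
  -- the unit sphere needs.
  have hlim : ∀ c : J → ℝ, Tendsto (fun r : ι × (J → ℝ) => (N r.1 : ℝ)⁻¹ *
      ∑ m ∈ Finset.Ioc ⌊p * N r.1⌋₊ ⌊q * N r.1⌋₊, (r.2 ⬝ᵥ F r.1 ((m : ℝ) / N r.1)) ^ 2)
      (L ×ˢ 𝓝 c) (𝓝 (∫ s in p..q, (c ⬝ᵥ f s) ^ 2)) := by
    intro c
    have hN1 : Tendsto (fun r : ι × (J → ℝ) => N r.1) (L ×ˢ 𝓝 c) atTop := hN.comp tendsto_fst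
    have hNR : Tendsto (fun r : ι × (J → ℝ) => (N r.1 : ℝ)) (L ×ˢ 𝓝 c) atTop :=
      tendsto_natCast_atTop_atTop.comp hN1
    have hfl : ∀ t : ℝ, 0 ≤ t → Tendsto (fun r : ι × (J → ℝ) => (⌊t * N r.1⌋₊ : ℝ) / N r.1)
        (L ×ˢ 𝓝 c) (𝓝 t) := fun t ht => (tendsto_nat_floor_mul_div_atTop ht).comp hNR
    refine ContConv.tendsto_riemannSum (N := fun r : ι × (J → ℝ) => N r.1)
      (a := fun r => ⌊p * N r.1⌋₊) (k := fun r => ⌊q * N r.1⌋₊)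
      (F := fun r s => (r.2 ⬝ᵥ F r.1 s) ^ 2) (fun x => ?_) (hfc c)
      hN1 (hfl p hp) (hfl q (hp.trans hpq.le))
      (Eventually.of_forall fun r => Nat.floor_mono (by gcongr)) (Eventually.of_forall fun r => ?_)
    · have h1 : Tendsto (fun z : (ι × (J → ℝ)) × ℝ => F z.1.1 z.2) ((L ×ˢ 𝓝 c) ×ˢ 𝓝 x)
          (𝓝 (f x)) := (h x).comp ((tendsto_fst.comp tendsto_fst).prodMk tendsto_snd)
      have h2 : Tendsto (fun z : (ι × (J → ℝ)) × ℝ => z.1.2) ((L ×ˢ 𝓝 c) ×ˢ 𝓝 x)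
          (𝓝 c) := tendsto_snd.comp tendsto_fst
      have h3 : Continuous fun z : (J → ℝ) × (J → ℝ) => (z.1 ⬝ᵥ z.2) ^ 2 :=
        (continuous_fst.dotProduct continuous_snd).pow 2
      have h4 := (h3.tendsto (c, f x)).comp (h2.prodMk_nhds h1)
      exact h4
    · refine Nat.floor_le_of_le ?_
      calc q * (N r.1 : ℝ) ≤ 1 * N r.1 := by gcongr
        _ = N r.1 := one_mul _
  -- Without indices the unit sphere is empty and has no minimizer.
  by_cases hJ : IsEmpty J
  · refine ⟨1, one_pos, Eventually.of_forall fun i c => ?_⟩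
    simp only [dotProduct, Finset.univ_eq_empty, Finset.sum_empty, mul_zero]
    positivity
  rw [not_isEmpty_iff] at hJ
  have hcomp : IsCompact {c : J → ℝ | c ⬝ᵥ c = 1} := by
    refine Metric.isCompact_of_isClosed_isBounded
      (isClosed_eq (continuous_id.dotProduct continuous_id) continuous_const) ?_
    refine (Metric.isBounded_closedBall (x := (0 : J → ℝ)) (r := 1)).subset fun c hc => ?_
    rw [mem_closedBall_zero_iff, pi_norm_le_iff_of_nonneg zero_le_one]
    intro j
    have h1 : c j * c j ≤ c ⬝ᵥ c :=
      Finset.single_le_sum (f := fun j => c j * c j) (fun j _ => mul_self_nonneg _)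
        (Finset.mem_univ j)
    rw [show c ⬝ᵥ c = 1 from hc] at h1
    rw [Real.norm_eq_abs, abs_le]
    constructor <;> nlinarith
  have hne : {c : J → ℝ | c ⬝ᵥ c = 1}.Nonempty := by
    classical
    exact ⟨Pi.single hJ.some 1, by simp⟩
  have hcont : Continuous fun c : J → ℝ => ∫ s in p..q, (c ⬝ᵥ f s) ^ 2 := by
    refine intervalIntegral.continuous_parametric_intervalIntegral_of_continuous' ?_ p q
    exact (continuous_fst.dotProduct (hf.comp continuous_snd)).pow 2
  obtain ⟨c₁, hc₁, hmin⟩ := hcomp.exists_isMinOn hne hcont.continuousOn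
  have hc₁0 : c₁ ≠ 0 := by
    rintro rfl
    simp at hc₁
  set κ := ∫ s in p..q, (c₁ ⬝ᵥ f s) ^ 2 with hκ
  have hκ0 : 0 < κ := hpos c₁ hc₁0
  refine ⟨κ / 2, half_pos hκ0, ?_⟩
  have hev : ∀ᶠ i in L, ∀ c ∈ {c : J → ℝ | c ⬝ᵥ c = 1}, κ / 2 <
      (N i : ℝ)⁻¹ * ∑ m ∈ Finset.Ioc ⌊p * N i⌋₊ ⌊q * N i⌋₊, (c ⬝ᵥ F i ((m : ℝ) / N i)) ^ 2 := by
    refine eventually_forall_mem_of_isCompact hcomp fun c hc => ?_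
    have : κ ≤ ∫ s in p..q, (c ⬝ᵥ f s) ^ 2 := hmin hc
    exact (hlim c).eventually_const_lt (by linarith)
  filter_upwards [hev] with i hi c
  rcases eq_or_ne c 0 with rfl | hc
  · simp
  have hcc : 0 < c ⬝ᵥ c := by
    refine lt_of_le_of_ne (Finset.sum_nonneg fun j _ => mul_self_nonneg (c j)) (Ne.symm ?_)
    exact mt dotProduct_self_eq_zero.1 hc
  have hs : 0 < Real.sqrt (c ⬝ᵥ c) := Real.sqrt_pos.2 hcc
  -- Both sides are homogeneous of degree two, so the bound on the sphere extends to all `c`.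
  have := hi ((Real.sqrt (c ⬝ᵥ c))⁻¹ • c) (by
    simp only [smul_dotProduct, dotProduct_smul, smul_eq_mul]
    rw [← mul_assoc, ← mul_inv, Real.mul_self_sqrt hcc.le, inv_mul_cancel₀ hcc.ne'])
  simp only [smul_dotProduct, smul_eq_mul, mul_pow, ← Finset.mul_sum, inv_pow,
    Real.sq_sqrt hcc.le] at this
  rw [mul_left_comm, lt_inv_mul_iff₀ hcc] at this
  linarith

end ContinuousConvergence

end SNCP

namespace SNCP

/-! ### Convergence of the statistics for paths with a nondegenerate limit -/

section Limits

variable {d : ℕ} {ι : Type*} {L : Filter ι} {N : ι → ℕ}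

/-- No nontrivial linear combination of the coordinates of `f` is affine on a nontrivial
subinterval of `[0, 1]`. -/
def Nondegenerate (f : ℝ → Fin d → ℝ) : Prop :=
  ∀ p q : ℝ, 0 ≤ p → p < q → q ≤ 1 → ∀ (x : Fin d → ℝ) (b₀ b₁ : ℝ),
    (∀ s ∈ Set.Icc p q, x ⬝ᵥ f s + b₀ + b₁ * s = 0) → x = 0

/-- A singular matrix has inverse `0` by convention. Upper bounds on the statistic therefore need no
invertibility: either it vanishes, or `w = V⁻¹ D` solves `V w = D`. -/
theorem dotProduct_inv_mulVec_eq {V : Matrix (Fin d) (Fin d) ℝ} (D : Fin d → ℝ) :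
    D ⬝ᵥ V⁻¹.mulVec D = 0 ∨
      V.mulVec (V⁻¹.mulVec D) = D ∧
        D ⬝ᵥ V⁻¹.mulVec D = (V⁻¹.mulVec D) ⬝ᵥ V.mulVec (V⁻¹.mulVec D) := by
  by_cases hV : IsUnit V.det
  · right
    have h1 : V.mulVec (V⁻¹.mulVec D) = D := by
      rw [Matrix.mulVec_mulVec, Matrix.mul_nonsing_inv _ hV, Matrix.one_mulVec]
    exact ⟨h1, by rw [h1, dotProduct_comm]⟩
  · left
    simp [Matrix.nonsing_inv_apply_not_isUnit _ hV]

theorem dotProduct_inv_mulVec_nonneg {V : Matrix (Fin d) (Fin d) ℝ}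
    (hV : ∀ x, 0 ≤ x ⬝ᵥ V.mulVec x) (D : Fin d → ℝ) : 0 ≤ D ⬝ᵥ V⁻¹.mulVec D := by
  rcases dotProduct_inv_mulVec_eq (V := V) D with h | ⟨-, h⟩
  · exact h.ge
  · exact h ▸ hV _

theorem det_ne_zero_of_pos {V : Matrix (Fin d) (Fin d) ℝ}
    (hV : ∀ x, x ≠ 0 → 0 < x ⬝ᵥ V.mulVec x) : V.det ≠ 0 := by
  intro h
  obtain ⟨x, hx, hx0⟩ := Matrix.exists_mulVec_eq_zero_iff.2 h
  simpa [hx0] using hV x hx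

/-- Cramer's rule leaves `V.det⁻¹` as the only factor that is not polynomial; both convergence and
measurability are read off from this form. -/
theorem dotProduct_inv_mulVec_eq_adjugate (V : Matrix (Fin d) (Fin d) ℝ) (D : Fin d → ℝ) :
    D ⬝ᵥ V⁻¹.mulVec D = V.det⁻¹ * (D ⬝ᵥ V.adjugate.mulVec D) := by
  rw [Matrix.inv_def, Ring.inverse_eq_inv', Matrix.smul_mulVec, dotProduct_smul, smul_eq_mul]

theorem tendsto_dotProduct_inv_mulVec {V : ι → Matrix (Fin d) (Fin d) ℝ} {D : ι → Fin d → ℝ}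
    {V₀ : Matrix (Fin d) (Fin d) ℝ} {D₀ : Fin d → ℝ} (hV : Tendsto V L (𝓝 V₀))
    (hD : Tendsto D L (𝓝 D₀)) (h : V₀.det ≠ 0) :
    Tendsto (fun i => D i ⬝ᵥ (V i)⁻¹.mulVec (D i)) L (𝓝 (D₀ ⬝ᵥ V₀⁻¹.mulVec D₀)) := by
  simp only [dotProduct_inv_mulVec_eq_adjugate]
  have h1 : Continuous fun z : Matrix (Fin d) (Fin d) ℝ × (Fin d → ℝ) =>
      z.2 ⬝ᵥ z.1.adjugate.mulVec z.2 :=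
    continuous_snd.dotProduct (continuous_fst.matrix_adjugate.matrix_mulVec continuous_snd)
  have h2 := (h1.tendsto (V₀, D₀)).comp (hV.prodMk_nhds hD)
  have h3 : Continuous fun z : Matrix (Fin d) (Fin d) ℝ => z.det := continuous_id.matrix_det
  exact (((h3.tendsto V₀).comp hV).inv₀ h).mul h2

theorem tendsto_matrix {V : ι → Matrix (Fin d) (Fin d) ℝ} {V₀ : Matrix (Fin d) (Fin d) ℝ}
    (h : ∀ a b, Tendsto (fun i => V i a b) L (𝓝 (V₀ a b))) : Tendsto V L (𝓝 V₀) :=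
  tendsto_pi_nhds.2 fun a => tendsto_pi_nhds.2 fun b => h a b

theorem continuous_matrix_of_entries {X : Type*} [TopologicalSpace X]
    {V : X → Matrix (Fin d) (Fin d) ℝ} (h : ∀ a b, Continuous fun x => V x a b) : Continuous V :=
  continuous_pi fun a => continuous_pi fun b => h a b

/-- As a function of `s` a bridge is the path plus an affine function, the form that `Nondegenerate`
speaks about. -/
theorem dotProduct_bridge (w : ℝ → Fin d → ℝ) (x : Fin d → ℝ) (u₁ s u : ℝ) :
    x ⬝ᵥ bridge w u₁ s u = x ⬝ᵥ w s +
      (-(x ⬝ᵥ w u₁) + u₁ / (u - u₁) * (x ⬝ᵥ w u - x ⬝ᵥ w u₁)) +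
        (-(u - u₁)⁻¹ * (x ⬝ᵥ w u - x ⬝ᵥ w u₁)) * s := by
  simp only [bridge, dotProduct_sub, dotProduct_smul, smul_eq_mul]
  ring

theorem Nondegenerate.exists_bridge_ne_zero {f : ℝ → Fin d → ℝ} (h : Nondegenerate f)
    {u₁ u p q : ℝ} (hp : 0 ≤ p) (hpq : p < q) (hq : q ≤ 1) {x : Fin d → ℝ} (hx : x ≠ 0) :
    ∃ s ∈ Set.Icc p q, x ⬝ᵥ bridge f u₁ s u ≠ 0 := by
  by_contra! hcon
  refine hx (h p q hp hpq hq x (-(x ⬝ᵥ f u₁) + u₁ / (u - u₁) * (x ⬝ᵥ f u - x ⬝ᵥ f u₁))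
    (-(u - u₁)⁻¹ * (x ⬝ᵥ f u - x ⬝ᵥ f u₁)) fun s hs => ?_)
  rw [← hcon s hs]
  exact (dotProduct_bridge f x u₁ s u).symm

theorem continuous_bridge {f : ℝ → Fin d → ℝ} (hf : Continuous f) (u₁ u : ℝ) :
    Continuous fun s => bridge f u₁ s u := by
  unfold bridge
  fun_prop

theorem dotProduct_limNormalizer_mulVec {f : ℝ → Fin d → ℝ} (hf : Continuous f)
    (u₁ u u₂ : ℝ) (x : Fin d → ℝ) :
    x ⬝ᵥ (limNormalizer f u₁ u u₂).mulVec x = ((u₂ - u₁) ^ 2)⁻¹ *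
      ((∫ s in u₁..u, (x ⬝ᵥ bridge f u₁ s u) ^ 2) + ∫ s in u..u₂, (x ⬝ᵥ bridge f u s u₂) ^ 2) := by
  have key : ∀ p q α β : ℝ, ∫ s in p..q, (x ⬝ᵥ bridge f α s β) ^ 2 =
      ∑ a, ∑ b, x a * x b * ∫ s in p..q, bridge f α s β a * bridge f α s β b := by
    intro p q α β
    have hc : ∀ a, Continuous fun s => bridge f α s β a := fun a =>
      (continuous_apply a).comp (continuous_bridge hf α β)
    have h1 : ∀ s, (x ⬝ᵥ bridge f α s β) ^ 2 =
        ∑ a, ∑ b, x a * x b * (bridge f α s β a * bridge f α s β b) := by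
      intro s
      rw [sq, dotProduct, Finset.sum_mul_sum]
      exact Finset.sum_congr rfl fun a _ => Finset.sum_congr rfl fun b _ => by ring
    simp only [h1]
    rw [intervalIntegral.integral_finsetSum fun a _ => ?_]
    · refine Finset.sum_congr rfl fun a _ => ?_
      rw [intervalIntegral.integral_finsetSum fun b _ => ?_]
      · exact Finset.sum_congr rfl fun b _ => intervalIntegral.integral_const_mul _ _
      · exact (continuous_const.mul ((hc a).mul (hc b))).intervalIntegrable _ _
    · exact (continuous_finsetSum _ fun b _ =>
        continuous_const.mul ((hc a).mul (hc b))).intervalIntegrable _ _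
  rw [key, key, ← Finset.sum_add_distrib, Finset.mul_sum]
  simp only [dotProduct, Matrix.mulVec, limNormalizer, Matrix.of_apply, Finset.mul_sum]
  refine Finset.sum_congr rfl fun a _ => ?_
  rw [← Finset.sum_add_distrib, Finset.mul_sum]
  exact Finset.sum_congr rfl fun b _ => by ring

theorem Nondegenerate.limNormalizer_pos {f : ℝ → Fin d → ℝ} (h : Nondegenerate f)
    (hf : Continuous f) {u₁ u u₂ : ℝ} (h₁ : 0 ≤ u₁) (h₁' : u₁ < u) (h₂' : u < u₂) (h₂ : u₂ ≤ 1)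
    {x : Fin d → ℝ} (hx : x ≠ 0) : 0 < x ⬝ᵥ (limNormalizer f u₁ u u₂).mulVec x := by
  rw [dotProduct_limNormalizer_mulVec hf]
  have hc : ∀ α β, Continuous fun s => (x ⬝ᵥ bridge f α s β) ^ 2 := fun α β =>
    (continuous_const.dotProduct (continuous_bridge hf α β)).pow 2
  -- The left half of the window already makes the form positive.
  have hpos : 0 < ∫ s in u₁..u, (x ⬝ᵥ bridge f u₁ s u) ^ 2 := by
    obtain ⟨s, hs, hs0⟩ := h.exists_bridge_ne_zero (u₁ := u₁) (u := u) h₁ h₁' (by linarith) hx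
    exact intervalIntegral.integral_pos h₁' (hc _ _).continuousOn (fun _ _ => sq_nonneg _)
      ⟨s, hs, by positivity⟩
  have hnn : 0 ≤ ∫ s in u..u₂, (x ⬝ᵥ bridge f u s u₂) ^ 2 :=
    intervalIntegral.integral_nonneg h₂'.le fun _ _ => sq_nonneg _
  have : 0 < u₂ - u₁ := by linarith
  positivity

theorem Nondegenerate.limNormalizer_det_ne_zero {f : ℝ → Fin d → ℝ} (h : Nondegenerate f)
    (hf : Continuous f) {u₁ u u₂ : ℝ} (h₁ : 0 ≤ u₁) (h₁' : u₁ < u) (h₂' : u < u₂) (h₂ : u₂ ≤ 1) :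
    (limNormalizer f u₁ u u₂).det ≠ 0 :=
  det_ne_zero_of_pos fun _ hx => h.limNormalizer_pos hf h₁ h₁' h₂' h₂ hx

theorem limStat_nonneg {f : ℝ → Fin d → ℝ} (hf : Continuous f) {u₁ u u₂ : ℝ} (h₁ : u₁ ≤ u)
    (h₂ : u ≤ u₂) : 0 ≤ limStat f u₁ u u₂ := by
  refine dotProduct_inv_mulVec_nonneg (fun x => ?_) _
  rw [dotProduct_limNormalizer_mulVec hf]
  exact mul_nonneg (by positivity) (add_nonneg
    (intervalIntegral.integral_nonneg h₁ fun _ _ => sq_nonneg _)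
    (intervalIntegral.integral_nonneg h₂ fun _ _ => sq_nonneg _))

theorem snStat_nonneg (y : ℕ → Fin d → ℝ) (t₁ k t₂ : ℕ) : 0 ≤ snStat y t₁ k t₂ := by
  have key : ∀ x v : Fin d → ℝ, x ⬝ᵥ (Matrix.vecMulVec v v).mulVec x = (x ⬝ᵥ v) ^ 2 := by
    intro x v
    rw [Matrix.vecMulVec_mulVec]
    simp [dotProduct_comm v x, sq]
  refine dotProduct_inv_mulVec_nonneg (fun x => ?_) _
  simp only [normalizer, leftNormalizer, rightNormalizer, Matrix.add_mulVec, Matrix.sum_mulVec,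
    Matrix.smul_mulVec, dotProduct_add, dotProduct_sum, dotProduct_smul, key, smul_eq_mul]
  positivity

theorem ContConv.bridge {F : ι → ℝ → Fin d → ℝ} {f : ℝ → Fin d → ℝ} (h : ContConv L F f)
    {u v : ι → ℝ} {α β : ℝ} (hu : Tendsto u L (𝓝 α)) (hv : Tendsto v L (𝓝 β)) (hαβ : α ≠ β) :
    ContConv L (fun i s => bridge (F i) (u i) s (v i)) (fun s => bridge f α s β) := by
  intro x
  have h1 : Tendsto (fun p : ι × ℝ => F p.1 (u p.1)) (L ×ˢ 𝓝 x) (𝓝 (f α)) :=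
    (h.tendsto_comp hu).comp tendsto_fst
  have h2 : Tendsto (fun p : ι × ℝ => F p.1 (v p.1)) (L ×ˢ 𝓝 x) (𝓝 (f β)) :=
    (h.tendsto_comp hv).comp tendsto_fst
  have h3 : Tendsto (fun p : ι × ℝ => u p.1) (L ×ˢ 𝓝 x) (𝓝 α) := hu.comp tendsto_fst
  have h4 : Tendsto (fun p : ι × ℝ => v p.1) (L ×ˢ 𝓝 x) (𝓝 β) := hv.comp tendsto_fst
  exact ((h x).sub h1).sub (((tendsto_snd.sub h3).div (h4.sub h3) (sub_ne_zero.2 hαβ.symm)).smul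
    (h2.sub h1))

variable {F : ι → ℝ → Fin d → ℝ} {f : ℝ → Fin d → ℝ} {a k e : ι → ℕ} {u₁ u u₂ : ℝ}

theorem ContConv.tendsto_sum_dbridge (h : ContConv L F f) (hf : Continuous f)
    (hN : Tendsto N L atTop) (ha : Tendsto (fun i => (a i : ℝ) / N i) L (𝓝 u₁))
    (hk : Tendsto (fun i => (k i : ℝ) / N i) L (𝓝 u)) (hak : ∀ᶠ i in L, a i ≤ k i)
    (hkN : ∀ᶠ i in L, k i ≤ N i) (hu : u₁ ≠ u) (b c : Fin d) :
    Tendsto (fun i => (N i : ℝ)⁻¹ * ∑ m ∈ Finset.Ioc (a i) (k i),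
      dbridge (fun m => F i ((m : ℝ) / N i)) (a i) m (k i) b *
        dbridge (fun m => F i ((m : ℝ) / N i)) (a i) m (k i) c) L
      (𝓝 (∫ s in u₁..u, SNCP.bridge f u₁ s u b * SNCP.bridge f u₁ s u c)) := by
  have hb := h.bridge ha hk hu
  have hc := continuous_bridge hf u₁ u
  have hprod : ContConv L
      (fun i s => SNCP.bridge (F i) ((a i : ℝ) / N i) s ((k i : ℝ) / N i) b *
        SNCP.bridge (F i) ((a i : ℝ) / N i) s ((k i : ℝ) / N i) c)
      (fun s => SNCP.bridge f u₁ s u b * SNCP.bridge f u₁ s u c) := fun x =>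
    ((tendsto_pi_nhds.1 (hb x) b).mul (tendsto_pi_nhds.1 (hb x) c))
  refine (hprod.tendsto_riemannSum (((continuous_apply b).comp hc).mul ((continuous_apply c).comp hc))
    hN ha hk hak hkN).congr' ?_
  filter_upwards [hN.eventually_ge_atTop 1] with i hi
  simp only [dbridge_comp_div (F i) (show N i ≠ 0 by omega)]

theorem ContConv.tendsto_normalizer (h : ContConv L F f) (hf : Continuous f)
    (hN : Tendsto N L atTop) (ha : Tendsto (fun i => (a i : ℝ) / N i) L (𝓝 u₁))
    (hk : Tendsto (fun i => (k i : ℝ) / N i) L (𝓝 u))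
    (he : Tendsto (fun i => (e i : ℝ) / N i) L (𝓝 u₂))
    (hak : ∀ᶠ i in L, a i ≤ k i) (hke : ∀ᶠ i in L, k i ≤ e i) (heN : ∀ᶠ i in L, e i ≤ N i)
    (h₁ : u₁ < u) (h₂ : u < u₂) :
    Tendsto (fun i => ((((e i : ℝ) - a i) / N i) ^ 2)⁻¹ •
      bridgeGram (fun m => F i ((m : ℝ) / N i)) (N i) (a i) (k i) (e i)) L
      (𝓝 (limNormalizer f u₁ u u₂)) := by
  refine tendsto_matrix fun b c => ?_
  have hkN : ∀ᶠ i in L, k i ≤ N i := by filter_upwards [hke, heN] with i h1 h2 using h1.trans h2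
  have hl : Tendsto (fun i => ((((e i : ℝ) - a i) / N i) ^ 2)⁻¹) L (𝓝 ((u₂ - u₁) ^ 2)⁻¹) := by
    have h3 : u₂ - u₁ ≠ 0 := by linarith
    simp only [sub_div]
    exact ((he.sub ha).pow 2).inv₀ (pow_ne_zero 2 h3)
  have hmain := hl.mul ((h.tendsto_sum_dbridge hf hN ha hk hak hkN h₁.ne b c).add
    (h.tendsto_sum_dbridge hf hN hk he hke heN h₂.ne b c))
  simp only [limNormalizer, Matrix.of_apply]
  refine hmain.congr fun i => ?_
  simp only [bridgeGram, Matrix.smul_apply, Matrix.add_apply, Matrix.sum_apply,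
    Matrix.vecMulVec_apply, smul_eq_mul]
  ring

theorem ContConv.tendsto_contrast (h : ContConv L F f)
    (hN : Tendsto N L atTop) (ha : Tendsto (fun i => (a i : ℝ) / N i) L (𝓝 u₁))
    (hk : Tendsto (fun i => (k i : ℝ) / N i) L (𝓝 u))
    (he : Tendsto (fun i => (e i : ℝ) / N i) L (𝓝 u₂)) (h₁₂ : u₁ < u₂) :
    Tendsto (fun i => (Real.sqrt (((e i : ℝ) - a i) / N i))⁻¹ •
      dbridge (fun m => F i ((m : ℝ) / N i)) (a i) (k i) (e i)) L
      (𝓝 (limContrast f u₁ u u₂)) := by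
  have hl : Tendsto (fun i => (Real.sqrt (((e i : ℝ) - a i) / N i))⁻¹) L
      (𝓝 (Real.sqrt (u₂ - u₁))⁻¹) := by
    simp only [sub_div]
    exact ((Real.continuous_sqrt.tendsto _).comp (he.sub ha)).inv₀
      (Real.sqrt_pos.2 (by linarith)).ne'
  refine (hl.smul ((h.bridge ha he h₁₂.ne).tendsto_comp hk)).congr' ?_
  filter_upwards [hN.eventually_ge_atTop 1] with i hi
  simp only [dbridge_comp_div (F i) (show N i ≠ 0 by omega)]

/-- Convergence of the statistic for data whose rescaled partial sums are, up to a linear trend,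
given by the functions `F i`. -/
theorem ContConv.tendsto_snStat (h : ContConv L F f) (hf : Continuous f) (hnd : Nondegenerate f)
    (hN : Tendsto N L atTop) {y : ι → ℕ → Fin d → ℝ} {θ : ι → Fin d → ℝ}
    (hy : ∀ᶠ i in L, ∀ t, 1 ≤ t → t ≤ N i →
      y i t = Real.sqrt (N i) • (F i ((t : ℝ) / N i) - F i (((t : ℝ) - 1) / N i)) + θ i)
    (ha : Tendsto (fun i => (a i : ℝ) / N i) L (𝓝 u₁))
    (hk : Tendsto (fun i => (k i : ℝ) / N i) L (𝓝 u))
    (he : Tendsto (fun i => (e i : ℝ) / N i) L (𝓝 u₂))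
    (hak : ∀ᶠ i in L, a i < k i) (hke : ∀ᶠ i in L, k i < e i) (heN : ∀ᶠ i in L, e i ≤ N i)
    (h₀ : 0 ≤ u₁) (h₁ : u₁ < u) (h₂ : u < u₂) (h₃ : u₂ ≤ 1) :
    Tendsto (fun i => snStat (y i) (a i + 1) (k i) (e i)) L (𝓝 (limStat f u₁ u u₂)) := by
  refine (tendsto_dotProduct_inv_mulVec
    (h.tendsto_normalizer hf hN ha hk he (hak.mono fun _ => le_of_lt)
      (hke.mono fun _ => le_of_lt) heN h₁ h₂)
    (h.tendsto_contrast hN ha hk he (h₁.trans h₂))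
    (hnd.limNormalizer_det_ne_zero hf h₀ h₁ h₂ h₃)).congr' ?_
  filter_upwards [hy, hak, hke, heN] with i hy hak hke heN
  have hn : (0 : ℝ) < N i := by exact_mod_cast (show 0 < N i by omega)
  have hsn : 0 < Real.sqrt (N i) := Real.sqrt_pos.2 hn
  set Z : ℕ → Fin d → ℝ := fun m => F i ((m : ℝ) / N i) with hZ
  -- A constant mean `θ i` adds the linear drift `(m / N) √N θ i` to the rescaled partial sums,
  -- which the bridges cancel.
  set Z' : ℕ → Fin d → ℝ := fun m => Z m + ((m : ℝ) / N i) • (Real.sqrt (N i) • θ i) with hZ'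
  have hy' : ∀ t, 1 ≤ t → t ≤ N i → y i t = Real.sqrt (N i) • (Z' t - Z' (t - 1)) := by
    intro t ht1 ht2
    rw [hy t ht1 ht2]
    ext j
    simp only [hZ', hZ, Pi.add_apply, Pi.sub_apply, Pi.smul_apply, smul_eq_mul, Nat.cast_sub ht1,
      Nat.cast_one]
    have hsq : Real.sqrt (N i) ^ 2 = N i := Real.sq_sqrt hn.le
    field_simp
    linear_combination (-θ i j) * hsq
  have hZZ : ∀ {p m q : ℕ}, p < q → dbridge Z' p m q = dbridge Z p m q := fun hpq =>
    dbridge_add_affine 0 (Real.sqrt (N i) • θ i) (N i) hpq (by simp [hZ']) (by simp [hZ'])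
      (by simp [hZ'])
  rw [snStat, contrast_eq hy' hak hke heN, normalizer_eq hy' hak hke heN, hZZ (hak.trans hke),
    bridgeGram_congr (Z := Z') (Z' := Z) (fun _ _ => hZZ hak) (fun _ _ => hZZ hke)]

end Limits

end SNCP

namespace SNCP

/-! ### Convergence of the maximal statistic -/

section MaxStat

variable {d : ℕ}

theorem le_maxOrZero {α : Type*} {s : Finset α} (f : α → ℝ) {x : α} (hx : x ∈ s) :
    f x ≤ maxOrZero s f := by
  rw [maxOrZero, dif_pos ⟨x, hx⟩]
  exact Finset.le_sup' f hx

/-- Nonnegativity of `c` excludes the default value `0` of the empty maximum. -/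
theorem exists_lt_of_lt_maxOrZero {α : Type*} {s : Finset α} {f : α → ℝ} {c : ℝ} (hc : 0 ≤ c)
    (h : c < maxOrZero s f) : ∃ x ∈ s, c < f x := by
  rw [maxOrZero] at h
  split_ifs at h with hs
  · exact (Finset.lt_sup'_iff hs).1 h
  · exact absurd h hc.not_gt

/-- With `a = k - j₁ h`, which is a genuine difference here, windows take the form `(a + 1, e)` used
by the bridge formulas. -/
theorem mem_nestedWindows {n h k : ℕ} (hh : 0 < h) {p : ℕ × ℕ} :
    p ∈ nestedWindows n h k ↔ ∃ j₁ j₂ : ℕ, 1 ≤ j₁ ∧ 1 ≤ j₂ ∧ j₁ * h ≤ k ∧ j₂ * h ≤ n - k ∧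
      p = (k - j₁ * h + 1, k + j₂ * h) := by
  simp only [nestedWindows, Finset.mem_image, Finset.mem_product, Finset.mem_Icc, Prod.exists,
    Nat.le_div_iff_mul_le hh]
  constructor
  · rintro ⟨j₁, j₂, ⟨⟨h1, h2⟩, h3, h4⟩, rfl⟩
    exact ⟨j₁, j₂, h1, h3, h2, h4, by rw [Nat.sub_add_comm h2]⟩
  · rintro ⟨j₁, j₂, h1, h3, h2, h4, rfl⟩
    exact ⟨j₁, j₂, ⟨⟨h1, h2⟩, h3, h4⟩, by rw [Nat.sub_add_comm h2]⟩

theorem exists_lt_snStat_of_lt_globalMaxStat {y : ℕ → Fin d → ℝ} {n h : ℕ} (hh : 0 < h) {c : ℝ}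
    (hc : 0 ≤ c) (hlt : c < globalMaxStat y n h) :
    ∃ k j₁ j₂ : ℕ, 1 ≤ j₁ ∧ 1 ≤ j₂ ∧ j₁ * h ≤ k ∧ k + j₂ * h ≤ n ∧
      c < snStat y (k - j₁ * h + 1) k (k + j₂ * h) := by
  obtain ⟨k, hk, hlt⟩ := exists_lt_of_lt_maxOrZero hc hlt
  obtain ⟨p, hp, hlt⟩ := exists_lt_of_lt_maxOrZero hc hlt
  obtain ⟨j₁, j₂, h1, h2, h3, h4, rfl⟩ := (mem_nestedWindows hh).1 (Finset.mem_filter.1 hp).1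
  have := (Finset.mem_Icc.1 hk).2
  exact ⟨k, j₁, j₂, h1, h2, h3, by omega, hlt⟩

theorem snStat_le_maxStat (y : ℕ → Fin d → ℝ) {n h s e k : ℕ} {p : ℕ × ℕ}
    (hp : p ∈ nestedWindowsIn n h s e k) : snStat y p.1 k p.2 ≤ maxStat y n h s e k := by
  have h := le_maxOrZero (fun p => snStat y p.1 k p.2) hp
  exact h

theorem maxStat_le_globalMaxStat (y : ℕ → Fin d → ℝ) {n h k : ℕ} (hk : k ∈ Finset.Icc 1 n) :
    maxStat y n h 1 n k ≤ globalMaxStat y n h := by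
  have h := le_maxOrZero (fun k => maxStat y n h 1 n k) hk
  exact h

theorem snStat_le_globalMaxStat (y : ℕ → Fin d → ℝ) {n h k j₁ j₂ : ℕ} (hh : 0 < h)
    (h₁ : 1 ≤ j₁) (h₂ : 1 ≤ j₂) (hk : j₁ * h ≤ k) (hn : k + j₂ * h ≤ n) :
    snStat y (k - j₁ * h + 1) k (k + j₂ * h) ≤ globalMaxStat y n h := by
  have hj1 : 0 < j₁ * h := Nat.mul_pos h₁ hh
  have hj2 : 0 < j₂ * h := Nat.mul_pos h₂ hh
  have hp : (k - j₁ * h + 1, k + j₂ * h) ∈ nestedWindowsIn n h 1 n k := by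
    rw [nestedWindowsIn, Finset.mem_filter, mem_nestedWindows hh]
    refine ⟨⟨j₁, j₂, h₁, h₂, hk, by omega, rfl⟩, ?_⟩
    simp only
    omega
  exact (snStat_le_maxStat y hp).trans
    (maxStat_le_globalMaxStat y (Finset.mem_Icc.2 ⟨hj1.trans_le hk, by omega⟩))

theorem tendsto_windowSize_div {ε : ℝ} (hε : 0 ≤ ε) :
    Tendsto (fun n : ℕ => (windowSize ε n : ℝ) / n) atTop (𝓝 ε) := by
  simp only [windowSize, mul_comm _ ε]
  exact (tendsto_nat_floor_mul_div_atTop hε).comp tendsto_natCast_atTop_atTop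

theorem tendsto_windowSize {ε : ℝ} (hε : 0 < ε) : Tendsto (windowSize ε) atTop atTop :=
  tendsto_nat_floor_atTop.comp (tendsto_natCast_atTop_atTop.atTop_mul_const hε)

theorem windowSize_le {ε : ℝ} (hε : 0 ≤ ε) (n : ℕ) : (windowSize ε n : ℝ) ≤ n * ε :=
  Nat.floor_le (by positivity)

/-! ### Continuity and boundedness of the limit functional -/

variable {f : ℝ → Fin d → ℝ} {ε : ℝ}

theorem mem_limWindows (hε : 0 < ε) {u : ℝ} (hu : u ∈ Set.Icc (0 : ℝ) 1) {p : ℝ × ℝ} :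
    p ∈ limWindows ε u ↔ ∃ j₁ j₂ : ℕ, 1 ≤ j₁ ∧ 1 ≤ j₂ ∧ j₁ * ε ≤ u ∧ u + j₂ * ε ≤ 1 ∧
      p = (u - j₁ * ε, u + j₂ * ε) := by
  have h1 : 0 ≤ u / ε := div_nonneg hu.1 hε.le
  have h2 : 0 ≤ (1 - u) / ε := div_nonneg (by linarith [hu.2]) hε.le
  unfold limWindows
  constructor
  · rintro ⟨j₁, j₂, h3, h4, h5, h6, rfl⟩
    rw [Nat.le_floor_iff h1, le_div_iff₀ hε] at h4
    rw [Nat.le_floor_iff h2, le_div_iff₀ hε] at h6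
    exact ⟨j₁, j₂, h3, h5, h4, by linarith, rfl⟩
  · rintro ⟨j₁, j₂, h3, h4, h5, h6, rfl⟩
    refine ⟨j₁, j₂, h3, ?_, h4, ?_, rfl⟩
    · rwa [Nat.le_floor_iff h1, le_div_iff₀ hε]
    · rw [Nat.le_floor_iff h2, le_div_iff₀ hε]
      linarith

/-- Both limits of integration move with `u`. Each is handled as the upper limit of a parametric
integral from `0`, and the two are subtracted. -/
theorem continuous_integral_bridge_left (hf : Continuous f) (c : ℝ) (a b : Fin d) :
    Continuous fun u => ∫ s in (u - c)..u, bridge f (u - c) s u a * bridge f (u - c) s u b := by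
  have hΦ : Continuous (Function.uncurry fun u s =>
      bridge f (u - c) s u a * bridge f (u - c) s u b) := by
    simp only [bridge, sub_sub_cancel, Function.uncurry_def, Pi.sub_apply, Pi.smul_apply,
      smul_eq_mul]
    fun_prop
  have h1 : ∀ g : ℝ → ℝ, Continuous g → Continuous fun u => ∫ s in (0 : ℝ)..g u,
      bridge f (u - c) s u a * bridge f (u - c) s u b := fun g hg =>
    intervalIntegral.continuous_parametric_intervalIntegral_of_continuous hΦ hg
  refine ((h1 id continuous_id).sub (h1 (fun u => u - c) (by fun_prop))).congr fun u => ?_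
  have hi : Continuous fun s => bridge f (u - c) s u a * bridge f (u - c) s u b :=
    hΦ.comp (Continuous.prodMk_right u)
  exact intervalIntegral.integral_interval_sub_left (hi.intervalIntegrable _ _)
    (hi.intervalIntegrable _ _)

theorem continuous_integral_bridge_right (hf : Continuous f) (c : ℝ) (a b : Fin d) :
    Continuous fun u => ∫ s in u..(u + c), bridge f u s (u + c) a * bridge f u s (u + c) b := by
  have h := (continuous_integral_bridge_left hf c a b).comp (continuous_add_const c)
  refine h.congr fun u => ?_
  simp only [Function.comp_apply, add_sub_cancel_right]

theorem continuousOn_limStat (hf : Continuous f) (hnd : Nondegenerate f) {c₁ c₂ : ℝ} (h₁ : 0 < c₁)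
    (h₂ : 0 < c₂) :
    ContinuousOn (fun u => limStat f (u - c₁) u (u + c₂)) (Set.Icc c₁ (1 - c₂)) := by
  have hlen : ∀ u : ℝ, u + c₂ - (u - c₁) = c₁ + c₂ := fun u => by ring
  have hV : Continuous fun u => limNormalizer f (u - c₁) u (u + c₂) := by
    refine continuous_matrix_of_entries fun a b => ?_
    simp only [limNormalizer, Matrix.of_apply, hlen]
    exact continuous_const.mul ((continuous_integral_bridge_left hf c₁ a b).add
      (continuous_integral_bridge_right hf c₂ a b))
  have hD : Continuous fun u => limContrast f (u - c₁) u (u + c₂) := by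
    simp only [limContrast, bridge, hlen, sub_sub_cancel]
    fun_prop
  intro u hu
  refine Tendsto.mono_left ?_ nhdsWithin_le_nhds
  exact tendsto_dotProduct_inv_mulVec (hV.tendsto u) (hD.tendsto u)
    (hnd.limNormalizer_det_ne_zero hf (by linarith [hu.1]) (by linarith) (by linarith)
      (by linarith [hu.2]))

/-- Only finitely many `(j₁, j₂)` fit into `[0, 1]`, and for each of them the statistic is
continuous in `u` on a compact interval. -/
theorem bddAbove_limStat (hf : Continuous f) (hnd : Nondegenerate f) (hε : 0 < ε) {U : Set ℝ}
    (hU : U ⊆ Set.Icc 0 1) :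
    BddAbove {x | ∃ u ∈ U, ∃ p ∈ limWindows ε u, x = limStat f p.1 u p.2} := by
  have hb : ∀ j ∈ Set.Iic ⌊1 / ε⌋₊ ×ˢ Set.Iic ⌊1 / ε⌋₊, BddAbove ({x | 1 ≤ j.1 ∧ 1 ≤ j.2 ∧
      x ∈ (fun u => limStat f (u - j.1 * ε) u (u + j.2 * ε)) ''
        Set.Icc (j.1 * ε) (1 - j.2 * ε)}) := by
    rintro ⟨j₁, j₂⟩ -
    by_cases h : 1 ≤ j₁ ∧ 1 ≤ j₂
    · have h1 : (0 : ℝ) < j₁ * ε := mul_pos (by exact_mod_cast h.1) hε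
      have h2 : (0 : ℝ) < j₂ * ε := mul_pos (by exact_mod_cast h.2) hε
      exact (isCompact_Icc.bddAbove_image (continuousOn_limStat hf hnd h1 h2)).mono
        fun x hx => hx.2.2
    · exact bddAbove_empty.mono fun x hx => h ⟨hx.1, hx.2.1⟩
  have hfin : (Set.Iic ⌊1 / ε⌋₊ ×ˢ Set.Iic ⌊1 / ε⌋₊).Finite :=
    (Set.finite_Iic _).prod (Set.finite_Iic _)
  refine ((hfin.bddAbove_biUnion).2 hb).mono ?_
  rintro x ⟨u, hu, p, hp, rfl⟩
  obtain ⟨j₁, j₂, h1, h2, h3, h4, rfl⟩ := (mem_limWindows hε (hU hu)).1 hp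
  have hu' := hU hu
  have hj1 : (0 : ℝ) ≤ j₁ * ε := by positivity
  have hj2 : (0 : ℝ) ≤ j₂ * ε := by positivity
  refine Set.mem_biUnion (x := (j₁, j₂)) ⟨?_, ?_⟩ ⟨h1, h2, u, ⟨h3, by linarith⟩, rfl⟩
  · exact Nat.le_floor (by rw [le_div_iff₀ hε]; linarith [hu'.2])
  · exact Nat.le_floor (by rw [le_div_iff₀ hε]; linarith [hu'.1])

theorem limStat_le_supLimStat (hf : Continuous f) (hnd : Nondegenerate f) (hε : 0 < ε) {U : Set ℝ}
    (hU : U ⊆ Set.Icc 0 1) {u : ℝ} (hu : u ∈ U) {j₁ j₂ : ℕ} (h₁ : 1 ≤ j₁) (h₂ : 1 ≤ j₂)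
    (h₁' : j₁ * ε ≤ u) (h₂' : u + j₂ * ε ≤ 1) :
    limStat f (u - j₁ * ε) u (u + j₂ * ε) ≤ supLimStat U ε f :=
  le_csSup (bddAbove_limStat hf hnd hε hU)
    ⟨u, hu, _, (mem_limWindows hε (hU hu)).2 ⟨j₁, j₂, h₁, h₂, h₁', h₂', rfl⟩, rfl⟩

theorem Icc_window_subset (hε : 0 < ε) : Set.Icc ε (1 - ε) ⊆ Set.Icc (0 : ℝ) 1 :=
  Set.Icc_subset_Icc hε.le (by linarith)

theorem supLimStat_nonempty (hε : 0 < ε) {U : Set ℝ} (hU : U ⊆ Set.Icc 0 1)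
    {u : ℝ} (hu : u ∈ U) (hu' : u ∈ Set.Icc ε (1 - ε)) :
    {x | ∃ u ∈ U, ∃ p ∈ limWindows ε u, x = limStat f p.1 u p.2}.Nonempty := by
  refine ⟨_, u, hu, _, (mem_limWindows hε (hU hu)).2 ⟨1, 1, le_rfl, le_rfl, ?_, ?_, rfl⟩, rfl⟩
  · simpa using hu'.1
  · have := hu'.2
    push_cast
    linarith

/-- If `1 / ε` is not an integer, the supremum may be taken over the open interval. -/
theorem supLimStat_Ioo (hf : Continuous f) (hnd : Nondegenerate f) (hε : 0 < ε) (hε' : ε < 1 / 2)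
    (hq : ∀ q : ℕ, (q : ℝ) * ε ≠ 1) :
    supLimStat (Set.Ioo ε (1 - ε)) ε f = supLimStat (Set.Icc ε (1 - ε)) ε f := by
  have hsub : Set.Ioo ε (1 - ε) ⊆ Set.Icc (0 : ℝ) 1 :=
    Set.Ioo_subset_Icc_self.trans (Icc_window_subset hε)
  refine le_antisymm ?_ ?_
  · refine csSup_le_csSup (bddAbove_limStat hf hnd hε (Icc_window_subset hε))
      (supLimStat_nonempty hε hsub (u := 1 / 2) ⟨hε', by linarith⟩ ⟨hε'.le, by linarith⟩) ?_
    rintro x ⟨u, hu, p, hp, rfl⟩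
    exact ⟨u, Set.Ioo_subset_Icc_self hu, p, hp, rfl⟩
  · refine csSup_le (supLimStat_nonempty hε (Icc_window_subset hε) (u := ε)
      ⟨le_rfl, by linarith⟩ ⟨le_rfl, by linarith⟩) ?_
    rintro x ⟨u, hu, p, hp, rfl⟩
    obtain ⟨j₁, j₂, h1, h2, h3, h4, rfl⟩ :=
      (mem_limWindows hε (Icc_window_subset hε hu)).1 hp
    have hj1 : (1 : ℝ) ≤ j₁ := by exact_mod_cast h1
    have hj2 : (1 : ℝ) ≤ j₂ := by exact_mod_cast h2
    -- Since `(j₁ + j₂) ε ≠ 1`, the interval of admissible `u` is not a single point, so an endpoint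
    -- is approached from its interior, which lies in the open range.
    have hlt : (j₁ : ℝ) * ε < 1 - j₂ * ε := by
      have := hq (j₁ + j₂)
      push_cast at this
      refine lt_of_le_of_ne (by linarith) fun h => this ?_
      linarith
    have hu' : u ∈ Set.Icc (j₁ * ε) (1 - j₂ * ε) := ⟨h3, by linarith⟩
    have hcont := continuousOn_limStat hf hnd (c₁ := j₁ * ε) (c₂ := j₂ * ε) (by positivity)
      (by positivity) u hu'
    have hne : (𝓝[Set.Ioo (j₁ * ε) (1 - j₂ * ε)] u).NeBot := by
      rw [← mem_closure_iff_nhdsWithin_neBot, closure_Ioo hlt.ne]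
      exact hu'
    refine le_of_tendsto (hcont.mono Set.Ioo_subset_Icc_self) ?_
    filter_upwards [self_mem_nhdsWithin] with v hv
    refine limStat_le_supLimStat hf hnd hε hsub ⟨?_, ?_⟩ h1 h2 hv.1.le (by linarith [hv.2])
    · nlinarith [hv.1]
    · nlinarith [hv.2]

/-! ### Convergence of the discrete maximum, along ultrafilters -/

variable {ι : Type*} {L : Filter ι} {N : ι → ℕ} {F : ι → ℝ → Fin d → ℝ}

theorem _root_.Ultrafilter.eventually_eq_const_of_le {U : Ultrafilter ι} {j : ι → ℕ} {M : ℕ}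
    (h : ∀ᶠ i in (U : Filter ι), j i ≤ M) : ∃ c, ∀ᶠ i in (U : Filter ι), j i = c := by
  have hmem : Set.Iic M ∈ U.map j := h
  obtain ⟨c, -, hc⟩ := Ultrafilter.eq_pure_of_finite_mem (Set.finite_Iic M) hmem
  refine ⟨c, ?_⟩
  have : ({c} : Set ℕ) ∈ U.map j := by
    rw [hc]
    exact Set.mem_singleton c
  exact this

/-- Along an ultrafilter, a sequence in `[0, 1]` converges. -/
theorem _root_.Ultrafilter.exists_tendsto_of_mem_Icc {U : Ultrafilter ι} {r : ι → ℝ}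
    (h : ∀ᶠ i in (U : Filter ι), r i ∈ Set.Icc (0 : ℝ) 1) :
    ∃ u ∈ Set.Icc (0 : ℝ) 1, Tendsto r U (𝓝 u) :=
  isCompact_Icc.ultrafilter_le_nhds (U.map r) (le_principal_iff.2 h)

/-- Ultrafilters play the role of subsequences for an arbitrary filter `L`: along them bounded
integers become constant and sequences in `[0, 1]` converge. -/
theorem exists_ultrafilter_of_frequently {p : ι → Prop} (h : ∃ᶠ i in L, p i) :
    ∃ U : Ultrafilter ι, (U : Filter ι) ≤ L ∧ ∀ᶠ i in (U : Filter ι), p i := by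
  have hne : (L ⊓ 𝓟 {i | p i}).NeBot := Filter.frequently_mem_iff_neBot.1 h
  exact ⟨Ultrafilter.of _, (Ultrafilter.of_le _).trans inf_le_left,
    le_principal_iff.1 ((Ultrafilter.of_le _).trans inf_le_right)⟩

/-- From below, a nearly optimal limit window is discretized. From above, windows violating the
bound are followed along an ultrafilter: `j₁`, `j₂` stabilize, the location converges, and the limit
is an admissible window whose statistic is too large. -/
theorem ContConv.tendsto_globalMaxStat (h : ContConv L F f) (hf : Continuous f)
    (hnd : Nondegenerate f) (hN : Tendsto N L atTop) (hε : 0 < ε) (hε' : ε < 1 / 2)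
    {y : ι → ℕ → Fin d → ℝ} {θ : ι → Fin d → ℝ}
    (hy : ∀ᶠ i in L, ∀ t, 1 ≤ t → t ≤ N i →
      y i t = Real.sqrt (N i) • (F i ((t : ℝ) / N i) - F i (((t : ℝ) - 1) / N i)) + θ i) :
    Tendsto (fun i => globalMaxStat (y i) (N i) (windowSize ε (N i))) L
      (𝓝 (supLimStat (Set.Icc ε (1 - ε)) ε f)) := by
  have hh : Tendsto (fun i => (windowSize ε (N i) : ℝ) / N i) L (𝓝 ε) :=
    (tendsto_windowSize_div hε.le).comp hN
  have hh1 : ∀ᶠ i in L, 0 < windowSize ε (N i) :=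
    ((tendsto_windowSize hε).comp hN).eventually_gt_atTop 0
  have hN1 : ∀ᶠ i in L, 0 < N i := hN.eventually_gt_atTop 0
  have hG0 : 0 ≤ supLimStat (Set.Icc ε (1 - ε)) ε f := by
    have := limStat_le_supLimStat hf hnd hε (Icc_window_subset hε) (u := ε) (j₁ := 1) (j₂ := 1)
      ⟨le_rfl, by linarith⟩ le_rfl le_rfl (by simp) (by push_cast; linarith)
    refine (limStat_nonneg hf ?_ ?_).trans this
    · simp [hε.le]
    · simp [hε.le]
  refine tendsto_order.2 ⟨fun c hc => ?_, fun c hc => ?_⟩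
  · -- lower bound
    obtain ⟨x, ⟨u, hu, p, hp, rfl⟩, hx⟩ := exists_lt_of_lt_csSup
      (supLimStat_nonempty hε (Icc_window_subset hε) (u := ε)
        ⟨le_rfl, by linarith⟩ ⟨le_rfl, by linarith⟩) hc
    obtain ⟨j₁, j₂, h1, h2, h3, h4, rfl⟩ := (mem_limWindows hε (Icc_window_subset hε hu)).1 hp
    have hj1 : (1 : ℝ) ≤ j₁ := by exact_mod_cast h1
    have hj2 : (1 : ℝ) ≤ j₂ := by exact_mod_cast h2
    -- Building `k` from `j₁` whole windows makes `j₁ h ≤ k` exact; `k + j₂ h ≤ N` then follows from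
    -- `h ≤ N ε`.
    set k : ι → ℕ := fun i => j₁ * windowSize ε (N i) + ⌊(u - j₁ * ε) * N i⌋₊ with hk
    have hNR : Tendsto (fun i => (N i : ℝ)) L atTop := tendsto_natCast_atTop_atTop.comp hN
    have hkN : ∀ i, k i + j₂ * windowSize ε (N i) ≤ N i := by
      intro i
      have hw := windowSize_le hε.le (N i)
      have hfl : (⌊(u - j₁ * ε) * N i⌋₊ : ℝ) ≤ (u - j₁ * ε) * N i :=
        Nat.floor_le (mul_nonneg (by linarith) (Nat.cast_nonneg _))
      have hNi : (0 : ℝ) ≤ N i := Nat.cast_nonneg _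
      have : ((k i + j₂ * windowSize ε (N i) : ℕ) : ℝ) ≤ N i := by
        push_cast [hk]
        nlinarith
      exact_mod_cast this
    have hklim : Tendsto (fun i => (k i : ℝ) / N i) L (𝓝 u) := by
      have hfl : Tendsto (fun i => (⌊(u - j₁ * ε) * N i⌋₊ : ℝ) / N i) L (𝓝 (u - j₁ * ε)) :=
        (tendsto_nat_floor_mul_div_atTop (by linarith)).comp hNR
      have := (hh.const_mul (j₁ : ℝ)).add hfl
      rw [add_sub_cancel] at this
      refine this.congr fun i => ?_
      push_cast [hk]
      ring
    have halim : Tendsto (fun i => ((k i - j₁ * windowSize ε (N i) : ℕ) : ℝ) / N i) L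
        (𝓝 (u - j₁ * ε)) := by
      refine (hklim.sub (hh.const_mul (j₁ : ℝ))).congr fun i => ?_
      rw [Nat.cast_sub (by simp [hk])]
      push_cast
      ring
    have helim : Tendsto (fun i => ((k i + j₂ * windowSize ε (N i) : ℕ) : ℝ) / N i) L
        (𝓝 (u + j₂ * ε)) := by
      refine (hklim.add (hh.const_mul (j₂ : ℝ))).congr fun i => ?_
      push_cast
      ring
    have hlim := h.tendsto_snStat hf hnd hN hy halim hklim helim
      (hh1.mono fun i hi => by
        have : 0 < j₁ * windowSize ε (N i) := Nat.mul_pos h1 hi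
        have : j₁ * windowSize ε (N i) ≤ k i := by simp [hk]
        omega)
      (hh1.mono fun i hi => by
        have : 0 < j₂ * windowSize ε (N i) := Nat.mul_pos h2 hi
        omega)
      (Eventually.of_forall hkN) (by linarith) (by nlinarith) (by nlinarith) h4
    filter_upwards [hlim.eventually_const_lt hx, hh1] with i hi hh1
    exact hi.trans_le (snStat_le_globalMaxStat (y i) hh1 h1 h2 (by simp [hk]) (hkN i))
  · -- upper bound
    by_contra hcon
    -- The intermediate level keeps the contradiction strict after the inequality is weakened in the
    -- limit.
    obtain ⟨c', hGc', hc'c⟩ := exists_between hc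
    obtain ⟨U, hUL, hU⟩ := exists_ultrafilter_of_frequently (Filter.not_eventually.1 hcon)
    have hex : ∀ᶠ i in (U : Filter ι), ∃ q : ℕ × ℕ × ℕ, 1 ≤ q.2.1 ∧ 1 ≤ q.2.2 ∧
        q.2.1 * windowSize ε (N i) ≤ q.1 ∧ q.1 + q.2.2 * windowSize ε (N i) ≤ N i ∧
        c' < snStat (y i) (q.1 - q.2.1 * windowSize ε (N i) + 1) q.1
          (q.1 + q.2.2 * windowSize ε (N i)) := by
      filter_upwards [hU, hUL hh1] with i hi hhi
      obtain ⟨k, j₁, j₂, h1⟩ := exists_lt_snStat_of_lt_globalMaxStat hhi (hG0.trans hGc'.le)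
        (hc'c.trans_le (not_lt.1 hi))
      exact ⟨(k, j₁, j₂), h1⟩
    obtain ⟨q, hq⟩ := hex.choice
    have hhU := hh.mono_left hUL
    -- Eventually `h > N ε / 2`, so at most `2 / ε` windows fit.
    have hbound : ∀ᶠ i in (U : Filter ι), ∀ j : ℕ, j * windowSize ε (N i) ≤ N i →
        j ≤ ⌊2 / ε⌋₊ := by
      filter_upwards [hhU.eventually_const_lt (half_lt_self hε), hUL hN1] with i h1 h2 j hj
      have h2' : (0 : ℝ) < N i := by exact_mod_cast h2
      have hj' : (j : ℝ) * windowSize ε (N i) ≤ N i := by exact_mod_cast hj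
      rw [lt_div_iff₀ h2'] at h1
      refine Nat.le_floor ?_
      rw [le_div_iff₀ hε]
      by_contra! hlt
      have hj0 : (0 : ℝ) ≤ j := Nat.cast_nonneg j
      nlinarith [mul_le_mul_of_nonneg_left h1.le hj0]
    obtain ⟨j₁, hj₁⟩ := Ultrafilter.eventually_eq_const_of_le (U := U) (j := fun i => (q i).2.1)
      (M := ⌊2 / ε⌋₊) (by
        filter_upwards [hq, hbound] with i h1 h2
        exact h2 _ (h1.2.2.1.trans ((Nat.le_add_right _ _).trans h1.2.2.2.1)))
    obtain ⟨j₂, hj₂⟩ := Ultrafilter.eventually_eq_const_of_le (U := U) (j := fun i => (q i).2.2)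
      (M := ⌊2 / ε⌋₊) (by
        filter_upwards [hq, hbound] with i h1 h2
        exact h2 _ ((Nat.le_add_left _ _).trans h1.2.2.2.1))
    have hq' : ∀ᶠ i in (U : Filter ι), 1 ≤ j₁ ∧ 1 ≤ j₂ ∧
        j₁ * windowSize ε (N i) ≤ (q i).1 ∧ (q i).1 + j₂ * windowSize ε (N i) ≤ N i ∧
        c' < snStat (y i) ((q i).1 - j₁ * windowSize ε (N i) + 1) (q i).1
          ((q i).1 + j₂ * windowSize ε (N i)) := by
      filter_upwards [hq, hj₁, hj₂] with i h1 h2 h3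
      rwa [h2, h3] at h1
    obtain ⟨u, hu, hulim⟩ := Ultrafilter.exists_tendsto_of_mem_Icc (U := U)
      (r := fun i => ((q i).1 : ℝ) / N i) (by
        filter_upwards [hq', hUL hN1] with i h1 h2
        have h2' : (0 : ℝ) < N i := by exact_mod_cast h2
        refine ⟨by positivity, ?_⟩
        rw [div_le_one h2']
        exact_mod_cast (Nat.le_add_right _ _).trans h1.2.2.2.1)
    obtain ⟨-, h1, h2, -⟩ := hq'.exists
    have hj1 : (1 : ℝ) ≤ j₁ := by exact_mod_cast h1
    have hj2 : (1 : ℝ) ≤ j₂ := by exact_mod_cast h2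
    have halim : Tendsto (fun i => (((q i).1 - j₁ * windowSize ε (N i) : ℕ) : ℝ) / N i) U
        (𝓝 (u - j₁ * ε)) := by
      refine (hulim.sub (hhU.const_mul (j₁ : ℝ))).congr' ?_
      filter_upwards [hq'] with i hi
      rw [Nat.cast_sub hi.2.2.1]
      push_cast
      ring
    have helim : Tendsto (fun i => (((q i).1 + j₂ * windowSize ε (N i) : ℕ) : ℝ) / N i) U
        (𝓝 (u + j₂ * ε)) := by
      refine (hulim.add (hhU.const_mul (j₂ : ℝ))).congr fun i => ?_
      push_cast
      ring
    have hu1 : 0 ≤ u - j₁ * ε := ge_of_tendsto' halim fun i => by positivity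
    have hu2 : u + j₂ * ε ≤ 1 := by
      refine le_of_tendsto helim ?_
      filter_upwards [hq', hUL hN1] with i h1 h2
      have h2' : (0 : ℝ) < N i := by exact_mod_cast h2
      rw [div_le_one h2']
      exact_mod_cast h1.2.2.2.1
    have hlim := (h.mono hUL).tendsto_snStat hf hnd (hN.mono_left hUL) (hUL hy) halim hulim helim
      (by
        filter_upwards [hq', hUL hh1] with i hi hh
        have : 0 < j₁ * windowSize ε (N i) := Nat.mul_pos h1 hh
        omega)
      (by
        filter_upwards [hUL hh1] with i hi
        have : 0 < j₂ * windowSize ε (N i) := Nat.mul_pos h2 hi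
        omega)
      (hq'.mono fun i hi => hi.2.2.2.1) hu1 (by nlinarith) (by nlinarith) hu2
    have hle : c' ≤ limStat f (u - j₁ * ε) u (u + j₂ * ε) :=
      ge_of_tendsto hlim (hq'.mono fun i hi => hi.2.2.2.2.le)
    have := limStat_le_supLimStat hf hnd hε (Icc_window_subset hε) (u := u)
      ⟨by nlinarith, by nlinarith⟩ h1 h2 (by linarith) hu2
    linarith

end MaxStat

end SNCP

namespace SNCP

/-! ### The statistic in the presence of a kink of the partial sums -/

section Kink

variable {d : ℕ}

theorem dotProduct_dbridge (Z : ℕ → Fin d → ℝ) (x : Fin d → ℝ) (a i k : ℕ) :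
    x ⬝ᵥ dbridge Z a i k = x ⬝ᵥ Z i - x ⬝ᵥ Z a -
      (((i : ℝ) - a) / ((k : ℝ) - a)) * (x ⬝ᵥ Z k - x ⬝ᵥ Z a) := by
  simp only [dbridge, dotProduct_sub, dotProduct_smul, smul_eq_mul]

/-- Two lines with coefficients of size at most `√M` differ by `β (u - v)` at `u`. Evaluating there
gives `|β| |u - v| ≤ 4 √M`, so a kink away from `u` is itself small; the two slopes contribute the
remaining `2 √M`. -/
theorem sq_slope_diff_le_of_kink {a₀ a₁ b₀ b₁ β u v x M : ℝ} (hx : 0 < x) (hu₀ : 0 ≤ u)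
    (hu₁ : u ≤ 1) (ha : a₀ ^ 2 + a₁ ^ 2 ≤ M) (hb : b₀ ^ 2 + b₁ ^ 2 ≤ M)
    (hid : β * (u - v) = b₀ + b₁ * u - a₀ - a₁ * u) (hβ : β = 0 ∨ x ≤ |u - v|) :
    (b₁ - a₁ - β) ^ 2 ≤ (2 + 4 / x) ^ 2 * M := by
  have hM : 0 ≤ M := le_trans (by positivity) ha
  set μ := Real.sqrt M with hμ
  have hμ0 : 0 ≤ μ := Real.sqrt_nonneg _
  have hle : ∀ r s : ℝ, r ^ 2 + s ^ 2 ≤ M → |r| ≤ μ ∧ |s| ≤ μ := fun r s h =>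
    ⟨Real.abs_le_sqrt (by linarith only [h, sq_nonneg s]),
      Real.abs_le_sqrt (by linarith only [h, sq_nonneg r])⟩
  obtain ⟨hI0, hI1⟩ := hle _ _ ha
  obtain ⟨hJ0, hJ1⟩ := hle _ _ hb
  have hkink : |β| ≤ 4 / x * μ := by
    rcases hβ with rfl | hβ
    · rw [abs_zero]
      positivity
    · have hmul : ∀ t : ℝ, |t| ≤ μ → |t * u| ≤ μ := fun t ht => by
        rw [abs_mul, abs_of_nonneg hu₀]
        exact (mul_le_of_le_one_right (abs_nonneg _) hu₁).trans ht
      have h1 : |β| * |u - v| ≤ 4 * μ := by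
        rw [← abs_mul, hid]
        have h2 := abs_le.1 (hmul _ hI1)
        have h3 := abs_le.1 (hmul _ hJ1)
        have h4 := abs_le.1 hI0
        have h5 := abs_le.1 hJ0
        rw [abs_le]
        constructor <;> linarith only [h2.1, h2.2, h3.1, h3.2, h4.1, h4.2, h5.1, h5.2]
      have h2 : |β| * x ≤ 4 * μ := (mul_le_mul_of_nonneg_left hβ (abs_nonneg _)).trans h1
      rw [div_mul_eq_mul_div, le_div_iff₀ hx]
      exact h2
  have hdiff : |b₁ - a₁ - β| ≤ (2 + 4 / x) * μ := by
    rw [add_mul]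
    rw [abs_le] at hI1 hJ1 hkink ⊢
    constructor <;> linarith only [hI1.1, hI1.2, hJ1.1, hJ1.2, hkink.1, hkink.2]
  calc _ = |b₁ - a₁ - β| ^ 2 := (sq_abs _).symm
    _ ≤ ((2 + 4 / x) * μ) ^ 2 := by gcongr
    _ = _ := by rw [mul_pow, hμ, Real.sq_sqrt hM]

/-- If the bridges of `z` over `(a, k]` and `(k, e]` are small in mean square, where
`z = g + affine` on a part of `(a, k]` and `z = g + affine + kink` on a part of `(k, e]`, then the
bridge of `z` over `(a, e]` is small at `k`, provided that the kink is away from `k`. -/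
theorem sq_bridge_le_of_kink {n a k e : ℕ} (hak : a < k) (hke : k < e) (hen : e ≤ n) {z g : ℕ → ℝ}
    {p₀ p₁ β v x c ν : ℝ} (hc : 0 < c) (hx : 0 < x) {I J : Finset ℕ}
    (hβ : β = 0 ∨ x ≤ |(k : ℝ) / n - v|)
    (hI : ∀ m ∈ I, z m = g m + p₀ + (m : ℝ) / n * p₁)
    (hJ : ∀ m ∈ J, z m = g m + p₀ + (m : ℝ) / n * p₁ + ((m : ℝ) / n - v) * β)
    (hgI : ∀ b₀ b₁ : ℝ, c * (b₀ ^ 2 + b₁ ^ 2) ≤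
      (n : ℝ)⁻¹ * ∑ m ∈ I, (g m + b₀ + b₁ * ((m : ℝ) / n)) ^ 2)
    (hgJ : ∀ b₀ b₁ : ℝ, c * (b₀ ^ 2 + b₁ ^ 2) ≤
      (n : ℝ)⁻¹ * ∑ m ∈ J, (g m + b₀ + b₁ * ((m : ℝ) / n)) ^ 2)
    (hνI : (n : ℝ)⁻¹ * ∑ m ∈ I, (z m - z a - ((m : ℝ) - a) / ((k : ℝ) - a) * (z k - z a)) ^ 2 ≤ ν)
    (hνJ : (n : ℝ)⁻¹ * ∑ m ∈ J, (z m - z k - ((m : ℝ) - k) / ((e : ℝ) - k) * (z e - z k)) ^ 2 ≤ ν) :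
    (z k - z a - ((k : ℝ) - a) / ((e : ℝ) - a) * (z e - z a)) ^ 2 ≤ (2 + 4 / x) ^ 2 * (ν / c) := by
  have hak' : (0 : ℝ) < (k : ℝ) - a := sub_pos.2 (by exact_mod_cast hak)
  have hke' : (0 : ℝ) < (e : ℝ) - k := sub_pos.2 (by exact_mod_cast hke)
  have hae' : (0 : ℝ) < (e : ℝ) - a := by linarith
  have hn : (0 : ℝ) < n := by exact_mod_cast (show 0 < n by omega)
  -- the chords of `z` over `[a, k]` and `[k, e]`
  obtain ⟨c₁, hc₁⟩ : ∃ c₁, c₁ = (z k - z a) * n / ((k : ℝ) - a) := ⟨_, rfl⟩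
  obtain ⟨c₁', hc₁'⟩ : ∃ c₁', c₁' = (z e - z k) * n / ((e : ℝ) - k) := ⟨_, rfl⟩
  obtain ⟨c₀, hc₀⟩ : ∃ c₀, c₀ = z k - c₁ * (k / n) := ⟨_, rfl⟩
  obtain ⟨c₀', hc₀'⟩ : ∃ c₀', c₀' = z k - c₁' * (k / n) := ⟨_, rfl⟩
  -- On `I` the bridge equals `g` plus an affine function whose coefficients compare the drift of
  -- `z` with its chord; the lower bound for `g` turns a small mean square into small coefficients.
  have hEI : c * ((p₀ - c₀) ^ 2 + (p₁ - c₁) ^ 2) ≤ ν := by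
    refine (hgI _ _).trans (le_of_eq_of_le ?_ hνI)
    congr 1
    refine Finset.sum_congr rfl fun m hm => ?_
    rw [hI m hm, hc₀, hc₁]
    congr 1
    field_simp
    ring
  have hEJ : c * ((p₀ - v * β - c₀') ^ 2 + (p₁ + β - c₁') ^ 2) ≤ ν := by
    refine (hgJ _ _).trans (le_of_eq_of_le ?_ hνJ)
    congr 1
    refine Finset.sum_congr rfl fun m hm => ?_
    rw [hJ m hm, hc₀', hc₁']
    congr 1
    field_simp
    ring
  have hM : ∀ b₀ b₁ : ℝ, c * (b₀ ^ 2 + b₁ ^ 2) ≤ ν → b₀ ^ 2 + b₁ ^ 2 ≤ ν / c := fun b₀ b₁ hb => by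
    rwa [le_div_iff₀' hc]
  have hu1 : (k : ℝ) / n ≤ 1 := by
    rw [div_le_one hn]
    exact_mod_cast hke.le.trans hen
  have hdiff := sq_slope_diff_le_of_kink hx (u := (k : ℝ) / n) (by positivity) hu1 (hM _ _ hEI)
    (hM _ _ hEJ) (β := β) (v := v) (by rw [hc₀, hc₀']; ring) hβ
  -- The bridge at `k` is proportional to the difference `c₁ - c₁'` of the chord slopes; `p₁` and
  -- `β` are inserted to match the previous estimate.
  have hid : z k - z a - ((k : ℝ) - a) / ((e : ℝ) - a) * (z e - z a) =
      ((k : ℝ) - a) / ((e : ℝ) - a) * (((e : ℝ) - k) / n) * (p₁ + β - c₁' - (p₁ - c₁) - β) := by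
    rw [hc₁, hc₁']
    field_simp
    ring
  have hco : ((k : ℝ) - a) / ((e : ℝ) - a) * (((e : ℝ) - k) / n) ≤ 1 := by
    have h1 : ((k : ℝ) - a) / ((e : ℝ) - a) ≤ 1 := by
      rw [div_le_one hae']
      linarith only [hke']
    have h2 : ((e : ℝ) - k) / n ≤ 1 := by
      rw [div_le_one hn]
      have h3 : (e : ℝ) ≤ n := by exact_mod_cast hen
      have h4 : (0 : ℝ) ≤ k := Nat.cast_nonneg k
      linarith only [h3, h4]
    exact mul_le_one₀ h1 (div_nonneg hke'.le hn.le) h2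
  have hco0 : 0 ≤ ((k : ℝ) - a) / ((e : ℝ) - a) * (((e : ℝ) - k) / n) :=
    mul_nonneg (div_nonneg hak'.le hae'.le) (div_nonneg hke'.le hn.le)
  rw [hid, mul_pow]
  exact (mul_le_of_le_one_left (sq_nonneg _) (pow_le_one₀ hco0 hco)).trans hdiff

/-- With `w = V⁻¹ D`, the statistic `T` is both `w ⬝ D` and `wᵀ V w`. The kink estimate applied to
`w ⬝ Z` bounds `(w ⬝ D)²` by a multiple of `wᵀ V w`, so `T² ≤ C T`. Only the summands of `V` over
`I` and `J` are used, so the path is unconstrained elsewhere, for instance at further change-points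
in the window. -/
theorem snStat_le_of_kink {n a k e : ℕ} (hak : a < k) (hke : k < e) (hen : e ≤ n)
    {y Z G : ℕ → Fin d → ℝ}
    (hy : ∀ t, 1 ≤ t → t ≤ n → y t = Real.sqrt n • (Z t - Z (t - 1)))
    {P₀ P₁ β : Fin d → ℝ} {v x c : ℝ} (hc : 0 < c) (hx : 0 < x) {I J : Finset ℕ}
    (hI : I ⊆ Finset.Ioc a k) (hJ : J ⊆ Finset.Ioc k e)
    (hβ : β = 0 ∨ x ≤ |(k : ℝ) / n - v|)
    (hZI : ∀ m ∈ I, Z m = G m + P₀ + ((m : ℝ) / n) • P₁)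
    (hZJ : ∀ m ∈ J, Z m = G m + P₀ + ((m : ℝ) / n) • P₁ + ((m : ℝ) / n - v) • β)
    (hGI : ∀ (w : Fin d → ℝ) (b₀ b₁ : ℝ), c * (b₀ ^ 2 + b₁ ^ 2) ≤
      (n : ℝ)⁻¹ * ∑ m ∈ I, (w ⬝ᵥ G m + b₀ + b₁ * ((m : ℝ) / n)) ^ 2)
    (hGJ : ∀ (w : Fin d → ℝ) (b₀ b₁ : ℝ), c * (b₀ ^ 2 + b₁ ^ 2) ≤
      (n : ℝ)⁻¹ * ∑ m ∈ J, (w ⬝ᵥ G m + b₀ + b₁ * ((m : ℝ) / n)) ^ 2) :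
    snStat y (a + 1) k e ≤ (2 + 4 / x) ^ 2 / c := by
  have hae' : (0 : ℝ) < (e : ℝ) - a := sub_pos.2 (by exact_mod_cast hak.trans hke)
  have hn : (0 : ℝ) < n := by exact_mod_cast (show 0 < n by omega)
  have hT0 := snStat_nonneg y (a + 1) k e
  rcases dotProduct_inv_mulVec_eq (V := normalizer y (a + 1) k e) (contrast y (a + 1) k e) with
    h | ⟨hw, hT⟩
  · rw [snStat, h]
    positivity
  set w := (normalizer y (a + 1) k e)⁻¹.mulVec (contrast y (a + 1) k e) with hwdef
  have hTw : snStat y (a + 1) k e = contrast y (a + 1) k e ⬝ᵥ w := rfl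
  set T := snStat y (a + 1) k e with hTdef
  set l := ((e : ℝ) - a) / n with hl
  have hl0 : 0 < l := by positivity
  have hl1 : l ≤ 1 := by
    rw [hl, div_le_one hn]
    have : (e : ℝ) ≤ n := by exact_mod_cast hen
    linarith [Nat.cast_nonneg (α := ℝ) a]
  obtain ⟨ν, hν⟩ : ∃ ν, ν = w ⬝ᵥ (bridgeGram Z n a k e).mulVec w := ⟨_, rfl⟩
  have hT1 : T = (l ^ 2)⁻¹ * ν := by
    rw [hTw, hT, normalizer_eq hy hak hke hen, Matrix.smul_mulVec, dotProduct_smul, hν, smul_eq_mul]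
  have hT2 : T = (Real.sqrt l)⁻¹ * (w ⬝ᵥ dbridge Z a k e) := by
    rw [hTw, contrast_eq hy hak hke hen, smul_dotProduct, dotProduct_comm, smul_eq_mul]
  rw [dotProduct_bridgeGram_mulVec] at hν
  have hsum : ∀ {S S' : Finset ℕ} {q : ℕ → ℝ}, S ⊆ S' → ∑ m ∈ S, q m ^ 2 ≤ ∑ m ∈ S', q m ^ 2 :=
    fun hS => Finset.sum_le_sum_of_subset_of_nonneg hS fun _ _ _ => sq_nonneg _
  have hν0 : ∀ (S : Finset ℕ) (q : ℕ → ℝ), 0 ≤ ∑ m ∈ S, q m ^ 2 :=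
    fun S q => Finset.sum_nonneg fun _ _ => sq_nonneg _
  have hn0 : (0 : ℝ) ≤ (n : ℝ)⁻¹ := by positivity
  have hmain : (w ⬝ᵥ dbridge Z a k e) ^ 2 ≤ (2 + 4 / x) ^ 2 * (ν / c) := by
    rw [dotProduct_dbridge]
    refine sq_bridge_le_of_kink hak hke hen (z := fun m => w ⬝ᵥ Z m) (g := fun m => w ⬝ᵥ G m)
      (p₀ := w ⬝ᵥ P₀) (p₁ := w ⬝ᵥ P₁) (β := w ⬝ᵥ β) (v := v) (I := I) (J := J) hc hx ?_ ?_ ?_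
      (hGI w) (hGJ w) ?_ ?_
    · exact hβ.imp (fun h => by simp [h]) id
    · intro m hm
      simp only [hZI m hm, dotProduct_add, dotProduct_smul, smul_eq_mul]
    · intro m hm
      simp only [hZJ m hm, dotProduct_add, dotProduct_smul, smul_eq_mul]
    · simp only [← dotProduct_dbridge]
      rw [hν]
      exact mul_le_mul_of_nonneg_left ((hsum hI).trans (le_add_of_nonneg_right (hν0 _ _))) hn0
    · simp only [← dotProduct_dbridge]
      rw [hν]
      exact mul_le_mul_of_nonneg_left ((hsum hJ).trans (le_add_of_nonneg_left (hν0 _ _))) hn0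
  -- The powers of the relative window length `l` combine to a single factor `l ≤ 1`.
  have hsq : T ^ 2 ≤ T * ((2 + 4 / x) ^ 2 / c) := by
    have h1 : T ^ 2 = l⁻¹ * (w ⬝ᵥ dbridge Z a k e) ^ 2 := by
      rw [hT2, mul_pow, inv_pow, Real.sq_sqrt hl0.le]
    have h2 : ν = T * l ^ 2 := by
      rw [hT1]
      field_simp
    rw [h1]
    calc l⁻¹ * (w ⬝ᵥ dbridge Z a k e) ^ 2 ≤ l⁻¹ * ((2 + 4 / x) ^ 2 * (ν / c)) := by gcongr
      _ = l * (T * ((2 + 4 / x) ^ 2 / c)) := by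
        rw [h2]
        field_simp
      _ ≤ _ := mul_le_of_le_one_left (by positivity) hl1
  rcases hT0.eq_or_lt with h0 | h0
  · rw [← h0]
    positivity
  · rw [sq] at hsq
    exact le_of_mul_le_mul_left hsq h0

variable {ι : Type*} {L : Filter ι} {N : ι → ℕ} {F : ι → ℝ → Fin d → ℝ} {f : ℝ → Fin d → ℝ}

/-- Nondegeneracy says that `1`, `s` and the coordinates of `f` are linearly independent on `[p,
q]`. The quadratic lower bound for this augmented path is uniform in all coefficients; the part `w ⬝
w` is discarded at the end. -/
theorem ContConv.exists_affine_lower_bound (h : ContConv L F f) (hf : Continuous f)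
    (hnd : Nondegenerate f) (hN : Tendsto N L atTop) {p q : ℝ} (hp : 0 ≤ p) (hpq : p < q)
    (hq : q ≤ 1) :
    ∃ c > 0, ∀ᶠ i in L, ∀ (w : Fin d → ℝ) (b₀ b₁ : ℝ), c * (b₀ ^ 2 + b₁ ^ 2) ≤
      (N i : ℝ)⁻¹ * ∑ m ∈ Finset.Ioc ⌊p * N i⌋₊ ⌊q * N i⌋₊,
        (w ⬝ᵥ F i ((m : ℝ) / N i) + b₀ + b₁ * ((m : ℝ) / N i)) ^ 2 := by
  let aug : (Fin d → ℝ) → ℝ → Option (Option (Fin d)) → ℝ := fun v s o =>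
    o.elim 1 fun o' => o'.elim s v
  have haug : ∀ (v : Fin d → ℝ) (s : ℝ) (c : Option (Option (Fin d)) → ℝ),
      c ⬝ᵥ aug v s = (fun j => c (some (some j))) ⬝ᵥ v + c none + c (some none) * s := by
    intro v s c
    simp only [dotProduct, Fintype.sum_option, aug, Option.elim]
    ring
  have hcont : Continuous fun z : (Fin d → ℝ) × ℝ => aug z.1 z.2 := by
    refine continuous_pi fun o => ?_
    rcases o with _ | _ | j
    · exact continuous_const
    · exact continuous_snd
    · exact (continuous_apply j).comp continuous_fst
  obtain ⟨c₀, hc₀, hev⟩ := ContConv.exists_quadratic_lower_bound (L := L) (N := N)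
    (F := fun i s => aug (F i s) s) (f := fun s => aug (f s) s)
    (fun x => (hcont.tendsto (f x, x)).comp ((h x).prodMk_nhds tendsto_snd))
    (hcont.comp (hf.prodMk continuous_id)) hN hp hpq hq (fun c hc => by
      simp only [haug] at hc
      have h1 := hnd p q hp hpq hq _ _ _ hc
      simp only [h1, zero_dotProduct, zero_add] at hc
      have h2 := hc p ⟨le_rfl, hpq.le⟩
      have h3 := hc q ⟨hpq.le, le_rfl⟩
      have h4 : c (some none) = 0 := by
        have : c (some none) * (q - p) = 0 := by linarith
        exact (mul_eq_zero.1 this).resolve_right (sub_ne_zero.2 hpq.ne')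
      rw [h4, zero_mul, add_zero] at h2
      ext o
      rcases o with _ | _ | j
      · exact h2
      · exact h4
      · exact congrFun h1 j)
  refine ⟨c₀, hc₀, hev.mono fun i hi w b₀ b₁ => ?_⟩
  let cc : Option (Option (Fin d)) → ℝ := fun o => o.elim b₀ fun o' => o'.elim b₁ w
  have := hi cc
  simp only [haug] at this
  refine le_trans ?_ this
  have h5 : cc ⬝ᵥ cc = b₀ * b₀ + (b₁ * b₁ + w ⬝ᵥ w) := by
    simp only [dotProduct, Fintype.sum_option, cc, Option.elim]
  have h6 : 0 ≤ w ⬝ᵥ w := Finset.sum_nonneg fun j _ => mul_self_nonneg (w j)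
  rw [h5]
  nlinarith

/-- Asymptotic upper bound of the statistic at `k` when the rescaled partial sums are `F i` plus a
piecewise linear function with at most one kink near `k`. -/
theorem ContConv.exists_snStat_le_of_kink (h : ContConv L F f) (hf : Continuous f)
    (hnd : Nondegenerate f) (hN : Tendsto N L atTop) {ε : ℝ} (hε : 0 < ε)
    {y Z : ι → ℕ → Fin d → ℝ}
    (hy : ∀ᶠ i in L, ∀ t, 1 ≤ t → t ≤ N i → y i t = Real.sqrt (N i) • (Z i t - Z i (t - 1)))
    {k : ι → ℕ} {u r : ℝ} (hk : Tendsto (fun i => (k i : ℝ) / N i) L (𝓝 u))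
    (hr : 0 < r) (hrε : r < ε) (hur : 0 ≤ u - r) (hur' : u + r ≤ 1)
    {P₀ P₁ β : ι → Fin d → ℝ} {v : ι → ℝ}
    (hZl : ∀ᶠ i in L, ∀ m : ℕ, (u - r) * N i < m → (m : ℝ) ≤ (u - r / 2) * N i →
      Z i m = F i ((m : ℝ) / N i) + P₀ i + ((m : ℝ) / N i) • P₁ i)
    (hZr : ∀ᶠ i in L, ∀ m : ℕ, (u + r / 2) * N i < m → (m : ℝ) ≤ (u + r) * N i →
      Z i m = F i ((m : ℝ) / N i) + P₀ i + ((m : ℝ) / N i) • P₁ i + ((m : ℝ) / N i - v i) • β i) :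
    ∃ C > 0, ∀ᶠ i in L, ∀ x > 0, (β i = 0 ∨ x ≤ |(k i : ℝ) / N i - v i|) → ∀ a e : ℕ,
      a + windowSize ε (N i) ≤ k i → k i + windowSize ε (N i) ≤ e → e ≤ N i →
        snStat (y i) (a + 1) (k i) e ≤ C * (2 + 4 / x) ^ 2 := by
  -- The two fixed intervals avoid a neighbourhood of `u`, so they eventually lie on opposite sides
  -- of `k`; since `r < ε`, every admissible window contains both, and the constants do not depend
  -- on the window.
  obtain ⟨c₁, hc₁, hev₁⟩ := h.exists_affine_lower_bound hf hnd hN (p := u - r) (q := u - r / 2)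
    hur (by linarith) (by linarith)
  obtain ⟨c₂, hc₂, hev₂⟩ := h.exists_affine_lower_bound hf hnd hN (p := u + r / 2) (q := u + r)
    (by linarith) (by linarith) hur'
  have hc : 0 < min c₁ c₂ := lt_min hc₁ hc₂
  refine ⟨(min c₁ c₂)⁻¹, inv_pos.2 hc, ?_⟩
  have hh : Tendsto (fun i => (windowSize ε (N i) : ℝ) / N i) L (𝓝 ε) :=
    (tendsto_windowSize_div hε.le).comp hN
  have hkl : ∀ᶠ i in L, ((k i : ℝ) - windowSize ε (N i)) / N i < u - r := by
    simp only [sub_div]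
    exact (hk.sub hh).eventually_lt_const (by linarith)
  have hkr : ∀ᶠ i in L, u + r < ((k i : ℝ) + windowSize ε (N i)) / N i := by
    simp only [add_div]
    exact (hk.add hh).eventually_const_lt (by linarith)
  have hkl' : ∀ᶠ i in L, u - r / 2 < (k i : ℝ) / N i := hk.eventually_const_lt (by linarith)
  have hkr' : ∀ᶠ i in L, (k i : ℝ) / N i < u + r / 2 := hk.eventually_lt_const (by linarith)
  filter_upwards [hy, hZl, hZr, hev₁, hev₂, hkl, hkr, hkl', hkr', hN.eventually_gt_atTop 0,
    ((tendsto_windowSize hε).comp hN).eventually_gt_atTop 0] with i hy hZl hZr hev₁ hev₂ hkl hkr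
    hkl' hkr' hN0 hh0 x hx hβ a e ha he heN
  have hn : (0 : ℝ) < N i := by exact_mod_cast hN0
  simp only [Function.comp_apply] at hh0
  rw [div_lt_iff₀ hn] at hkl hkr'
  rw [lt_div_iff₀ hn] at hkr hkl'
  have ha' : (a : ℝ) + windowSize ε (N i) ≤ k i := by exact_mod_cast ha
  have he' : (k i : ℝ) + windowSize ε (N i) ≤ e := by exact_mod_cast he
  have hmono : ∀ {c' : ℝ} (b₀ b₁ : ℝ), min c₁ c₂ ≤ c' →
      min c₁ c₂ * (b₀ ^ 2 + b₁ ^ 2) ≤ c' * (b₀ ^ 2 + b₁ ^ 2) := fun b₀ b₁ h =>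
    mul_le_mul_of_nonneg_right h (by positivity)
  have hmem : ∀ {p q : ℝ} {m : ℕ}, 0 ≤ p → 0 ≤ q → m ∈ Finset.Ioc ⌊p * N i⌋₊ ⌊q * N i⌋₊ →
      p * N i < m ∧ (m : ℝ) ≤ q * N i := by
    intro p q m hp hq hm
    obtain ⟨h1, h2⟩ := Finset.mem_Ioc.1 hm
    exact ⟨(Nat.floor_lt (by positivity)).1 h1, (Nat.le_floor_iff (by positivity)).1 h2⟩
  rw [mul_comm, ← div_eq_mul_inv]
  refine snStat_le_of_kink (G := fun m => F i ((m : ℝ) / N i)) (by omega) (by omega) heN hy hc hx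
    (I := Finset.Ioc ⌊(u - r) * N i⌋₊ ⌊(u - r / 2) * N i⌋₊)
    (J := Finset.Ioc ⌊(u + r / 2) * N i⌋₊ ⌊(u + r) * N i⌋₊) (P₀ := P₀ i) (P₁ := P₁ i) ?_ ?_ hβ ?_ ?_
    (fun w b₀ b₁ => (hmono b₀ b₁ (min_le_left _ _)).trans (hev₁ w b₀ b₁))
    (fun w b₀ b₁ => (hmono b₀ b₁ (min_le_right _ _)).trans (hev₂ w b₀ b₁))
  · intro m hm
    obtain ⟨h1, h2⟩ := hmem hur (by linarith) hm
    rw [Finset.mem_Ioc, ← Nat.cast_lt (α := ℝ), ← Nat.cast_le (α := ℝ)]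
    constructor <;> linarith
  · intro m hm
    obtain ⟨h1, h2⟩ := hmem (by linarith) (by linarith) hm
    rw [Finset.mem_Ioc, ← Nat.cast_lt (α := ℝ), ← Nat.cast_le (α := ℝ)]
    constructor <;> linarith
  · intro m hm
    obtain ⟨h1, h2⟩ := hmem hur (by linarith) hm
    exact hZl m h1 h2
  · intro m hm
    obtain ⟨h1, h2⟩ := hmem (by linarith) (by linarith) hm
    exact hZr m h1 h2

end Kink

end SNCP

namespace SNCP

/-! ### Asymptotics under multiple changes of the mean -/

section MeanChange

variable {d m : ℕ}

/-- The partial sums of the mean function. -/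
noncomputable def shiftSum (k : Fin (m + 2) → ℕ) (θ : Fin (m + 1) → Fin d → ℝ) (q : ℕ) :
    Fin d → ℝ :=
  ∑ t ∈ Finset.Icc 1 q, ∑ i : Fin (m + 1), if k i.castSucc < t ∧ t ≤ k i.succ then θ i else 0

/-- The path `w` plus the rescaled partial sums of the mean function. -/
noncomputable def shiftedPath (k : Fin (m + 2) → ℕ) (θ : Fin (m + 1) → Fin d → ℝ) (n : ℕ)
    (w : ℝ → Fin d → ℝ) (q : ℕ) : Fin d → ℝ :=
  w ((q : ℝ) / n) + (Real.sqrt n)⁻¹ • shiftSum k θ q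

theorem sum_shift_eq {k : Fin (m + 2) → ℕ} (hk : Monotone k) (θ : Fin (m + 1) → Fin d → ℝ)
    {l : Fin (m + 1)} {t : ℕ} (h₁ : k l.castSucc < t) (h₂ : t ≤ k l.succ) :
    (∑ i : Fin (m + 1), if k i.castSucc < t ∧ t ≤ k i.succ then θ i else 0) = θ l := by
  rw [Finset.sum_eq_single l, if_pos ⟨h₁, h₂⟩]
  · intro i _ hil
    refine if_neg fun hi => ?_
    rcases lt_or_gt_of_ne hil with h | h
    · have := hk (show i.succ ≤ l.castSucc from Fin.succ_le_castSucc_iff.2 h)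
      omega
    · have := hk (show l.succ ≤ i.castSucc from Fin.succ_le_castSucc_iff.2 h)
      omega
  · simp

theorem shiftSum_eq {k : Fin (m + 2) → ℕ} (hk : Monotone k) (θ : Fin (m + 1) → Fin d → ℝ)
    {l : Fin (m + 1)} {p q : ℕ} (h₁ : k l.castSucc ≤ p) (hpq : p ≤ q) (h₂ : q ≤ k l.succ) :
    shiftSum k θ q = shiftSum k θ p + ((q : ℝ) - p) • θ l := by
  induction q, hpq using Nat.le_induction with
  | base => simp
  | succ q hpq ih =>
    have h3 : shiftSum k θ (q + 1) = shiftSum k θ q + θ l := by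
      rw [shiftSum, Finset.sum_Icc_succ_top (by omega), sum_shift_eq hk θ (l := l) (by omega) h₂]
      rfl
    rw [h3, ih (by omega), add_assoc]
    congr 1
    push_cast
    module

theorem piecewiseShift_eq {k : Fin (m + 2) → ℕ} {θ : Fin (m + 1) → Fin d → ℝ} {n : ℕ}
    {w : ℝ → Fin d → ℝ} {x : ℕ → Fin d → ℝ}
    (hx : ∀ t, 1 ≤ t → t ≤ n →
      x t = Real.sqrt n • (w ((t : ℝ) / n) - w (((t : ℝ) - 1) / n)))
    {t : ℕ} (h₁ : 1 ≤ t) (h₂ : t ≤ n) :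
    piecewiseShift k θ x t =
      Real.sqrt n • (shiftedPath k θ n w t - shiftedPath k θ n w (t - 1)) := by
  have hn : (0 : ℝ) < n := by exact_mod_cast (show 0 < n by omega)
  have hsn : Real.sqrt n ≠ 0 := (Real.sqrt_pos.2 hn).ne'
  obtain ⟨t, rfl⟩ : ∃ s, t = s + 1 := ⟨t - 1, by omega⟩
  have h3 : shiftSum k θ (t + 1) = shiftSum k θ t +
      ∑ i : Fin (m + 1), if k i.castSucc < t + 1 ∧ t + 1 ≤ k i.succ then θ i else 0 := by
    rw [shiftSum, Finset.sum_Icc_succ_top (by omega)]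
    rfl
  rw [piecewiseShift, hx _ h₁ h₂, Nat.add_sub_cancel, shiftedPath, shiftedPath, h3]
  generalize (∑ i : Fin (m + 1),
    if k i.castSucc < t + 1 ∧ t + 1 ≤ k i.succ then θ i else 0) = S
  push_cast
  ext j
  simp only [Pi.add_apply, Pi.sub_apply, Pi.smul_apply, smul_eq_mul, add_sub_cancel_right]
  field_simp
  ring

/-- The anchor `b` may be any index of the segment. Taking a change-point as the anchor for both
adjacent segments exhibits the drift as a line with a kink there. -/
theorem shiftedPath_eq_affine {k : Fin (m + 2) → ℕ} (hk : Monotone k)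
    (θ : Fin (m + 1) → Fin d → ℝ) {n : ℕ} (hn : n ≠ 0) (w : ℝ → Fin d → ℝ) {l : Fin (m + 1)}
    {b q : ℕ} (hb : k l.castSucc ≤ b) (hb' : b ≤ k l.succ) (hq : k l.castSucc ≤ q)
    (hq' : q ≤ k l.succ) :
    shiftedPath k θ n w q = w ((q : ℝ) / n) +
      (Real.sqrt n)⁻¹ • (shiftSum k θ b - (b : ℝ) • θ l) +
        ((q : ℝ) / n) • (Real.sqrt n • θ l) := by
  have hS : shiftSum k θ q = shiftSum k θ b + ((q : ℝ) - b) • θ l := by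
    rcases le_total b q with h | h
    · exact shiftSum_eq hk θ hb h hq'
    · rw [shiftSum_eq hk θ hq h hb']
      module
  have hn' : (0 : ℝ) < n := by exact_mod_cast Nat.pos_of_ne_zero hn
  have hsn : Real.sqrt n ≠ 0 := (Real.sqrt_pos.2 hn').ne'
  have hsq : Real.sqrt n ^ 2 = n := Real.sq_sqrt hn'.le
  rw [shiftedPath, hS, add_assoc]
  congr 1
  ext j
  simp only [Pi.add_apply, Pi.sub_apply, Pi.smul_apply, smul_eq_mul]
  field_simp
  rw [hsq]
  ring

/-- Multiple changes of the mean: the assumptions on the change-points `k n i`, their limiting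
fractions `τ i`, the means `θ n i` and the jumps `δ n • η i`. -/
structure MeanChange (ε : ℝ) (k : ℕ → Fin (m + 2) → ℕ) (τ : Fin (m + 2) → ℝ)
    (θ : ℕ → Fin (m + 1) → Fin d → ℝ) (δ : ℕ → ℝ) (η : Fin m → Fin d → ℝ) : Prop where
  zero : ∀ n, k n 0 = 0
  last : ∀ n, k n (Fin.last (m + 1)) = n
  strictMono : ∀ᶠ n in atTop, StrictMono (k n)
  tau_zero : τ 0 = 0
  tau_last : τ (Fin.last (m + 1)) = 1
  tendsto : ∀ i, Tendsto (fun n => (k n i : ℝ) / n) atTop (𝓝 (τ i))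
  gap : ∀ i : Fin (m + 1), ε < τ i.succ - τ i.castSucc
  jump_ne_zero : ∀ i, η i ≠ 0
  jump : ∀ n (i : Fin m), θ n i.succ - θ n i.castSucc = δ n • η i
  signal : Tendsto (fun n : ℕ => (n : ℝ) * δ n ^ 2) atTop atTop

variable {ε : ℝ} {k : ℕ → Fin (m + 2) → ℕ} {τ : Fin (m + 2) → ℝ}
  {θ : ℕ → Fin (m + 1) → Fin d → ℝ} {δ : ℕ → ℝ} {η : Fin m → Fin d → ℝ}

theorem MeanChange.tau_nonneg (M : MeanChange ε k τ θ δ η) (i : Fin (m + 2)) : 0 ≤ τ i :=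
  ge_of_tendsto' (M.tendsto i) fun n => by positivity

theorem MeanChange.tau_le_one (M : MeanChange ε k τ θ δ η) (i : Fin (m + 2)) : τ i ≤ 1 := by
  refine le_of_tendsto (M.tendsto i) ?_
  filter_upwards [M.strictMono, eventually_gt_atTop 0] with n hn hn0
  rw [div_le_one (by exact_mod_cast hn0), Nat.cast_le]
  conv_rhs => rw [← M.last n]
  exact hn.monotone (Fin.le_last i)

/-- A limiting location lies inside a segment or at a limiting change-point; the bounds on the
statistic are proved separately in these two cases. -/
theorem MeanChange.exists_segment (M : MeanChange ε k τ θ δ η) {u : ℝ} (h₀ : 0 < u) (h₁ : u < 1) :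
    (∃ l : Fin (m + 1), τ l.castSucc < u ∧ u < τ l.succ) ∨ ∃ l : Fin m, u = τ l.succ.castSucc := by
  obtain ⟨l, hl1, hl2⟩ : ∃ l : Fin (m + 1), τ l.castSucc ≤ u ∧ u < τ l.succ := by
    by_contra! hcon
    have : ∀ i : Fin (m + 2), τ i ≤ u := fun i => by
      induction i using Fin.induction with
      | zero => rw [M.tau_zero]; exact h₀.le
      | succ i ih => exact hcon i ih
    have := this (Fin.last (m + 1))
    rw [M.tau_last] at this
    linarith
  rcases hl1.eq_or_lt with h | h
  · right
    rcases Fin.eq_zero_or_eq_succ l with rfl | ⟨l, rfl⟩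
    · rw [Fin.castSucc_zero, M.tau_zero] at h
      exact absurd h h₀.ne
    · exact ⟨l, h.symm⟩
  · exact Or.inl ⟨l, h, hl2⟩

variable {ι : Type*} {L : Filter ι} {N : ι → ℕ} {F : ι → ℝ → Fin d → ℝ} {f : ℝ → Fin d → ℝ}
  {x : ι → ℕ → Fin d → ℝ}

/-- The statistic is bounded at points away from the change-points. -/
theorem MeanChange.exists_snStat_le_of_segment (M : MeanChange ε k τ θ δ η) (h : ContConv L F f)
    (hf : Continuous f) (hnd : Nondegenerate f) (hN : Tendsto N L atTop) (hε : 0 < ε)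
    (hx : ∀ᶠ i in L, ∀ t, 1 ≤ t → t ≤ N i →
      x i t = Real.sqrt (N i) • (F i ((t : ℝ) / N i) - F i (((t : ℝ) - 1) / N i)))
    {K : ι → ℕ} {u : ℝ} (hK : Tendsto (fun i => (K i : ℝ) / N i) L (𝓝 u)) {l : Fin (m + 1)}
    (h₁ : τ l.castSucc < u) (h₂ : u < τ l.succ) :
    ∃ C, ∀ᶠ i in L, ∀ a e : ℕ, a + windowSize ε (N i) ≤ K i → K i + windowSize ε (N i) ≤ e →
      e ≤ N i → snStat (piecewiseShift (k (N i)) (θ (N i)) (x i)) (a + 1) (K i) e ≤ C := by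
  obtain ⟨r, hr0, hrε, hr1, hr2⟩ : ∃ r > 0, r < ε ∧ τ l.castSucc < u - r ∧ u + r < τ l.succ := by
    refine ⟨min (ε / 2) (min ((u - τ l.castSucc) / 2) ((τ l.succ - u) / 2)), ?_, ?_, ?_, ?_⟩
    · exact lt_min (by linarith) (lt_min (by linarith) (by linarith))
    · exact (min_le_left _ _).trans_lt (by linarith)
    · have := (min_le_right (ε / 2) (min ((u - τ l.castSucc) / 2) ((τ l.succ - u) / 2))).trans
        (min_le_left _ _)
      linarith
    · have := (min_le_right (ε / 2) (min ((u - τ l.castSucc) / 2) ((τ l.succ - u) / 2))).trans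
        (min_le_right _ _)
      linarith
  have hn0 := hN.eventually_gt_atTop 0
  have hmono := hN.eventually M.strictMono
  have hk1 : ∀ᶠ i in L, (k (N i) l.castSucc : ℝ) / N i < u - r :=
    ((M.tendsto l.castSucc).comp hN).eventually_lt_const hr1
  have hk2 : ∀ᶠ i in L, u + r < (k (N i) l.succ : ℝ) / N i :=
    ((M.tendsto l.succ).comp hN).eventually_const_lt hr2
  have hZ : ∀ᶠ i in L, ∀ q : ℕ, (u - r) * N i < q → (q : ℝ) ≤ (u + r) * N i →
      shiftedPath (k (N i)) (θ (N i)) (N i) (F i) q = F i ((q : ℝ) / N i) +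
      (Real.sqrt (N i))⁻¹ • (shiftSum (k (N i)) (θ (N i)) (k (N i) l.castSucc) -
        (k (N i) l.castSucc : ℝ) • θ (N i) l) +
        ((q : ℝ) / N i) • (Real.sqrt (N i) • θ (N i) l) := by
    filter_upwards [hn0, hmono, hk1, hk2] with i hn0 hmono hk1 hk2 q hq1 hq2
    have hn : (0 : ℝ) < N i := by exact_mod_cast hn0
    rw [div_lt_iff₀ hn] at hk1
    rw [lt_div_iff₀ hn] at hk2
    exact shiftedPath_eq_affine hmono.monotone (θ (N i)) hn0.ne' (F i) le_rfl
      (hmono.monotone Fin.castSucc_lt_succ.le)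
      (by exact_mod_cast (hk1.trans hq1).le) (by exact_mod_cast hq2.trans hk2.le)
  obtain ⟨C, -, hC⟩ := h.exists_snStat_le_of_kink hf hnd hN hε
    (y := fun i => piecewiseShift (k (N i)) (θ (N i)) (x i))
    (Z := fun i => shiftedPath (k (N i)) (θ (N i)) (N i) (F i))
    (hx.mono fun i hi t h1 h2 => piecewiseShift_eq hi h1 h2) hK hr0 hrε
    (by linarith [M.tau_nonneg l.castSucc]) (by linarith [M.tau_le_one l.succ])
    (P₀ := fun i => (Real.sqrt (N i))⁻¹ • (shiftSum (k (N i)) (θ (N i)) (k (N i) l.castSucc) -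
        (k (N i) l.castSucc : ℝ) • θ (N i) l))
    (P₁ := fun i => Real.sqrt (N i) • θ (N i) l) (β := fun _ => 0) (v := fun _ => 0)
    (by
      filter_upwards [hZ] with i hi q h1 h2
      refine hi q h1 (h2.trans ?_)
      gcongr
      linarith)
    (by
      filter_upwards [hZ] with i hi q h1 h2
      rw [smul_zero, add_zero]
      refine hi q (lt_of_le_of_lt ?_ h1) h2
      gcongr
      linarith)
  -- With no kink the distance `x` is arbitrary; `x = 1` is taken.
  exact ⟨C * (2 + 4 / 1) ^ 2, hC.mono fun i hi a e => hi 1 one_pos (Or.inl rfl) a e⟩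

/-- Upper bound of the statistic at points near a change-point. -/
theorem MeanChange.exists_snStat_le_near (M : MeanChange ε k τ θ δ η) (h : ContConv L F f)
    (hf : Continuous f) (hnd : Nondegenerate f) (hN : Tendsto N L atTop) (hε : 0 < ε)
    (hx : ∀ᶠ i in L, ∀ t, 1 ≤ t → t ≤ N i →
      x i t = Real.sqrt (N i) • (F i ((t : ℝ) / N i) - F i (((t : ℝ) - 1) / N i)))
    {K : ι → ℕ} {l : Fin m}
    (hK : Tendsto (fun i => (K i : ℝ) / N i) L (𝓝 (τ l.succ.castSucc))) :
    ∃ C > 0, ∀ᶠ i in L, ∀ z > 0, z ≤ |(K i : ℝ) / N i - (k (N i) l.succ.castSucc : ℝ) / N i| →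
      ∀ a e : ℕ, a + windowSize ε (N i) ≤ K i → K i + windowSize ε (N i) ≤ e →
      e ≤ N i → snStat (piecewiseShift (k (N i)) (θ (N i)) (x i)) (a + 1) (K i) e ≤
        C * (2 + 4 / z) ^ 2 := by
  set u := τ l.succ.castSucc with hu
  have hgap1 := M.gap l.castSucc
  have hgap2 := M.gap l.succ
  have hcs : l.castSucc.succ = l.succ.castSucc := Fin.succ_castSucc l
  rw [hcs, ← hu] at hgap1
  rw [← hu] at hgap2
  have hn0 := hN.eventually_gt_atTop 0
  have hmono := hN.eventually M.strictMono
  -- Gaps exceed `ε`, so with `r = ε / 2` the neighbouring change-points stay outside `[u - r, u +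
  -- r]`, while the one near `u` stays within `r / 2` of it.
  have hk0 : ∀ᶠ i in L, (k (N i) l.castSucc.castSucc : ℝ) / N i < u - ε / 2 :=
    ((M.tendsto _).comp hN).eventually_lt_const (by linarith)
  have hk1 : ∀ᶠ i in L, u - ε / 4 < (k (N i) l.succ.castSucc : ℝ) / N i :=
    ((M.tendsto l.succ.castSucc).comp hN).eventually_const_lt (by linarith)
  have hk1' : ∀ᶠ i in L, (k (N i) l.succ.castSucc : ℝ) / N i < u + ε / 4 :=
    ((M.tendsto l.succ.castSucc).comp hN).eventually_lt_const (by linarith)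
  have hk2 : ∀ᶠ i in L, u + ε / 2 < (k (N i) l.succ.succ : ℝ) / N i :=
    ((M.tendsto _).comp hN).eventually_const_lt (by linarith)
  obtain ⟨C, hC0, hC⟩ := h.exists_snStat_le_of_kink hf hnd hN hε
    (y := fun i => piecewiseShift (k (N i)) (θ (N i)) (x i))
    (Z := fun i => shiftedPath (k (N i)) (θ (N i)) (N i) (F i))
    (hx.mono fun i hi t h1 h2 => piecewiseShift_eq hi h1 h2) hK (half_pos hε) (half_lt_self hε)
    (by linarith [M.tau_nonneg l.castSucc.castSucc]) (by linarith [M.tau_le_one l.succ.succ])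
    (P₀ := fun i => (Real.sqrt (N i))⁻¹ • (shiftSum (k (N i)) (θ (N i)) (k (N i) l.succ.castSucc) -
        (k (N i) l.succ.castSucc : ℝ) • θ (N i) l.castSucc))
    (P₁ := fun i => Real.sqrt (N i) • θ (N i) l.castSucc)
    (β := fun i => Real.sqrt (N i) • (θ (N i) l.succ - θ (N i) l.castSucc))
    (v := fun i => (k (N i) l.succ.castSucc : ℝ) / N i)
    (by
      filter_upwards [hn0, hmono, hk0, hk1] with i hn0 hmono hk0 hk1 q hq1 hq2
      have hn : (0 : ℝ) < N i := by exact_mod_cast hn0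
      rw [div_lt_iff₀ hn] at hk0
      rw [lt_div_iff₀ hn] at hk1
      have h3 : (q : ℝ) ≤ k (N i) l.succ.castSucc := by
        refine hq2.trans (le_trans (le_of_eq ?_) hk1.le)
        ring
      refine shiftedPath_eq_affine hmono.monotone (θ (N i)) hn0.ne' (F i) ?_ (by rw [hcs])
        (by exact_mod_cast (hk0.trans hq1).le) (by rw [hcs]; exact_mod_cast h3)
      rw [← hcs]
      exact hmono.monotone Fin.castSucc_lt_succ.le)
    (by
      filter_upwards [hn0, hmono, hk1', hk2] with i hn0 hmono hk1 hk2 q hq1 hq2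
      have hn : (0 : ℝ) < N i := by exact_mod_cast hn0
      have hsn : Real.sqrt (N i) ≠ 0 := (Real.sqrt_pos.2 hn).ne'
      have hsq : Real.sqrt (N i) ^ 2 = N i := Real.sq_sqrt hn.le
      rw [div_lt_iff₀ hn] at hk1
      rw [lt_div_iff₀ hn] at hk2
      have h3 : (k (N i) l.succ.castSucc : ℝ) ≤ q := by
        refine hk1.le.trans (le_trans (le_of_eq ?_) hq1.le)
        ring
      rw [shiftedPath_eq_affine hmono.monotone (θ (N i)) hn0.ne' (F i) (l := l.succ)
        (b := k (N i) l.succ.castSucc) le_rfl (hmono.monotone Fin.castSucc_lt_succ.le)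
        (by exact_mod_cast h3) (by exact_mod_cast hq2.trans hk2.le)]
      ext j
      simp only [Pi.add_apply, Pi.sub_apply, Pi.smul_apply, smul_eq_mul]
      field_simp
      rw [hsq]
      ring)
  exact ⟨C, hC0, hC.mono fun i hi z hz hz' a e => hi z hz (Or.inr hz') a e⟩

theorem ContConv.comp_tendsto_window {K a e : ι → ℕ} {u : ℝ} {U : Filter ι} [U.NeBot] (hε : 0 < ε)
    (hN : Tendsto N U atTop) (hK : Tendsto (fun i => (K i : ℝ) / N i) U (𝓝 u))
    (ha : ∀ᶠ i in U, a i + windowSize ε (N i) ≤ K i)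
    (he : ∀ᶠ i in U, K i + windowSize ε (N i) ≤ e i ∧ e i ≤ N i) : ε ≤ u ∧ u ≤ 1 - ε := by
  have hh : Tendsto (fun i => (windowSize ε (N i) : ℝ) / N i) U (𝓝 ε) :=
    (tendsto_windowSize_div hε.le).comp hN
  constructor
  · refine le_of_tendsto_of_tendsto hh hK ?_
    filter_upwards [ha] with i hi
    gcongr
    omega
  · have : u + ε ≤ 1 := by
      refine le_of_tendsto (hK.add hh) ?_
      filter_upwards [he, hN.eventually_gt_atTop 0] with i hi hn
      rw [← add_div, div_le_one (by exact_mod_cast hn)]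
      exact_mod_cast hi.1.trans hi.2
    linarith

/-- At points that are farther than `r` from all change-points, the statistic is of smaller order
than `n δ²`. -/
theorem MeanChange.eventually_snStat_le_signal (M : MeanChange ε k τ θ δ η) (h : ContConv L F f)
    (hf : Continuous f) (hnd : Nondegenerate f) (hN : Tendsto N L atTop) (hε : 0 < ε)
    (hx : ∀ᶠ i in L, ∀ t, 1 ≤ t → t ≤ N i →
      x i t = Real.sqrt (N i) • (F i ((t : ℝ) / N i) - F i (((t : ℝ) - 1) / N i)))
    {r : ℕ → ℝ} (hr : ∀ n, 0 < r n)
    (hrate : Tendsto (fun n : ℕ => (n : ℝ) / (r n ^ 2 * δ n ^ 2)) atTop (𝓝 0)) {c : ℝ}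
    (hc : 0 < c) :
    ∀ᶠ i in L, ∀ K a e : ℕ, a + windowSize ε (N i) ≤ K → K + windowSize ε (N i) ≤ e →
      e ≤ N i → (∀ l : Fin m, r (N i) < |(K : ℝ) - k (N i) l.succ.castSucc|) →
      snStat (piecewiseShift (k (N i)) (θ (N i)) (x i)) (a + 1) K e ≤
        c * (N i * δ (N i) ^ 2) := by
  by_contra hcon
  obtain ⟨U, hUL, hU⟩ := exists_ultrafilter_of_frequently (Filter.not_eventually.1 hcon)
  push Not at hU
  have hex : ∀ᶠ i in (U : Filter ι), ∃ q : ℕ × ℕ × ℕ, q.2.1 + windowSize ε (N i) ≤ q.1 ∧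
      q.1 + windowSize ε (N i) ≤ q.2.2 ∧ q.2.2 ≤ N i ∧
      (∀ l : Fin m, r (N i) < |(q.1 : ℝ) - k (N i) l.succ.castSucc|) ∧
      c * (N i * δ (N i) ^ 2) <
        snStat (piecewiseShift (k (N i)) (θ (N i)) (x i)) (q.2.1 + 1) q.1 q.2.2 := by
    filter_upwards [hU] with i ⟨K, a, e, h1⟩
    exact ⟨(K, a, e), h1⟩
  obtain ⟨q, hq⟩ := hex.choice
  have hNU := hN.mono_left hUL
  have hn0 := hNU.eventually_gt_atTop 0
  obtain ⟨u, -, hu⟩ := Ultrafilter.exists_tendsto_of_mem_Icc (U := U)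
    (r := fun i => ((q i).1 : ℝ) / N i) (by
      filter_upwards [hq, hn0] with i h1 h2
      refine ⟨by positivity, ?_⟩
      rw [div_le_one (by exact_mod_cast h2)]
      exact_mod_cast ((Nat.le_add_right _ _).trans h1.2.1).trans h1.2.2.1)
  obtain ⟨hu0, hu1⟩ := ContConv.comp_tendsto_window hε hNU hu (hq.mono fun i hi => hi.1)
    (hq.mono fun i hi => ⟨hi.2.1, hi.2.2.1⟩)
  have hsig := M.signal.comp hNU
  rcases M.exists_segment (u := u) (by linarith) (by linarith) with ⟨l, hl1, hl2⟩ | ⟨l, rfl⟩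
  · obtain ⟨C, hC⟩ := M.exists_snStat_le_of_segment (h.mono hUL) hf hnd hNU hε (hUL hx) hu hl1 hl2
    obtain ⟨i, h1, h2, h3⟩ := (hC.and (hq.and (hsig.eventually_ge_atTop (C / c)))).exists
    have h4 := h1 _ _ h2.1 h2.2.1 h2.2.2.1
    rw [Function.comp_apply, div_le_iff₀' hc] at h3
    linarith [h2.2.2.2.2]
  · obtain ⟨C, hC0, hC⟩ := M.exists_snStat_le_near (h.mono hUL) hf hnd hNU hε (hUL hx) hu
    have hrU := (hrate.comp hNU).eventually_lt_const (show (0 : ℝ) < c / (64 * C) by positivity)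
    obtain ⟨i, h1, h2, h3, h4, h5⟩ := (hC.and (hq.and (hrU.and
      (hn0.and (hsig.eventually_ge_atTop (max 1 (16 * C / c))))))).exists
    have hn : (0 : ℝ) < N i := by exact_mod_cast h4
    simp only [Function.comp_apply] at h3 h5
    have hri := hr (N i)
    have h6 := h1 (r (N i) / N i) (by positivity) (by
      rw [← sub_div, abs_div, abs_of_pos hn]
      gcongr
      exact (h2.2.2.2.1 l).le) _ _ h2.1 h2.2.1 h2.2.2.1
    -- With `ρ = N δ²` and `s = N / (r² δ²)`, the squared inverse relative distance `N² / r²` is `s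
    -- ρ`. The constants `64` and `16` make each of the two parts of the bound at most `c ρ / 2`.
    set ρ := (N i : ℝ) * δ (N i) ^ 2 with hρ
    have hρ1 : 1 ≤ ρ := (le_max_left _ _).trans h5
    have hδ : δ (N i) ≠ 0 := by
      intro h0
      rw [hρ, h0] at hρ1
      norm_num at hρ1
    set s := (N i : ℝ) / (r (N i) ^ 2 * δ (N i) ^ 2) with hs
    have hz : (4 / (r (N i) / N i)) ^ 2 = 16 * (s * ρ) := by
      rw [hs, hρ]
      field_simp
      ring
    have h7 : (2 + 4 / (r (N i) / N i)) ^ 2 ≤ 8 + 32 * (s * ρ) := by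
      nlinarith [sq_nonneg (2 - 4 / (r (N i) / N i))]
    have h8 : 16 * C ≤ ρ * c := by
      rw [← div_le_iff₀ hc]
      exact (le_max_right _ _).trans h5
    have h9 : s * (64 * C) < c := by rwa [lt_div_iff₀ (by positivity)] at h3
    have h10 : C * (2 + 4 / (r (N i) / N i)) ^ 2 ≤ C * (8 + 32 * (s * ρ)) := by gcongr
    have h11 : s * (64 * C) * ρ ≤ c * ρ := by gcongr
    have h12 := h2.2.2.2.2
    linarith

/-- At points whose distance to all change-points is almost the window size or more, the statistic
is eventually smaller than any diverging threshold. -/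
theorem MeanChange.eventually_snStat_le_threshold (M : MeanChange ε k τ θ δ η)
    (h : ContConv L F f) (hf : Continuous f) (hnd : Nondegenerate f) (hN : Tendsto N L atTop)
    (hε : 0 < ε) (hx : ∀ᶠ i in L, ∀ t, 1 ≤ t → t ≤ N i →
      x i t = Real.sqrt (N i) • (F i ((t : ℝ) / N i) - F i (((t : ℝ) - 1) / N i)))
    {r κ : ℕ → ℝ} (hr : Tendsto (fun n => r n / n) atTop (𝓝 0)) (hκ : Tendsto κ atTop atTop) :
    ∀ᶠ i in L, ∀ K a e : ℕ, a + windowSize ε (N i) ≤ K → K + windowSize ε (N i) ≤ e →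
      e ≤ N i →
      (∀ l : Fin m, windowSize ε (N i) - r (N i) ≤ |(K : ℝ) - k (N i) l.succ.castSucc|) →
      snStat (piecewiseShift (k (N i)) (θ (N i)) (x i)) (a + 1) K e ≤ κ (N i) := by
  by_contra hcon
  obtain ⟨U, hUL, hU⟩ := exists_ultrafilter_of_frequently (Filter.not_eventually.1 hcon)
  push Not at hU
  have hex : ∀ᶠ i in (U : Filter ι), ∃ q : ℕ × ℕ × ℕ, q.2.1 + windowSize ε (N i) ≤ q.1 ∧
      q.1 + windowSize ε (N i) ≤ q.2.2 ∧ q.2.2 ≤ N i ∧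
      (∀ l : Fin m, windowSize ε (N i) - r (N i) ≤ |(q.1 : ℝ) - k (N i) l.succ.castSucc|) ∧
      κ (N i) <
        snStat (piecewiseShift (k (N i)) (θ (N i)) (x i)) (q.2.1 + 1) q.1 q.2.2 := by
    filter_upwards [hU] with i ⟨K, a, e, h1⟩
    exact ⟨(K, a, e), h1⟩
  obtain ⟨q, hq⟩ := hex.choice
  have hNU := hN.mono_left hUL
  have hn0 := hNU.eventually_gt_atTop 0
  obtain ⟨u, -, hu⟩ := Ultrafilter.exists_tendsto_of_mem_Icc (U := U)
    (r := fun i => ((q i).1 : ℝ) / N i) (by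
      filter_upwards [hq, hn0] with i h1 h2
      refine ⟨by positivity, ?_⟩
      rw [div_le_one (by exact_mod_cast h2)]
      exact_mod_cast ((Nat.le_add_right _ _).trans h1.2.1).trans h1.2.2.1)
  obtain ⟨hu0, hu1⟩ := ContConv.comp_tendsto_window hε hNU hu (hq.mono fun i hi => hi.1)
    (hq.mono fun i hi => ⟨hi.2.1, hi.2.2.1⟩)
  rcases M.exists_segment (u := u) (by linarith) (by linarith) with ⟨l, hl1, hl2⟩ | ⟨l, rfl⟩
  · obtain ⟨C, hC⟩ := M.exists_snStat_le_of_segment (h.mono hUL) hf hnd hNU hε (hUL hx) hu hl1 hl2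
    obtain ⟨i, h1, h2, h3⟩ := (hC.and (hq.and ((hκ.comp hNU).eventually_ge_atTop C))).exists
    have h4 := h1 _ _ h2.1 h2.2.1 h2.2.2.1
    rw [Function.comp_apply] at h3
    linarith [h2.2.2.2.2]
  -- A limit at a change-point is impossible: the relative distance would tend to `0`, yet it is at
  -- least `(h - r) / N`, which tends to `ε`.
  · have hh : Tendsto (fun i => (windowSize ε (N i) : ℝ) / N i) U (𝓝 ε) :=
      (tendsto_windowSize_div hε.le).comp hNU
    have h1 := ((hu.sub ((M.tendsto l.succ.castSucc).comp hNU)).abs)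
    rw [sub_self, abs_zero] at h1
    have h2 := le_of_tendsto_of_tendsto (hh.sub (hr.comp hNU)) h1 (by
      filter_upwards [hq, hn0] with i h1 h2
      have hn : (0 : ℝ) < N i := by exact_mod_cast h2
      simp only [Function.comp_apply]
      rw [← sub_div, ← sub_div, abs_div, abs_of_pos hn]
      gcongr
      exact h1.2.2.2.1 l)
    linarith

end MeanChange

end SNCP

namespace SNCP

/-! ### Detection at the change-points -/

section Signal

variable {d m : ℕ} {ε : ℝ} {k : ℕ → Fin (m + 2) → ℕ} {τ : Fin (m + 2) → ℝ}
  {θ : ℕ → Fin (m + 1) → Fin d → ℝ} {δ : ℕ → ℝ} {η : Fin m → Fin d → ℝ}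
  {ι : Type*} {L : Filter ι} {N : ι → ℕ} {F : ι → ℝ → Fin d → ℝ} {f : ℝ → Fin d → ℝ}
  {x : ι → ℕ → Fin d → ℝ}

/-- The kink raises the chord over the symmetric window by `(h / n) β`, half of which is subtracted
at the midpoint. -/
theorem dbridge_of_kink {Z G : ℕ → Fin d → ℝ} {n b h : ℕ} (hh : 0 < h) (hb : h ≤ b)
    {P₀ P₁ β : Fin d → ℝ} (h₁ : Z (b - h) = G (b - h) + P₀ + (((b - h : ℕ) : ℝ) / n) • P₁)
    (h₂ : Z b = G b + P₀ + ((b : ℝ) / n) • P₁)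
    (h₃ : Z (b + h) = G (b + h) + P₀ + (((b + h : ℕ) : ℝ) / n) • P₁ + ((h : ℝ) / n) • β) :
    dbridge Z (b - h) b (b + h) = dbridge G (b - h) b (b + h) - ((h : ℝ) / n / 2) • β := by
  have hh' : (h : ℝ) ≠ 0 := by exact_mod_cast hh.ne'
  have hr : ((b : ℝ) - (b - h)) / ((b + h) - (b - h)) = 1 / 2 := by
    rw [show (b : ℝ) - (b - h) = h by ring, show (b : ℝ) + h - (b - h) = 2 * h by ring]
    field_simp
  simp only [dbridge, h₁, h₂, h₃]
  push_cast [Nat.cast_sub hb]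
  rw [hr]
  module

/-- The statistic at a change-point is at least of the order `n δ²`. -/
theorem MeanChange.exists_signal_le_snStat (M : MeanChange ε k τ θ δ η) (h : ContConv L F f)
    (hf : Continuous f) (hnd : Nondegenerate f) (hN : Tendsto N L atTop) (hε : 0 < ε)
    (hx : ∀ᶠ i in L, ∀ t, 1 ≤ t → t ≤ N i →
      x i t = Real.sqrt (N i) • (F i ((t : ℝ) / N i) - F i (((t : ℝ) - 1) / N i))) (l : Fin m) :
    ∃ c > 0, ∀ᶠ i in L, c * (N i * δ (N i) ^ 2) < snStat (piecewiseShift (k (N i)) (θ (N i)) (x i))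
      (k (N i) l.succ.castSucc - windowSize ε (N i) + 1) (k (N i) l.succ.castSucc)
      (k (N i) l.succ.castSucc + windowSize ε (N i)) := by
  set u := τ l.succ.castSucc with hu
  have hgap1 := M.gap l.castSucc
  have hgap2 := M.gap l.succ
  have hcs : l.castSucc.succ = l.succ.castSucc := Fin.succ_castSucc l
  rw [hcs, ← hu] at hgap1
  rw [← hu] at hgap2
  set b : ι → ℕ := fun i => k (N i) l.succ.castSucc with hb
  set w : ι → ℕ := fun i => windowSize ε (N i) with hw
  have hn0 := hN.eventually_gt_atTop 0
  have hmono := hN.eventually M.strictMono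
  have hw0 : ∀ᶠ i in L, 0 < w i := ((tendsto_windowSize hε).comp hN).eventually_gt_atTop 0
  have hblim : Tendsto (fun i => (b i : ℝ) / N i) L (𝓝 u) := (M.tendsto _).comp hN
  have hwlim : Tendsto (fun i => (w i : ℝ) / N i) L (𝓝 ε) := (tendsto_windowSize_div hε.le).comp hN
  have hk0 : ∀ᶠ i in L, k (N i) l.castSucc.castSucc + w i ≤ b i := by
    have h1 := ((M.tendsto l.castSucc.castSucc).comp hN).add hwlim
    filter_upwards [h1.eventually_lt hblim (by linarith), hn0] with i hi hn
    have hn : (0 : ℝ) < N i := by exact_mod_cast hn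
    simp only [Function.comp_apply] at hi
    rw [← add_div, div_lt_div_iff_of_pos_right hn] at hi
    exact_mod_cast hi.le
  have hk2 : ∀ᶠ i in L, b i + w i ≤ k (N i) l.succ.succ := by
    have h1 := hblim.add hwlim
    filter_upwards [h1.eventually_lt ((M.tendsto l.succ.succ).comp hN) (by linarith), hn0]
      with i hi hn
    have hn : (0 : ℝ) < N i := by exact_mod_cast hn
    simp only [Function.comp_apply] at hi
    rw [← add_div, div_lt_div_iff_of_pos_right hn] at hi
    exact_mod_cast hi.le
  have heN : ∀ᶠ i in L, b i + w i ≤ N i := by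
    filter_upwards [hk2, hmono] with i h1 h2
    refine h1.trans ?_
    conv_rhs => rw [← M.last (N i)]
    exact h2.monotone (Fin.le_last _)
  have halim : Tendsto (fun i => ((b i - w i : ℕ) : ℝ) / N i) L (𝓝 (u - ε)) := by
    refine (hblim.sub hwlim).congr' ?_
    filter_upwards [hk0] with i hi
    rw [Nat.cast_sub (by omega), sub_div]
  have helim : Tendsto (fun i => ((b i + w i : ℕ) : ℝ) / N i) L (𝓝 (u + ε)) := by
    refine (hblim.add hwlim).congr fun i => ?_
    rw [Nat.cast_add, add_div]
  -- These limits concern the noise path alone; `hgram` below shows that its normalizer is also that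
  -- of the shifted data.
  have hV := h.tendsto_normalizer hf hN halim hblim helim (Eventually.of_forall fun i => by omega)
    (Eventually.of_forall fun i => by omega) heN (by linarith) (by linarith)
  have hC := h.tendsto_contrast hN halim hblim helim (by linarith)
  -- the contrast divided by `√n δ`
  have hinv : Tendsto (fun i => (Real.sqrt (N i) * δ (N i))⁻¹) L (𝓝 0) := by
    have h1 : Tendsto (fun i => Real.sqrt (((N i : ℝ) * δ (N i) ^ 2)⁻¹)) L (𝓝 0) := by
      have := (Real.continuous_sqrt.tendsto 0).comp (M.signal.comp hN).inv_tendsto_atTop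
      rwa [Real.sqrt_zero] at this
    rw [tendsto_zero_iff_abs_tendsto_zero]
    refine h1.congr fun i => ?_
    rw [Function.comp_apply, ← Real.sqrt_sq_eq_abs, inv_pow, mul_pow,
      Real.sq_sqrt (Nat.cast_nonneg _)]
  have hs : Tendsto (fun i => (Real.sqrt ((((b i + w i : ℕ) : ℝ) - (b i - w i : ℕ)) / N i))⁻¹) L
      (𝓝 (Real.sqrt (u + ε - (u - ε)))⁻¹) := by
    simp only [sub_div]
    exact ((Real.continuous_sqrt.tendsto _).comp (helim.sub halim)).inv₀
      (Real.sqrt_pos.2 (by linarith)).ne'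
  have hD := (hinv.smul hC).sub ((hs.mul (hwlim.div_const 2)).smul_const (η l))
  -- After division by `√N δ` the noise contrast vanishes and a nonzero multiple of `η l` remains.
  set D₀ : Fin d → ℝ := (0 : ℝ) • limContrast f (u - ε) u (u + ε) -
    ((Real.sqrt (u + ε - (u - ε)))⁻¹ * (ε / 2)) • η l with hD₀
  have hD₀0 : D₀ ≠ 0 := by
    rw [hD₀, zero_smul, zero_sub, neg_ne_zero]
    have : 0 < Real.sqrt (u + ε - (u - ε)) := Real.sqrt_pos.2 (by linarith)
    exact smul_ne_zero (by positivity) (M.jump_ne_zero l)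
  have h0 : 0 ≤ u - ε := by linarith [M.tau_nonneg l.castSucc.castSucc]
  have h1 : u + ε ≤ 1 := by linarith [M.tau_le_one l.succ.succ]
  have hdet := hnd.limNormalizer_det_ne_zero hf h0 (by linarith : u - ε < u)
    (by linarith : u < u + ε) h1
  have hT := tendsto_dotProduct_inv_mulVec hV hD hdet
  set V₀ := limNormalizer f (u - ε) u (u + ε) with hV₀
  have hT0 : 0 < D₀ ⬝ᵥ V₀⁻¹.mulVec D₀ := by
    have hVD : V₀.mulVec (V₀⁻¹.mulVec D₀) = D₀ := by
      rw [Matrix.mulVec_mulVec, Matrix.mul_nonsing_inv _ (isUnit_iff_ne_zero.2 hdet),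
        Matrix.one_mulVec]
    have hne : V₀⁻¹.mulVec D₀ ≠ 0 := fun h => hD₀0 (by rw [← hVD, h, Matrix.mulVec_zero])
    have := hnd.limNormalizer_pos hf h0 (by linarith : u - ε < u)
      (by linarith : u < u + ε) h1 hne
    rwa [← hV₀, hVD, dotProduct_comm] at this
  refine ⟨(D₀ ⬝ᵥ V₀⁻¹.mulVec D₀) / 2, half_pos hT0, ?_⟩
  filter_upwards [hT.eventually_const_lt (half_lt_self hT0), hx, hn0, hmono, hw0, hk0, hk2, heN,
    hN.eventually (M.signal.eventually_gt_atTop 0)] with i hi hx hn0 hmono hw0 hk0 hk2 heN hsig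
  have hn : (0 : ℝ) < N i := by exact_mod_cast hn0
  have hsn : 0 < Real.sqrt (N i) := Real.sqrt_pos.2 hn
  have hsq : Real.sqrt (N i) ^ 2 = N i := Real.sq_sqrt hn.le
  have hδ : δ (N i) ≠ 0 := by
    intro h0
    rw [h0] at hsig
    norm_num at hsig
  set Z := shiftedPath (k (N i)) (θ (N i)) (N i) (F i) with hZ
  set G : ℕ → Fin d → ℝ := fun q => F i ((q : ℝ) / N i) with hG
  set P₀ := (Real.sqrt (N i))⁻¹ • (shiftSum (k (N i)) (θ (N i)) (b i) -
        (b i : ℝ) • θ (N i) l.castSucc) with hP₀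
  set P₁ := Real.sqrt (N i) • θ (N i) l.castSucc with hP₁
  set P₀' := (Real.sqrt (N i))⁻¹ • (shiftSum (k (N i)) (θ (N i)) (b i) -
        (b i : ℝ) • θ (N i) l.succ) with hP₀'
  set P₁' := Real.sqrt (N i) • θ (N i) l.succ with hP₁'
  have hprev : k (N i) l.castSucc.castSucc ≤ b i := by omega
  have hZl : ∀ q : ℕ, b i - w i ≤ q → q ≤ b i → Z q = G q + P₀ + ((q : ℝ) / N i) • P₁ :=
    fun q hq1 hq2 => shiftedPath_eq_affine hmono.monotone (θ (N i)) hn0.ne' (F i) hprev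
      (by rw [hcs]) (by omega) (by rw [hcs]; exact hq2)
  have hZr : ∀ q : ℕ, b i ≤ q → q ≤ b i + w i → Z q = G q + P₀' + ((q : ℝ) / N i) • P₁' :=
    fun q hq1 hq2 => shiftedPath_eq_affine hmono.monotone (θ (N i)) hn0.ne' (F i) (l := l.succ)
      le_rfl (by omega) hq1 (by omega)
  have hy : ∀ t, 1 ≤ t → t ≤ N i → piecewiseShift (k (N i)) (θ (N i)) (x i) t =
      Real.sqrt (N i) • (Z t - Z (t - 1)) := fun t h1 h2 => piecewiseShift_eq hx h1 h2
  have hkink : dbridge Z (b i - w i) (b i) (b i + w i) = dbridge G (b i - w i) (b i) (b i + w i) -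
      ((w i : ℝ) / N i / 2) • (Real.sqrt (N i) • δ (N i) • η l) := by
    refine dbridge_of_kink hw0 (by omega) (hZl _ le_rfl (Nat.sub_le _ _))
      (hZl _ (Nat.sub_le _ _) le_rfl) ?_
    rw [hZr _ (Nat.le_add_right _ _) le_rfl, ← M.jump, hP₀', hP₀, hP₁', hP₁]
    ext j
    simp only [Pi.add_apply, Pi.sub_apply, Pi.smul_apply, smul_eq_mul]
    push_cast
    field_simp
    rw [hsq]
    ring
  -- Each half of the window has constant mean, hence affine drift, so the jump is invisible to the
  -- normalizer.
  have hgram : bridgeGram Z (N i) (b i - w i) (b i) (b i + w i) =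
      bridgeGram G (N i) (b i - w i) (b i) (b i + w i) := by
    refine bridgeGram_congr (fun q hq => ?_) fun q hq => ?_
    · rw [Finset.mem_Ioc] at hq
      exact dbridge_add_affine P₀ P₁ (N i) (by omega) (hZl _ le_rfl (Nat.sub_le _ _))
        (hZl _ hq.1.le hq.2) (hZl _ (Nat.sub_le _ _) le_rfl)
    · rw [Finset.mem_Ioc] at hq
      exact dbridge_add_affine P₀' P₁' (N i) (by omega) (hZr _ le_rfl (Nat.le_add_right _ _))
        (hZr _ hq.1.le hq.2) (hZr _ (Nat.le_add_right _ _) le_rfl)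
  change _ < snStat _ (b i - w i + 1) (b i) (b i + w i)
  rw [snStat, contrast_eq hy (by omega) (by omega) heN, normalizer_eq hy (by omega) (by omega) heN,
    hgram, hkink]
  have hsplit : (Real.sqrt ((((b i + w i : ℕ) : ℝ) - (b i - w i : ℕ)) / N i))⁻¹ •
      (dbridge G (b i - w i) (b i) (b i + w i) -
        ((w i : ℝ) / N i / 2) • (Real.sqrt (N i) • δ (N i) • η l)) =
      (Real.sqrt (N i) * δ (N i)) • ((Real.sqrt (N i) * δ (N i))⁻¹ •
        (Real.sqrt ((((b i + w i : ℕ) : ℝ) - (b i - w i : ℕ)) / N i))⁻¹ •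
          dbridge G (b i - w i) (b i) (b i + w i) -
        ((Real.sqrt ((((b i + w i : ℕ) : ℝ) - (b i - w i : ℕ)) / N i))⁻¹ *
          ((w i : ℝ) / N i / 2)) • η l) := by
    have hne : Real.sqrt (N i) * δ (N i) ≠ 0 := mul_ne_zero hsn.ne' hδ
    rw [smul_sub, smul_sub, smul_inv_smul₀ hne]
    simp only [smul_smul]
    congr 2
    ring
  rw [hsplit]
  simp only [Matrix.mulVec_smul, smul_dotProduct, dotProduct_smul, smul_eq_mul]
  have hρ : Real.sqrt (N i) * δ (N i) * (Real.sqrt (N i) * δ (N i)) = N i * δ (N i) ^ 2 := by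
    rw [← sq, mul_pow, hsq]
  rw [← mul_assoc (Real.sqrt (N i) * δ (N i)), hρ, mul_comm]
  exact mul_lt_mul_of_pos_left hi hsig

end Signal

end SNCP

namespace SNCP

/-! ### The segmentation algorithm -/

section Algorithm

variable {d m : ℕ}

/-- A value above `K` forces the chosen `k` to be smaller than `e`, so both subsegments are strictly
shorter and the recursion terminates. -/
theorem exists_isOutput {T : ℕ → ℕ → ℕ → ℝ} {K : ℝ} {h : ℕ} (hh : 0 < h)
    (hT : ∀ s e k, e ≤ k → T s e k ≤ K) (s e : ℕ) : ∃ S, IsOutput T K h s e S := by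
  induction hlen : e + 1 - s using Nat.strong_induction_on generalizing s e with
  | _ len ih =>
  by_cases hshort : e + 1 < s + 2 * h
  · exact ⟨∅, .tooShort hshort⟩
  obtain ⟨k, hk, hmax⟩ := (Finset.Icc s e).exists_max_image (T s e)
    (Finset.nonempty_Icc.2 (by omega))
  rcases le_or_gt (T s e k) K with hle | hgt
  · exact ⟨∅, .noChange hshort hk hmax hle⟩
  have hke : k < e := by
    by_contra! hek
    exact (hT s e k hek).not_gt hgt
  have hsk := (Finset.mem_Icc.1 hk).1
  obtain ⟨S₁, h₁⟩ := ih (k + 1 - s) (by omega) s k rfl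
  obtain ⟨S₂, h₂⟩ := ih (e + 1 - (k + 1)) (by omega) (k + 1) e rfl
  exact ⟨_, .change hshort hk hmax hgt h₁ h₂⟩

/-- If in every segment between points close to `κ i` and `κ j` the procedure finds a point close
to some `κ l` strictly between, whenever there is one, and none otherwise, then the output consists
of exactly one point close to each `κ l` strictly between. -/
theorem IsOutput.exists_eq_image {T : ℕ → ℕ → ℕ → ℝ} {K : ℝ} {h : ℕ} {κ : Fin (m + 2) → ℕ} {r : ℝ}
    (hdet : ∀ (s e : ℕ) (i j : Fin (m + 2)), i < j → |(s : ℝ) - 1 - κ i| ≤ r →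
      |(e : ℝ) - κ j| ≤ r → (∃ l, i < l ∧ l < j) → ¬ e + 1 < s + 2 * h ∧
      (∃ k ∈ Finset.Icc s e, K < T s e k) ∧ ∀ k ∈ Finset.Icc s e,
        (∀ k' ∈ Finset.Icc s e, T s e k' ≤ T s e k) → ∃ l, i < l ∧ l < j ∧ |(k : ℝ) - κ l| ≤ r)
    (hnone : ∀ (s e : ℕ) (i j : Fin (m + 2)), i < j → |(s : ℝ) - 1 - κ i| ≤ r →
      |(e : ℝ) - κ j| ≤ r → (¬ ∃ l, i < l ∧ l < j) → ∀ k ∈ Finset.Icc s e, T s e k ≤ K)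
    {s e : ℕ} {S : Finset ℕ} (hS : IsOutput T K h s e S) :
    ∀ i j : Fin (m + 2), i < j → |(s : ℝ) - 1 - κ i| ≤ r → |(e : ℝ) - κ j| ≤ r →
      ∃ g : Fin (m + 2) → ℕ, (∀ l, i < l → l < j → |(g l : ℝ) - κ l| ≤ r) ∧
        S = (Finset.Ioo i j).image g := by
  have hempty : ∀ i j : Fin (m + 2), (¬ ∃ l, i < l ∧ l < j) → ∃ g : Fin (m + 2) → ℕ,
      (∀ l, i < l → l < j → |(g l : ℝ) - κ l| ≤ r) ∧ ∅ = (Finset.Ioo i j).image g := by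
    intro i j hij
    refine ⟨κ, fun l h1 h2 => absurd ⟨l, h1, h2⟩ hij, ?_⟩
    rw [eq_comm, Finset.image_eq_empty, Finset.eq_empty_iff_forall_notMem]
    exact fun l hl => hij ⟨l, Finset.mem_Ioo.1 hl⟩
  induction hS with
  | tooShort hlen =>
    intro i j hij hs he
    exact hempty i j fun hbet => (hdet _ _ i j hij hs he hbet).1 hlen
  | noChange hlen hk hmax hle =>
    intro i j hij hs he
    refine hempty i j fun hbet => ?_
    obtain ⟨k', hk', hlt⟩ := (hdet _ _ i j hij hs he hbet).2.1
    exact absurd (hlt.trans_le ((hmax k' hk').trans hle)) (lt_irrefl _)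
  | @change s e k S₁ S₂ hlen hk hmax hgt hleft hright ih₁ ih₂ =>
    intro i j hij hs he
    by_cases hbet : ∃ l, i < l ∧ l < j
    · obtain ⟨l, hil, hlj, hkl⟩ := (hdet _ _ i j hij hs he hbet).2.2 k hk hmax
      obtain ⟨g₁, hg₁, rfl⟩ := ih₁ i l hil hs hkl
      -- The right part starts at `k + 1`; this is why the invariant compares `s - 1` with `κ i`.
      obtain ⟨g₂, hg₂, rfl⟩ := ih₂ l j hlj (by push_cast; rwa [add_sub_cancel_right]) he
      refine ⟨fun q => if q < l then g₁ q else if q = l then k else g₂ q, fun q h1 h2 => ?_, ?_⟩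
      · rcases lt_trichotomy q l with h | rfl | h
        · simpa [h] using hg₁ q h1 h
        · simpa using hkl
        · simpa [h.not_gt, h.ne'] using hg₂ q h h2
      · ext z
        simp only [Finset.mem_insert, Finset.mem_union, Finset.mem_image, Finset.mem_Ioo]
        constructor
        · rintro (rfl | ⟨q, ⟨h1, h2⟩, rfl⟩ | ⟨q, ⟨h1, h2⟩, rfl⟩)
          · exact ⟨l, ⟨hil, hlj⟩, by simp⟩
          · exact ⟨q, ⟨h1, h2.trans hlj⟩, by simp [h2]⟩
          · exact ⟨q, ⟨hil.trans h1, h2⟩, by simp [h1.not_gt, h1.ne']⟩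
        · rintro ⟨q, ⟨h1, h2⟩, rfl⟩
          rcases lt_trichotomy q l with h | rfl | h
          · exact Or.inr (Or.inl ⟨q, ⟨h1, h⟩, by simp [h]⟩)
          · exact Or.inl (by simp)
          · exact Or.inr (Or.inr ⟨q, ⟨h, h2⟩, by simp [h.not_gt, h.ne']⟩)
    · exact absurd (hnone _ _ i j hij hs he hbet k hk) hgt.not_ge

theorem exists_eq_succ_castSucc {l : Fin (m + 2)} (h₀ : 0 < l) (h₁ : l < Fin.last (m + 1)) :
    ∃ i : Fin m, l = i.succ.castSucc := by
  refine ⟨⟨(l : ℕ) - 1, ?_⟩, ?_⟩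
  · have h2 : (l : ℕ) < m + 1 := h₁
    have h3 : 0 < (l : ℕ) := h₀
    omega
  · have h3 : 0 < (l : ℕ) := h₀
    ext
    simp
    omega

/-- Separation by more than `2 r` makes `g` strictly increasing, so it is the increasing enumeration
of `S`. -/
theorem exists_card_eq_of_eq_image {κ : Fin (m + 2) → ℕ} {r : ℝ}
    (hsep : ∀ i j : Fin (m + 2), i < j → (κ i : ℝ) + 2 * r < κ j) {S : Finset ℕ}
    {g : Fin (m + 2) → ℕ}
    (hg : ∀ l, 0 < l → l < Fin.last (m + 1) → |(g l : ℝ) - κ l| ≤ r)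
    (hS : S = (Finset.Ioo 0 (Fin.last (m + 1))).image g) :
    ∃ hcard : S.card = m, ∀ i : Fin m,
      |(S.orderEmbOfFin hcard i : ℝ) - (κ i.succ.castSucc : ℝ)| ≤ r := by
  have hpos : ∀ i : Fin m, 0 < i.succ.castSucc := fun i => by
    rw [Fin.lt_def]
    simp
  have hlast : ∀ i : Fin m, i.succ.castSucc < Fin.last (m + 1) := fun i => Fin.castSucc_lt_last _
  set φ : Fin m → ℕ := fun i => g i.succ.castSucc with hφ
  have hnear : ∀ i, |(φ i : ℝ) - (κ i.succ.castSucc : ℝ)| ≤ r := fun i => hg _ (hpos i) (hlast i)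
  have hmono : StrictMono φ := by
    intro i j hij
    have h1 := abs_le.1 (hnear i)
    have h2 := abs_le.1 (hnear j)
    have h3 := hsep i.succ.castSucc j.succ.castSucc
      (Fin.castSucc_lt_castSucc_iff.2 (Fin.succ_lt_succ_iff.2 hij))
    have : (φ i : ℝ) < φ j := by linarith [h1.2, h2.1]
    exact_mod_cast this
  have himg : S = Finset.univ.image φ := by
    rw [hS]
    ext z
    simp only [Finset.mem_image, Finset.mem_Ioo, Finset.mem_univ, true_and]
    constructor
    · rintro ⟨l, ⟨h1, h2⟩, rfl⟩
      obtain ⟨i, rfl⟩ := exists_eq_succ_castSucc h1 h2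
      exact ⟨i, rfl⟩
    · rintro ⟨i, rfl⟩
      exact ⟨_, ⟨hpos i, hlast i⟩, rfl⟩
  have hcard : S.card = m := by
    rw [himg, Finset.card_image_of_injective _ hmono.injective, Finset.card_univ, Fintype.card_fin]
  refine ⟨hcard, fun i => ?_⟩
  rw [← Finset.orderEmbOfFin_unique hcard (f := φ)
    (fun i => by rw [himg]; exact Finset.mem_image_of_mem _ (Finset.mem_univ i)) hmono]
  exact hnear i

theorem exists_of_mem_nestedWindowsIn {n h s e k : ℕ} (hh : 0 < h) {p : ℕ × ℕ}
    (hp : p ∈ nestedWindowsIn n h s e k) : ∃ a : ℕ, p.1 = a + 1 ∧ a + h ≤ k ∧ k + h ≤ p.2 ∧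
      p.2 ≤ n ∧ s ≤ a + 1 ∧ p.2 ≤ e := by
  obtain ⟨hp1, hp2, -, hp3⟩ := Finset.mem_filter.1 hp
  obtain ⟨j₁, j₂, h1, h2, h3, h4, rfl⟩ := (mem_nestedWindows hh).1 hp1
  have h5 : h ≤ j₁ * h := Nat.le_mul_of_pos_left h h1
  have h6 : h ≤ j₂ * h := Nat.le_mul_of_pos_left h h2
  simp only at hp2 hp3 ⊢
  refine ⟨k - j₁ * h, rfl, by omega, by omega, by omega, hp2, hp3⟩

theorem mem_nestedWindowsIn_self {n h s e k : ℕ} (hh : 0 < h) (hk : h ≤ k) (hn : k + h ≤ n)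
    (hs : s ≤ k - h + 1) (he : k + h ≤ e) :
    (k - h + 1, k + h) ∈ nestedWindowsIn n h s e k := by
  rw [nestedWindowsIn, Finset.mem_filter, mem_nestedWindows hh]
  refine ⟨⟨1, 1, le_rfl, le_rfl, by omega, by omega, by rw [one_mul]⟩, ?_⟩
  simp only
  omega

theorem maxStat_eq_zero (y : ℕ → Fin d → ℝ) {n h s e k : ℕ} (hh : 0 < h) (hek : e ≤ k) :
    maxStat y n h s e k = 0 := by
  have : nestedWindowsIn n h s e k = ∅ := by
    refine Finset.eq_empty_of_forall_notMem fun p hp => ?_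
    obtain ⟨a, -, -, h1, -, -, h2⟩ := exists_of_mem_nestedWindowsIn hh hp
    omega
  rw [maxStat, this, maxOrZero, dif_neg Finset.not_nonempty_empty]

/-- Deterministic consistency of the segmentation: if the statistic is large at the change-points,
small far from the change-points and below the threshold whenever its distance to the change-points
is almost the window size, then all change-points are found, and only these. -/
theorem isOutput_correct {y : ℕ → Fin d → ℝ} {n h : ℕ} {κ : Fin (m + 2) → ℕ} {r K A : ℝ}
    (hh : 0 < h) (hr : 0 ≤ r) (hrh : 2 * r < h) (hK : 0 ≤ K) (hA : 0 ≤ A)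
    (hκ : StrictMono κ) (hκ₀ : κ 0 = 0) (hκ₁ : κ (Fin.last (m + 1)) = n)
    (hgap : ∀ l : Fin (m + 1), (κ l.castSucc : ℝ) + h + r ≤ κ l.succ)
    (hlarge : ∀ l : Fin m, max K A < snStat y (κ l.succ.castSucc - h + 1) (κ l.succ.castSucc)
      (κ l.succ.castSucc + h))
    (hfar : ∀ k a e : ℕ, a + h ≤ k → k + h ≤ e → e ≤ n →
      (∀ l : Fin m, r < |(k : ℝ) - κ l.succ.castSucc|) → snStat y (a + 1) k e ≤ A)
    (hnull : ∀ k a e : ℕ, a + h ≤ k → k + h ≤ e → e ≤ n →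
      (∀ l : Fin m, h - r ≤ |(k : ℝ) - κ l.succ.castSucc|) → snStat y (a + 1) k e ≤ K) :
    (∃ S, IsOutput (maxStat y n h) K h 1 n S) ∧ ∀ S, IsOutput (maxStat y n h) K h 1 n S →
      ∃ hS : S.card = m, ∀ i : Fin m,
        |(S.orderEmbOfFin hS i : ℝ) - (κ i.succ.castSucc : ℝ)| ≤ r := by
  have hgap' : ∀ i j : Fin (m + 2), i < j → (κ i : ℝ) + h + r ≤ κ j := by
    intro i j hij
    obtain ⟨j, rfl⟩ := Fin.exists_succ_eq.2 (Fin.ne_zero_of_lt hij)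
    have h1 : (κ i : ℝ) ≤ κ j.castSucc := by
      exact_mod_cast hκ.monotone (Fin.le_castSucc_iff.2 hij)
    linarith [hgap j]
  refine ⟨exists_isOutput hh (fun s e k hek => (maxStat_eq_zero y hh hek).trans_le hK) 1 n,
    fun S hS => ?_⟩
  -- The gaps leave room `h + r`, so the window of length `2 h` around a true change-point fits
  -- despite endpoint errors up to `r`. The maximum therefore exceeds `A`, and a maximizer must be
  -- near some change-point. Its own window lies in `[s, e]`, and `2 r < h` places that change-point
  -- strictly between `κ i` and `κ j`.
  have hdet : ∀ (s e : ℕ) (i j : Fin (m + 2)), i < j → |(s : ℝ) - 1 - κ i| ≤ r →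
      |(e : ℝ) - κ j| ≤ r → (∃ l, i < l ∧ l < j) → ¬ e + 1 < s + 2 * h ∧
      (∃ k ∈ Finset.Icc s e, K < maxStat y n h s e k) ∧ ∀ k ∈ Finset.Icc s e,
        (∀ k' ∈ Finset.Icc s e, maxStat y n h s e k' ≤ maxStat y n h s e k) →
          ∃ l, i < l ∧ l < j ∧ |(k : ℝ) - κ l| ≤ r := by
    rintro s e i j hij hs he ⟨l, hil, hlj⟩
    have hs' := abs_le.1 hs
    have he' := abs_le.1 he
    obtain ⟨l, rfl⟩ := exists_eq_succ_castSucc ((Fin.zero_le i).trans_lt hil)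
      (hlj.trans_le (Fin.le_last j))
    set b := κ l.succ.castSucc with hb
    have h1 := hgap' _ _ hil
    have h2 := hgap' _ _ hlj
    have h3 : κ j ≤ n := hκ₁ ▸ hκ.monotone (Fin.le_last j)
    have hi0 : (0 : ℝ) ≤ κ i := Nat.cast_nonneg _
    have h4 : s + h ≤ b + 1 := by
      have : (s : ℝ) + h ≤ b + 1 := by linarith [hs'.2]
      exact_mod_cast this
    have h5 : b + h ≤ e := by
      have : (b : ℝ) + h ≤ e := by linarith [he'.1]
      exact_mod_cast this
    have h6 : h ≤ b := by
      have : (h : ℝ) ≤ b := by linarith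
      exact_mod_cast this
    have h7 : b + h ≤ n := by
      have h8 : (b : ℝ) + h ≤ κ j := by linarith
      have h9 : b + h ≤ κ j := by exact_mod_cast h8
      omega
    have hmem := mem_nestedWindowsIn_self (s := s) (e := e) hh h6 h7 (by omega) h5
    have hle := snStat_le_maxStat y hmem
    dsimp only at hle
    have hmax : max K A < maxStat y n h s e b := (hlarge l).trans_le hle
    refine ⟨by omega, ⟨b, Finset.mem_Icc.2 (by omega), (le_max_left _ _).trans_lt hmax⟩,
      fun k hk hkmax => ?_⟩
    have hAk : A < maxStat y n h s e k :=
      ((le_max_right _ _).trans_lt hmax).trans_le (hkmax b (Finset.mem_Icc.2 (by omega)))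
    obtain ⟨p, hp, hlt⟩ := exists_lt_of_lt_maxOrZero hA hAk
    obtain ⟨a, hp1, hak, hkp, hpn, hsa, hpe⟩ := exists_of_mem_nestedWindowsIn hh hp
    rw [hp1] at hlt
    have hnear : ∃ l' : Fin m, |(k : ℝ) - κ l'.succ.castSucc| ≤ r := by
      by_contra! hcon
      exact (hfar k a p.2 hak hkp hpn hcon).not_gt hlt
    obtain ⟨l', hl'⟩ := hnear
    have hl'' := abs_le.1 hl'
    have h8 : (s : ℝ) + h ≤ k + 1 := by exact_mod_cast (show s + h ≤ k + 1 by omega)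
    have h9 : (k : ℝ) + h ≤ e := by exact_mod_cast (show k + h ≤ e by omega)
    refine ⟨l'.succ.castSucc, hκ.lt_iff_lt.1 ?_, hκ.lt_iff_lt.1 ?_, hl'⟩
    · have : (κ i : ℝ) < κ l'.succ.castSucc := by linarith [hs'.1, hl''.2]
      exact_mod_cast this
    · have : (κ l'.succ.castSucc : ℝ) < κ j := by linarith [he'.2, hl''.1]
      exact_mod_cast this
  have hnone : ∀ (s e : ℕ) (i j : Fin (m + 2)), i < j → |(s : ℝ) - 1 - κ i| ≤ r →
      |(e : ℝ) - κ j| ≤ r → (¬ ∃ l, i < l ∧ l < j) → ∀ k ∈ Finset.Icc s e,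
        maxStat y n h s e k ≤ K := by
    intro s e i j hij hs he hbet k hk
    have hs' := abs_le.1 hs
    have he' := abs_le.1 he
    by_contra! hlt
    obtain ⟨p, hp, hlt⟩ := exists_lt_of_lt_maxOrZero hK hlt
    obtain ⟨a, hp1, hak, hkp, hpn, hsa, hpe⟩ := exists_of_mem_nestedWindowsIn hh hp
    rw [hp1] at hlt
    -- A point with an admissible window is at least `h` inside the segment, hence at distance at
    -- least `h - r` from `κ i`, `κ j` and all change-points beyond them.
    refine (hnull k a p.2 hak hkp hpn fun l => ?_).not_gt hlt
    have h8 : (s : ℝ) + h ≤ k + 1 := by exact_mod_cast (show s + h ≤ k + 1 by omega)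
    have h9 : (k : ℝ) + h ≤ e := by exact_mod_cast (show k + h ≤ e by omega)
    rcases le_or_gt l.succ.castSucc i with hli | hli
    · have : (κ l.succ.castSucc : ℝ) ≤ κ i := by exact_mod_cast hκ.monotone hli
      exact le_abs.2 (Or.inl (by linarith [hs'.1]))
    · have hjl : j ≤ l.succ.castSucc := not_lt.1 fun h => hbet ⟨_, hli, h⟩
      have : (κ j : ℝ) ≤ κ l.succ.castSucc := by exact_mod_cast hκ.monotone hjl
      exact le_abs.2 (Or.inr (by linarith [he'.2]))
  obtain ⟨g, hg, himg⟩ := IsOutput.exists_eq_image hdet hnone hS 0 (Fin.last (m + 1))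
    (Fin.last_pos) (by simpa [hκ₀] using hr) (by simpa [hκ₁] using hr)
  exact exists_card_eq_of_eq_image (fun i j hij => by linarith [hgap' i j hij]) hg himg

/-! ### Asymptotic correctness of the estimates -/

variable {ε : ℝ} {k : ℕ → Fin (m + 2) → ℕ} {τ : Fin (m + 2) → ℝ}
  {θ : ℕ → Fin (m + 1) → Fin d → ℝ} {δ : ℕ → ℝ} {η : Fin m → Fin d → ℝ}
  {ι : Type*} {L : Filter ι} {N : ι → ℕ} {F : ι → ℝ → Fin d → ℝ} {f : ℝ → Fin d → ℝ}
  {x : ι → ℕ → Fin d → ℝ}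

/-- All estimates are correct with accuracy `r`. -/
def EstimatesCorrect (ε : ℝ) (y : ℕ → Fin d → ℝ) (n : ℕ) (K : ℝ) (κ : Fin (m + 2) → ℕ) (r : ℝ) :
    Prop :=
  (∃ S, IsEstimate ε y n K S) ∧ ∀ S, IsEstimate ε y n K S →
    ∃ hS : S.card = m, ∀ i : Fin m, |(S.orderEmbOfFin hS i : ℝ) - (κ i.succ.castSucc : ℝ)| ≤ r

/-- The sum of inverses gives a common lower bound that also covers `m = 0`. -/
theorem exists_pos_forall_le {c : Fin m → ℝ} (hc : ∀ l, 0 < c l) : ∃ c₀ > 0, ∀ l, c₀ ≤ c l := by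
  have h0 : 0 ≤ ∑ l, (c l)⁻¹ := Finset.sum_nonneg fun l _ => (inv_pos.2 (hc l)).le
  refine ⟨(1 + ∑ l, (c l)⁻¹)⁻¹, by positivity, fun l => inv_le_of_inv_le₀ (hc l) ?_⟩
  have : (c l)⁻¹ ≤ ∑ l, (c l)⁻¹ := Finset.single_le_sum (f := fun l => (c l)⁻¹)
    (fun l _ => (inv_pos.2 (hc l)).le) (Finset.mem_univ l)
  linarith

/-- The deterministic criterion is applied with level `A = c₀ n δ²`, where `c₀` works at all
change-points. Because `κ < 1`, the threshold `(n δ²)^κ` is eventually below this level, and because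
`κ > 0` it diverges and exceeds the bounded statistics. -/
theorem MeanChange.eventually_correct (M : MeanChange ε k τ θ δ η) (h : ContConv L F f)
    (hf : Continuous f) (hnd : Nondegenerate f) (hN : Tendsto N L atTop) (hε : 0 < ε)
    (hx : ∀ᶠ i in L, ∀ t, 1 ≤ t → t ≤ N i →
      x i t = Real.sqrt (N i) • (F i ((t : ℝ) / N i) - F i (((t : ℝ) - 1) / N i)))
    {r : ℕ → ℝ} (hr : ∀ n, 0 < r n) (hr' : Tendsto (fun n => r n / n) atTop (𝓝 0))
    (hrate : Tendsto (fun n : ℕ => (n : ℝ) / (r n ^ 2 * δ n ^ 2)) atTop (𝓝 0)) {κ : ℝ}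
    (hκ₀ : 0 < κ) (hκ₁ : κ < 1) :
    ∀ᶠ i in L, EstimatesCorrect ε (piecewiseShift (k (N i)) (θ (N i)) (x i)) (N i)
      (((N i : ℝ) * δ (N i) ^ 2) ^ κ) (k (N i)) (r (N i)) := by
  have hA : ∀ l : Fin m, ∃ c > 0, ∀ᶠ i in L, c * (N i * δ (N i) ^ 2) <
      snStat (piecewiseShift (k (N i)) (θ (N i)) (x i))
      (k (N i) l.succ.castSucc - windowSize ε (N i) + 1) (k (N i) l.succ.castSucc)
      (k (N i) l.succ.castSucc + windowSize ε (N i)) := fun l =>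
    M.exists_signal_le_snStat h hf hnd hN hε hx l
  choose c hc hev using hA
  obtain ⟨c₀, hc₀, hcle⟩ := exists_pos_forall_le hc
  have hB := M.eventually_snStat_le_signal h hf hnd hN hε hx hr hrate hc₀
  have hC := M.eventually_snStat_le_threshold h hf hnd hN hε hx (r := r) hr'
    ((tendsto_rpow_atTop hκ₀).comp M.signal)
  have hsig := M.signal.comp hN
  have hKlt : ∀ᶠ i in L, ((N i : ℝ) * δ (N i) ^ 2) ^ κ ≤ c₀ * (N i * δ (N i) ^ 2) := by
    have h1 := ((tendsto_rpow_atTop (show 0 < 1 - κ by linarith)).comp hsig).eventually_ge_atTop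
      c₀⁻¹
    filter_upwards [h1, hsig.eventually_gt_atTop 0] with i h1 h2
    simp only [Function.comp_apply] at h1 h2
    set ρ := (N i : ℝ) * δ (N i) ^ 2 with hρ
    have h3 : ρ = ρ ^ κ * ρ ^ (1 - κ) := by
      rw [← Real.rpow_add h2]
      simp
    have h4 : 1 ≤ c₀ * ρ ^ (1 - κ) := by
      rw [inv_le_iff_one_le_mul₀' hc₀] at h1
      exact h1
    calc ρ ^ κ = ρ ^ κ * 1 := (mul_one _).symm
      _ ≤ ρ ^ κ * (c₀ * ρ ^ (1 - κ)) := by gcongr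
      _ = c₀ * (ρ ^ κ * ρ ^ (1 - κ)) := by ring
      _ = c₀ * ρ := by rw [← h3]
  have hwlim : Tendsto (fun i => (windowSize ε (N i) : ℝ) / N i) L (𝓝 ε) :=
    (tendsto_windowSize_div hε.le).comp hN
  have hn0 := hN.eventually_gt_atTop 0
  have hrlim : Tendsto (fun i => r (N i) / N i) L (𝓝 0) := hr'.comp hN
  have hrh : ∀ᶠ i in L, 2 * r (N i) < windowSize ε (N i) := by
    filter_upwards [(hrlim.const_mul 2).eventually_lt hwlim (by linarith), hn0] with i hi hn
    have hn : (0 : ℝ) < N i := by exact_mod_cast hn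
    rwa [← mul_div_assoc, div_lt_div_iff_of_pos_right hn] at hi
  have hgap : ∀ᶠ i in L, ∀ l : Fin (m + 1),
      (k (N i) l.castSucc : ℝ) + windowSize ε (N i) + r (N i) ≤ k (N i) l.succ := by
    rw [eventually_all]
    intro l
    have h1 := (((M.tendsto l.castSucc).comp hN).add hwlim).add hrlim
    have h2 := h1.eventually_lt ((M.tendsto l.succ).comp hN) (by linarith [M.gap l])
    filter_upwards [h2, hn0] with i hi hn
    have hn : (0 : ℝ) < N i := by exact_mod_cast hn
    simp only [Function.comp_apply] at hi
    rw [← add_div, ← add_div, div_lt_div_iff_of_pos_right hn] at hi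
    exact hi.le
  filter_upwards [eventually_all.2 hev, hB, hC, hKlt, hrh, hgap, hN.eventually M.strictMono,
    ((tendsto_windowSize hε).comp hN).eventually_gt_atTop 0, hsig.eventually_ge_atTop 0]
    with i hA hB hC hKlt hrh hgap hmono hw0 hsig0
  simp only [Function.comp_apply] at hw0 hsig0
  exact isOutput_correct (A := c₀ * (N i * δ (N i) ^ 2)) hw0 (hr _).le hrh
    (Real.rpow_nonneg hsig0 _) (by positivity) hmono (M.zero _) (M.last _) hgap
    (fun l => by
      rw [max_eq_right hKlt]
      refine lt_of_le_of_lt ?_ (hA l)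
      exact mul_le_mul_of_nonneg_right (hcle l) hsig0)
    hB hC

end Algorithm

end SNCP

namespace SNCP

/-! ### Brownian paths are nondegenerate -/

section Brownian

variable {Ω : Type*} [MeasurableSpace Ω] {P : Measure Ω} {d : ℕ}

/-- Strong law for the products `ξ a i * ξ b i`, which are integrable, identically distributed and
pairwise independent in `i`; their mean is `1` on the diagonal and `0` off it. -/
theorem ae_tendsto_sum_mul_div [IsProbabilityMeasure P] {ξ : Fin d → ℕ → Ω → ℝ}
    (hind : iIndepFun (fun (p : Fin d × ℕ) ω => ξ p.1 p.2 ω) P)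
    (hlaw : ∀ a j, HasLaw (ξ a j) (gaussianReal 0 1) P) :
    ∀ᵐ ω ∂P, ∀ a b, Tendsto (fun n : ℕ => (∑ i ∈ Finset.range n, ξ a i ω * ξ b i ω) / n) atTop
      (𝓝 (if a = b then 1 else 0)) := by
  have hm : ∀ a j, AEMeasurable (ξ a j) P := fun a j => (hlaw a j).aemeasurable
  have hL2 : ∀ a j, MemLp (ξ a j) 2 P := fun a j => by
    have h := memLp_id_gaussianReal (μ := 0) (v := 1) 2
    rw [← (hlaw a j).map_eq] at h
    exact (memLp_map_measure_iff aestronglyMeasurable_id (hm a j)).1 h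
  have hpair : ∀ (a b : Fin d) (i : ℕ), a ≠ b → ξ a i ⟂ᵢ[P] ξ b i := fun a b i hab =>
    hind.indepFun (i := (a, i)) (j := (b, i)) (by simpa using hab)
  rw [ae_all_iff]
  intro a
  rw [ae_all_iff]
  intro b
  have hident : ∀ i, IdentDistrib (fun ω => ξ a i ω * ξ b i ω) (fun ω => ξ a 0 ω * ξ b 0 ω) P P := by
    intro i
    have hprod : IdentDistrib (fun ω => (ξ a i ω, ξ b i ω)) (fun ω => (ξ a 0 ω, ξ b 0 ω)) P P := by
      refine ⟨(hm a i).prodMk (hm b i), (hm a 0).prodMk (hm b 0), ?_⟩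
      by_cases hab : a = b
      · subst hab
        have h1 : Measurable fun x : ℝ => (x, x) := by fun_prop
        have h2 : ∀ j, P.map (fun ω => (ξ a j ω, ξ a j ω)) =
            (gaussianReal 0 1).map fun x : ℝ => (x, x) := fun j => by
          rw [← (hlaw a j).map_eq, AEMeasurable.map_map_of_aemeasurable h1.aemeasurable (hm a j)]
          rfl
        rw [h2, h2]
      · rw [(indepFun_iff_map_prod_eq_prod_map_map (hm a i) (hm b i)).1 (hpair a b i hab),
          (indepFun_iff_map_prod_eq_prod_map_map (hm a 0) (hm b 0)).1 (hpair a b 0 hab),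
          (hlaw a i).map_eq, (hlaw b i).map_eq, (hlaw a 0).map_eq, (hlaw b 0).map_eq]
    exact hprod.comp (u := fun p : ℝ × ℝ => p.1 * p.2) (by fun_prop)
  have hlln := strong_law_ae_real (fun i ω => ξ a i ω * ξ b i ω)
    ((hL2 a 0).integrable_mul (hL2 b 0)) (fun i j hij => by
      have := hind.indepFun_prodMk_prodMk₀ (fun p => hm p.1 p.2) (a, i) (b, i) (a, j) (b, j)
        (by simp [hij]) (by simp [hij]) (by simp [hij]) (by simp [hij])
      exact this.comp (φ := fun p : ℝ × ℝ => p.1 * p.2) (ψ := fun p : ℝ × ℝ => p.1 * p.2)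
        (by fun_prop) (by fun_prop)) hident
  have hmean : ∫ ω, ξ a 0 ω * ξ b 0 ω ∂P = if a = b then 1 else 0 := by
    split_ifs with hab
    · subst hab
      have h1 : ∫ ω, ξ a 0 ω * ξ a 0 ω ∂P = ∫ x, x * x ∂(gaussianReal 0 1) := by
        rw [← (hlaw a 0).map_eq, integral_map (hm a 0) (by fun_prop)]
      have h2 := variance_id_gaussianReal (μ := 0) (v := 1)
      rw [variance_eq_integral aemeasurable_id] at h2
      simp only [id, integral_id_gaussianReal, sub_zero] at h2
      rw [h1]
      simpa [sq] using h2
    · have h1 := (hpair a b 0 hab).integral_fun_mul_eq_mul_integral (hm a 0).aestronglyMeasurable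
        (hm b 0).aestronglyMeasurable
      rw [h1, (hlaw a 0).integral_eq, integral_id_gaussianReal, zero_mul]
  rw [hmean] at hlln
  exact hlln

/-- The empirical quadratic form at `x` tends to `∑ a, x a ^ 2` because the Gram matrices tend to
the identity, and to `0` as a Cesàro mean of `r i ^ 2`. -/
theorem eq_zero_of_tendsto_sum_mul_div {v : Fin d → ℕ → ℝ}
    (hv : ∀ a b, Tendsto (fun n : ℕ => (∑ i ∈ Finset.range n, v a i * v b i) / n) atTop
      (𝓝 (if a = b then 1 else 0))) {r : ℕ → ℝ} (hr : Tendsto r atTop (𝓝 0)) {x : Fin d → ℝ}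
    (hx : ∀ j, ∑ a, x a * v a j = r j) : x = 0 := by
  have h1 : Tendsto (fun n : ℕ => ∑ a, ∑ b, x a * x b *
      ((∑ i ∈ Finset.range n, v a i * v b i) / n)) atTop
      (𝓝 (∑ a, ∑ b, x a * x b * if a = b then 1 else 0)) :=
    tendsto_finsetSum _ fun a _ => tendsto_finsetSum _ fun b _ => (hv a b).const_mul _
  have h2 : ∀ n : ℕ, ∑ a, ∑ b, x a * x b * ((∑ i ∈ Finset.range n, v a i * v b i) / n) =
      (n : ℝ)⁻¹ * ∑ i ∈ Finset.range n, r i ^ 2 := by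
    intro n
    have h3 : ∀ i, r i ^ 2 = ∑ a, ∑ b, x a * x b * (v a i * v b i) := fun i => by
      rw [← hx i, sq, Finset.sum_mul_sum]
      exact Finset.sum_congr rfl fun a _ => Finset.sum_congr rfl fun b _ => by ring
    simp only [h3]
    conv_rhs => rw [Finset.sum_comm, Finset.mul_sum]
    refine Finset.sum_congr rfl fun a _ => ?_
    conv_rhs => rw [Finset.sum_comm, Finset.mul_sum]
    refine Finset.sum_congr rfl fun b _ => ?_
    rw [← Finset.mul_sum]
    ring
  have h4 : Tendsto (fun n : ℕ => (n : ℝ)⁻¹ * ∑ i ∈ Finset.range n, r i ^ 2) atTop (𝓝 0) := by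
    have := (hr.pow 2).cesaro
    simpa using this
  have h5 := tendsto_nhds_unique (h1.congr h2) h4
  simp only [mul_ite, mul_one, mul_zero, Finset.sum_ite_eq, Finset.mem_univ, if_true] at h5
  rw [Finset.sum_eq_zero_iff_of_nonneg fun a _ => mul_self_nonneg _] at h5
  exact funext fun a => mul_self_eq_zero.1 (h5 a (Finset.mem_univ a))

variable {B : Fin d → ℝ≥0 → Ω → ℝ}

theorem IsBrownianVec.iIndepFun_increments (hB : IsBrownianVec B P) {t : ℕ → ℝ≥0} (ht : Monotone t)
    (c : ℕ → ℝ) : iIndepFun (fun (p : Fin d × ℕ) ω =>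
      c p.2 * (B p.1 (t (p.2 + 1)) ω - B p.1 (t p.2) ω)) P := by
  have hm : ∀ a j, AEMeasurable (fun ω => c j * (B a (t (j + 1)) ω - B a (t j) ω)) P := fun a j =>
    (((hB.coord a).aemeasurable _).sub ((hB.coord a).aemeasurable _)).const_mul _
  -- Increments are only almost everywhere measurable; measurable versions are used to combine
  -- independence across coordinates with independence in time.
  set ξ : Fin d → ℕ → Ω → ℝ := fun a j => (hm a j).mk _ with hξ
  have hae : ∀ a j, (fun ω => c j * (B a (t (j + 1)) ω - B a (t j) ω)) =ᵐ[P] ξ a j := fun a j =>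
    (hm a j).ae_eq_mk
  have h1 : iIndepFun (fun a ω => (ξ a · ω)) P := by
    have := hB.indep.comp (fun _ w (j : ℕ) => c j * (w (t (j + 1)) - w (t j)))
      (fun _ => by fun_prop)
    refine this.congr fun a => ?_
    filter_upwards [ae_all_iff.2 (hae a)] with ω hω
    exact funext fun j => hω j
  have h2 : ∀ a, iIndepFun (ξ a) P := fun a =>
    (((hB.coord a).hasIndepIncrements.nat ht).comp (fun j y => c j * y)
      (fun _ => by fun_prop)).congr (hae a)
  exact (iIndepFun_uncurry' (fun a j => (hm a j).measurable_mk) h1 h2).congr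
    fun p => (hae p.1 p.2).symm

/-- On a geometric grid accumulating at `q`, increments divided by `√ρ` are independent standard
Gaussians. If `x ⬝ B` is affine, its normalized increments are `-b₁ √ρ`, which tend to `0`, so the
Gram argument gives `x = 0`. The exceptional null set does not depend on `x`, `b₀`, `b₁`. -/
theorem IsBrownianVec.ae_eq_zero_of_affine [IsProbabilityMeasure P] (hB : IsBrownianVec B P)
    {p q : ℝ} (hp : 0 ≤ p) (hpq : p < q) : ∀ᵐ ω ∂P, ∀ (x : Fin d → ℝ) (b₀ b₁ : ℝ),
      (∀ s ∈ Set.Icc p q, (x ⬝ᵥ fun a => B a s.toNNReal ω) + b₀ + b₁ * s = 0) → x = 0 := by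
  set ρ : ℕ → ℝ := fun j => (q - p) * (1 / 2) ^ (j + 1) with hρ
  set s : ℕ → ℝ := fun j => q - (q - p) * (1 / 2) ^ j with hs
  have hρ0 : ∀ j, 0 < ρ j := fun j => mul_pos (sub_pos.2 hpq) (by positivity)
  have hstep : ∀ j, s (j + 1) - s j = ρ j := fun j => by
    simp only [hs, hρ]
    ring
  have hsmono : Monotone s := monotone_nat_of_le_succ fun j => by linarith [hstep j, hρ0 j]
  have hsp : ∀ j, p ≤ s j := fun j => by
    have := hsmono (Nat.zero_le j)
    simp only [hs, pow_zero] at this ⊢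
    linarith
  have hsq : ∀ j, s j ≤ q := fun j => by
    have : 0 ≤ (q - p) * (1 / 2) ^ j := mul_nonneg (sub_nonneg.2 hpq.le) (by positivity)
    simp only [hs]
    linarith
  set t : ℕ → ℝ≥0 := fun j => (s j).toNNReal with ht
  have htcoe : ∀ j, (t j : ℝ) = s j := fun j => Real.coe_toNNReal _ (hp.trans (hsp j))
  have htmono : Monotone t := fun i j hij => Real.toNNReal_le_toNNReal (hsmono hij)
  have hlaw : ∀ a j, HasLaw (fun ω => (Real.sqrt (ρ j))⁻¹ * (B a (t (j + 1)) ω - B a (t j) ω))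
      (gaussianReal 0 1) P := by
    intro a j
    have h1 := (hB.coord a).hasLaw_sub (t (j + 1)) (t j)
    have h2 : nndist (t (j + 1)).1 (t j).1 = (ρ j).toNNReal := by
      ext
      rw [Real.coe_toNNReal _ (hρ0 j).le]
      change dist (t (j + 1) : ℝ) (t j : ℝ) = ρ j
      rw [htcoe, htcoe, Real.dist_eq, hstep, abs_of_pos (hρ0 j)]
    rw [h2] at h1
    refine ⟨h1.aemeasurable.const_mul _, ?_⟩
    have h3 : P.map (fun ω => (Real.sqrt (ρ j))⁻¹ * (B a (t (j + 1)) ω - B a (t j) ω)) =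
        (P.map (B a (t (j + 1)) - B a (t j))).map ((Real.sqrt (ρ j))⁻¹ * ·) := by
      rw [AEMeasurable.map_map_of_aemeasurable (by fun_prop) h1.aemeasurable]
      rfl
    rw [h3, h1.map_eq, gaussianReal_map_const_mul, mul_zero]
    congr 1
    ext
    simp only [NNReal.coe_mul, NNReal.coe_mk, NNReal.coe_one, inv_pow, Real.sq_sqrt (hρ0 j).le,
      Real.coe_toNNReal _ (hρ0 j).le]
    exact inv_mul_cancel₀ (hρ0 j).ne'
  filter_upwards [ae_tendsto_sum_mul_div (hB.iIndepFun_increments htmono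
    fun j => (Real.sqrt (ρ j))⁻¹) hlaw]
    with ω hω x b₀ b₁ hx
  refine eq_zero_of_tendsto_sum_mul_div hω (r := fun j => -b₁ * Real.sqrt (ρ j)) ?_ fun j => ?_
  · have h1 : Tendsto ρ atTop (𝓝 0) := by
      have := ((tendsto_pow_atTop_nhds_zero_of_lt_one (by norm_num : (0 : ℝ) ≤ 1 / 2)
        (by norm_num)).comp (tendsto_add_atTop_nat 1)).const_mul (q - p)
      rwa [mul_zero] at this
    have h2 := ((Real.continuous_sqrt.tendsto 0).comp h1).const_mul (-b₁)
    rwa [Real.sqrt_zero, mul_zero] at h2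
  · have h1 := hx (s j) ⟨hsp j, hsq j⟩
    have h2 := hx (s (j + 1)) ⟨hsp _, hsq _⟩
    have h3 : ∑ a, x a * (B a (t (j + 1)) ω - B a (t j) ω) = -b₁ * ρ j := by
      simp only [mul_sub, Finset.sum_sub_distrib]
      rw [← hstep j]
      simp only [dotProduct] at h1 h2
      linarith
    have h4 : Real.sqrt (ρ j) ≠ 0 := (Real.sqrt_pos.2 (hρ0 j)).ne'
    calc ∑ a, x a * ((Real.sqrt (ρ j))⁻¹ * (B a (t (j + 1)) ω - B a (t j) ω))
        = (Real.sqrt (ρ j))⁻¹ * ∑ a, x a * (B a (t (j + 1)) ω - B a (t j) ω) := by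
          rw [Finset.mul_sum]
          exact Finset.sum_congr rfl fun a _ => by ring
      _ = (Real.sqrt (ρ j))⁻¹ * (-b₁ * (Real.sqrt (ρ j) * Real.sqrt (ρ j))) := by
          rw [h3, Real.mul_self_sqrt (hρ0 j).le]
      _ = -b₁ * Real.sqrt (ρ j) := by field_simp

/-- Every interval contains one with rational endpoints, so countably many null sets suffice. -/
theorem IsBrownianVec.ae_nondegenerate [IsProbabilityMeasure P] (hB : IsBrownianVec B P) :
    ∀ᵐ ω ∂P, Nondegenerate fun s a => B a s.toNNReal ω := by
  have h : ∀ᵐ ω ∂P, ∀ p q : ℚ, (0 : ℝ) ≤ p → (p : ℝ) < q → ∀ (x : Fin d → ℝ) (b₀ b₁ : ℝ),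
      (∀ s ∈ Set.Icc (p : ℝ) q, (x ⬝ᵥ fun a => B a s.toNNReal ω) + b₀ + b₁ * s = 0) → x = 0 := by
    simp only [ae_all_iff (ι := ℚ)]
    intro p q
    by_cases hpq : (0 : ℝ) ≤ p ∧ (p : ℝ) < q
    · filter_upwards [hB.ae_eq_zero_of_affine hpq.1 hpq.2] with ω hω _ _
      exact hω
    · exact Eventually.of_forall fun ω h1 h2 => absurd ⟨h1, h2⟩ hpq
  filter_upwards [h] with ω hω p q hp hpq _ x b₀ b₁ hx
  obtain ⟨p', hp1, hp2⟩ := exists_rat_btwn hpq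
  obtain ⟨q', hq1, hq2⟩ := exists_rat_btwn hp2
  exact hω p' q' (hp.trans hp1.le) hq1 x b₀ b₁ fun s hs =>
    hx s ⟨hp1.le.trans hs.1, hs.2.trans hq2.le⟩

theorem Nondegenerate.mulVec {w : ℝ → Fin d → ℝ} (hw : Nondegenerate w)
    {A : Matrix (Fin d) (Fin d) ℝ} (hA : A.det ≠ 0) : Nondegenerate fun s => A.mulVec (w s) := by
  intro p q hp hpq hq x b₀ b₁ hx
  refine Matrix.eq_zero_of_vecMul_eq_zero hA (hw p q hp hpq hq _ b₀ b₁ fun s hs => ?_)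
  rw [← Matrix.dotProduct_mulVec]
  exact hx s hs

end Brownian

end SNCP

namespace SNCP

/-! ### Càdlàg paths -/

section Path

variable {d : ℕ}

/-- A càdlàg path, extended constantly outside `[0,1]`. -/
noncomputable def Cadlag.extend (x : Cadlag d) (s : ℝ) : Fin d → ℝ :=
  x.toFun (Set.projIcc 0 1 zero_le_one s)

theorem Cadlag.continuous_extend {x : Cadlag d} (hx : Continuous x.toFun) : Continuous x.extend :=
  hx.comp continuous_projIcc

/-- Skorokhod convergence to a continuous path is locally uniform convergence. -/
theorem Cadlag.contConv_extend {x : Cadlag d} (hx : Continuous x.toFun) :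
    ContConv (𝓝 x) Cadlag.extend x.extend := by
  intro s
  set r₀ : unitInterval := Set.projIcc 0 1 zero_le_one s with hr₀
  rw [EMetric.tendsto_nhds]
  intro e he
  have he2 : 0 < e / 2 := ENNReal.half_pos he.ne'
  obtain ⟨δ, hδ, hxδ⟩ := EMetric.tendsto_nhds_nhds.1 (hx.tendsto r₀) (e / 2) he2
  have hδ2 : 0 < δ / 2 := ENNReal.half_pos hδ.ne'
  have hs : ∀ᶠ s' in 𝓝 s, edist (Set.projIcc (0 : ℝ) 1 zero_le_one s') r₀ < δ / 2 :=
    EMetric.tendsto_nhds.1 ((continuous_projIcc (h := zero_le_one)).tendsto s) _ hδ2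
  have hg : ∀ᶠ g in 𝓝 x, edist g x < min (δ / 2) (e / 2) :=
    Metric.eball_mem_nhds x (lt_min hδ2 he2)
  filter_upwards [hg.prod_mk hs] with ⟨g, s'⟩ ⟨hg, hs⟩
  simp only at hg hs ⊢
  -- The time change moves `t` only slightly, so the value of `g` at `t` is close to that of `x` at
  -- `l t`, where continuity of `x` at `r₀` applies.
  obtain ⟨l, hl⟩ := iInf_lt_iff.1 (show (⨅ l, timeChangeDist g x l) < min (δ / 2) (e / 2) from hg)
  set t : unitInterval := Set.projIcc 0 1 zero_le_one s' with ht
  have h1 : edist (l t) t < δ / 2 :=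
    (le_max_of_le_left (le_iSup (fun t => edist (l t) t) t)).trans_lt
      (hl.trans_le (min_le_left _ _))
  have h2 : edist (g.toFun t) (x.toFun (l t)) < e / 2 :=
    (le_max_of_le_right (le_iSup (fun t => edist (g.toFun t) (x.toFun (l t))) t)).trans_lt
      (hl.trans_le (min_le_right _ _))
  have h3 : edist (l t) r₀ < δ := by
    refine (edist_triangle _ t _).trans_lt ((ENNReal.add_lt_add h1 hs).trans_le ?_)
    rw [ENNReal.add_halves]
  refine (edist_triangle _ (x.toFun (l t)) _).trans_lt
    ((ENNReal.add_lt_add h2 (hxδ h3)).trans_le ?_)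
  rw [ENNReal.add_halves]

/-- The data with partial sum path `f`. -/
noncomputable def pathData (n : ℕ) (f : Cadlag d) (t : ℕ) : Fin d → ℝ :=
  Real.sqrt n • (f.extend ((t : ℝ) / n) - f.extend (((t : ℝ) - 1) / n))

theorem extend_partialSumPath (x : ℕ → Fin d → ℝ) {n q : ℕ} (hn : 0 < n) (hq : q ≤ n) :
    (partialSumPath x n).extend ((q : ℝ) / n) =
      (Real.sqrt n)⁻¹ • ∑ t ∈ Finset.Icc 1 q, x t := by
  have hn' : (0 : ℝ) < n := by exact_mod_cast hn
  have hmem : (q : ℝ) / n ∈ Set.Icc (0 : ℝ) 1 :=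
    ⟨by positivity, (div_le_one hn').2 (by exact_mod_cast hq)⟩
  have hfl : ⌊(n : ℝ) * ((q : ℝ) / n)⌋₊ = q := by
    rw [mul_div_cancel₀ _ hn'.ne', Nat.floor_natCast]
  rw [Cadlag.extend, Set.projIcc_of_mem _ hmem]
  simp only [partialSumPath, hfl]

/-- The path determines `x 1, …, x n`; this is what makes the statistics functionals on the
Skorokhod space. -/
theorem pathData_partialSumPath (x : ℕ → Fin d → ℝ) {n t : ℕ} (h1 : 1 ≤ t) (htn : t ≤ n) :
    pathData n (partialSumPath x n) t = x t := by
  have hn : 0 < n := h1.trans htn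
  have hn' : (0 : ℝ) < n := by exact_mod_cast hn
  obtain ⟨q, rfl⟩ : ∃ q, t = q + 1 := ⟨t - 1, by omega⟩
  have h2 : (((q + 1 : ℕ) : ℝ) - 1) / n = (q : ℝ) / n := by
    push_cast
    rw [add_sub_cancel_right]
  rw [pathData, h2, extend_partialSumPath x hn htn, extend_partialSumPath x hn (by omega),
    Finset.sum_Icc_succ_top (by omega), ← smul_sub, add_sub_cancel_left,
    smul_inv_smul₀ (Real.sqrt_pos.2 hn').ne']

/-! ### The statistics depend on the data `y 1, …, y n` only -/

theorem sampleMean_congr {y y' : ℕ → Fin d → ℝ} {a b : ℕ}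
    (h : ∀ t, a ≤ t → t ≤ b → y t = y' t) : sampleMean y a b = sampleMean y' a b := by
  rw [sampleMean, sampleMean, Finset.sum_congr rfl fun t ht =>
    h t (Finset.mem_Icc.1 ht).1 (Finset.mem_Icc.1 ht).2]

theorem snStat_congr {y y' : ℕ → Fin d → ℝ} {t₁ k t₂ : ℕ} (h₁ : t₁ ≤ k) (h₂ : k ≤ t₂)
    (h : ∀ t, t₁ ≤ t → t ≤ t₂ → y t = y' t) : snStat y t₁ k t₂ = snStat y' t₁ k t₂ := by
  have hs : ∀ a b, t₁ ≤ a → b ≤ t₂ → sampleMean y a b = sampleMean y' a b := fun a b ha hb =>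
    sampleMean_congr fun t h1 h2 => h t (ha.trans h1) (h2.trans hb)
  have hc : contrast y t₁ k t₂ = contrast y' t₁ k t₂ := by
    rw [contrast, contrast, hs t₁ k le_rfl h₂, hs (k + 1) t₂ (by omega) le_rfl]
  have hl : leftNormalizer y t₁ k t₂ = leftNormalizer y' t₁ k t₂ := by
    refine Finset.sum_congr rfl fun i hi => ?_
    rw [Finset.mem_Icc] at hi
    rw [hs t₁ i le_rfl (by omega), hs (i + 1) k (by omega) h₂]
  have hr : rightNormalizer y t₁ k t₂ = rightNormalizer y' t₁ k t₂ := by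
    refine Finset.sum_congr rfl fun i hi => ?_
    rw [Finset.mem_Icc] at hi
    rw [hs i t₂ (by omega) le_rfl, hs (k + 1) (i - 1) (by omega) (by omega)]
  rw [snStat, snStat, normalizer, normalizer, hc, hl, hr]

theorem maxOrZero_congr {α : Type*} {s : Finset α} {f g : α → ℝ} (h : ∀ x ∈ s, f x = g x) :
    maxOrZero s f = maxOrZero s g := by
  unfold maxOrZero
  split_ifs with hs
  · exact Finset.sup'_congr hs rfl h
  · rfl

theorem maxStat_congr {y y' : ℕ → Fin d → ℝ} {n : ℕ} (h : ∀ t, 1 ≤ t → t ≤ n → y t = y' t)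
    (w : ℕ) : maxStat y n w = maxStat y' n w := by
  funext s e k
  refine maxOrZero_congr fun p hp => ?_
  rcases Nat.eq_zero_or_pos w with rfl | hw
  -- For window size `0` there are no windows, since division by `0` gives `0`.
  · simp [nestedWindowsIn, nestedWindows] at hp
  · obtain ⟨a, h1, h2, h3, h4, -, -⟩ := exists_of_mem_nestedWindowsIn hw hp
    exact snStat_congr (by omega) (by omega) fun t ht ht' => h t (by omega) (by omega)

theorem globalMaxStat_congr {y y' : ℕ → Fin d → ℝ} {n : ℕ}
    (h : ∀ t, 1 ≤ t → t ≤ n → y t = y' t) (w : ℕ) : globalMaxStat y n w = globalMaxStat y' n w := by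
  rw [globalMaxStat, globalMaxStat, maxStat_congr h]

theorem estimatesCorrect_congr {m : ℕ} {y y' : ℕ → Fin d → ℝ} {n : ℕ}
    (h : ∀ t, 1 ≤ t → t ≤ n → y t = y' t) (ε K : ℝ) (κ : Fin (m + 2) → ℕ) (r : ℝ) :
    EstimatesCorrect ε y n K κ r ↔ EstimatesCorrect ε y' n K κ r := by
  simp only [EstimatesCorrect, IsEstimate, maxStat_congr h]

/-! ### Measurability -/

/-- Contrast, determinant and adjugate are continuous in the data; only the scalar inverse of the
determinant is merely measurable. -/
theorem measurable_snStat (t₁ k t₂ : ℕ) :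
    Measurable fun y : ℕ → Fin d → ℝ => snStat y t₁ k t₂ := by
  have hs : ∀ a b, Continuous fun y : ℕ → Fin d → ℝ => sampleMean y a b := fun a b => by
    unfold sampleMean
    fun_prop
  have hs' : ∀ a b a' b', Continuous fun y : ℕ → Fin d → ℝ =>
      sampleMean y a b - sampleMean y a' b' := fun a b a' b' => (hs a b).sub (hs a' b')
  have hc : Continuous fun y : ℕ → Fin d → ℝ => contrast y t₁ k t₂ := by
    unfold contrast
    have := hs' t₁ k (k + 1) t₂
    fun_prop
  have hN : Continuous fun y : ℕ → Fin d → ℝ => normalizer y t₁ k t₂ := by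
    refine continuous_matrix_of_entries fun a b => ?_
    simp only [normalizer, leftNormalizer, rightNormalizer, Matrix.add_apply, Matrix.sum_apply,
      Matrix.smul_apply, Matrix.vecMulVec_apply, smul_eq_mul]
    have he : ∀ p q p' q' c, Continuous fun y : ℕ → Fin d → ℝ =>
        (sampleMean y p q - sampleMean y p' q') c := fun p q p' q' c =>
      (continuous_apply c).comp (hs' p q p' q')
    exact (continuous_finsetSum _ fun i _ => continuous_const.mul ((he _ _ _ _ _).mul
      (he _ _ _ _ _))).add (continuous_finsetSum _ fun i _ => continuous_const.mul
      ((he _ _ _ _ _).mul (he _ _ _ _ _)))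
  unfold snStat
  simp only [dotProduct_inv_mulVec_eq_adjugate]
  exact hN.matrix_det.measurable.inv.mul
    (hc.dotProduct (hN.matrix_adjugate.matrix_mulVec hc)).measurable

theorem measurable_maxOrZero {α β : Type*} [MeasurableSpace α] (s : Finset β) {f : β → α → ℝ}
    (hf : ∀ i, Measurable (f i)) : Measurable fun x => maxOrZero s fun i => f i x := by
  unfold maxOrZero
  split_ifs with hs
  · have := Finset.measurable_sup' hs fun i _ => hf i
    convert this using 1
    funext x
    rw [Finset.sup'_apply]
  · exact measurable_const

theorem measurable_globalMaxStat (n w : ℕ) :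
    Measurable fun y : ℕ → Fin d → ℝ => globalMaxStat y n w :=
  measurable_maxOrZero _ fun _ => measurable_maxOrZero _ fun _ => measurable_snStat _ _ _

/-! ### Invariance of the limit -/

theorem bridge_mulVec (A : Matrix (Fin d) (Fin d) ℝ) (w : ℝ → Fin d → ℝ) (u₁ u u₂ : ℝ) :
    bridge (fun s => A.mulVec (w s)) u₁ u u₂ = A.mulVec (bridge w u₁ u u₂) := by
  simp only [bridge, Matrix.mulVec_sub, Matrix.mulVec_smul]

theorem limNormalizer_mulVec (A : Matrix (Fin d) (Fin d) ℝ) {w : ℝ → Fin d → ℝ} (hw : Continuous w)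
    (u₁ u u₂ : ℝ) : limNormalizer (fun s => A.mulVec (w s)) u₁ u u₂ =
      A * limNormalizer w u₁ u u₂ * A.transpose := by
  have hint : ∀ (p q : ℝ) (a b : Fin d), ∫ s in p..q, bridge (fun s => A.mulVec (w s)) p s q a *
      bridge (fun s => A.mulVec (w s)) p s q b =
      ∑ j, ∑ i, A a i * (∫ s in p..q, bridge w p s q i * bridge w p s q j) * A b j := by
    intro p q a b
    have hc : ∀ i, Continuous fun s => bridge w p s q i := fun i =>
      (continuous_apply i).comp (continuous_bridge hw p q)
    simp only [bridge_mulVec]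
    have h1 : ∀ s, A.mulVec (bridge w p s q) a * A.mulVec (bridge w p s q) b =
        ∑ j, ∑ i, A a i * (bridge w p s q i * bridge w p s q j) * A b j := fun s => by
      simp only [Matrix.mulVec, dotProduct]
      rw [Finset.sum_mul_sum, Finset.sum_comm]
      exact Finset.sum_congr rfl fun j _ => Finset.sum_congr rfl fun i _ => by ring
    simp only [h1]
    have hci : ∀ i j, Continuous fun s => A a i * (bridge w p s q i * bridge w p s q j) * A b j :=
      fun i j => (continuous_const.mul ((hc i).mul (hc j))).mul continuous_const
    rw [intervalIntegral.integral_finsetSum fun j _ =>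
      (continuous_finsetSum _ fun i _ => hci i j).intervalIntegrable _ _]
    refine Finset.sum_congr rfl fun j _ => ?_
    rw [intervalIntegral.integral_finsetSum fun i _ => (hci i j).intervalIntegrable _ _]
    refine Finset.sum_congr rfl fun i _ => ?_
    rw [intervalIntegral.integral_mul_const, intervalIntegral.integral_const_mul]
  ext a b
  simp only [limNormalizer, Matrix.of_apply, hint, Matrix.mul_apply, Matrix.transpose_apply,
    Finset.sum_mul, ← Finset.sum_add_distrib, Finset.mul_sum]
  exact Finset.sum_congr rfl fun j _ => Finset.sum_congr rfl fun i _ => by ring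

/-- `D` becomes `A D` and `V` becomes `A V Aᵀ`, so `A` cancels from the quadratic form and the limit
law is free of the covariance. -/
theorem limStat_mulVec {A : Matrix (Fin d) (Fin d) ℝ} (hA : A.det ≠ 0) {w : ℝ → Fin d → ℝ}
    (hw : Continuous w) (u₁ u u₂ : ℝ) :
    limStat (fun s => A.mulVec (w s)) u₁ u u₂ = limStat w u₁ u u₂ := by
  have hu : IsUnit A.det := isUnit_iff_ne_zero.2 hA
  have hu' : IsUnit A.transpose.det := by rwa [Matrix.det_transpose]
  have hD : limContrast (fun s => A.mulVec (w s)) u₁ u u₂ = A.mulVec (limContrast w u₁ u u₂) := by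
    rw [limContrast, limContrast, bridge_mulVec, Matrix.mulVec_smul]
  rw [limStat, limStat, hD, limNormalizer_mulVec A hw, Matrix.mul_inv_rev, Matrix.mul_inv_rev,
    ← Matrix.mulVec_mulVec, ← Matrix.mulVec_mulVec, Matrix.mulVec_mulVec (limContrast w u₁ u u₂),
    Matrix.nonsing_inv_mul _ hu, Matrix.one_mulVec, Matrix.dotProduct_mulVec,
    Matrix.vecMul_mulVec, Matrix.mul_nonsing_inv _ hu', Matrix.vecMul_one]

theorem limStat_congr {w w' : ℝ → Fin d → ℝ} {u₁ u u₂ : ℝ} (h₁ : u₁ ≤ u) (h₂ : u ≤ u₂)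
    (h : ∀ s ∈ Set.Icc u₁ u₂, w s = w' s) : limStat w u₁ u u₂ = limStat w' u₁ u u₂ := by
  have hb : ∀ p s q, u₁ ≤ p → p ≤ s → s ≤ q → q ≤ u₂ → bridge w p s q = bridge w' p s q := by
    intro p s q h1 h2 h3 h4
    rw [bridge, bridge, h p ⟨h1, by linarith⟩, h s ⟨by linarith, by linarith⟩,
      h q ⟨by linarith, h4⟩]
  have hi : ∀ p q a b, u₁ ≤ p → p ≤ q → q ≤ u₂ → ∫ s in p..q, bridge w p s q a * bridge w p s q b =
      ∫ s in p..q, bridge w' p s q a * bridge w' p s q b := by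
    intro p q a b h1 h2 h3
    refine intervalIntegral.integral_congr fun s hs => ?_
    rw [Set.uIcc_of_le h2] at hs
    simp only [hb p s q h1 hs.1 hs.2 h3]
  have hN : limNormalizer w u₁ u u₂ = limNormalizer w' u₁ u u₂ := by
    ext a b
    simp only [limNormalizer, Matrix.of_apply]
    rw [hi u₁ u a b le_rfl h₁ h₂, hi u u₂ a b h₁ h₂ le_rfl]
  rw [limStat, limStat, limContrast, limContrast, hb u₁ u u₂ le_rfl h₁ h₂ le_rfl, hN]

theorem supLimStat_congr {U : Set ℝ} (hU : U ⊆ Set.Icc 0 1) {ε : ℝ} (hε : 0 < ε)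
    {w w' : ℝ → Fin d → ℝ} (h : ∀ u₁ u u₂, 0 ≤ u₁ → u₁ ≤ u → u ≤ u₂ → u₂ ≤ 1 →
      limStat w u₁ u u₂ = limStat w' u₁ u u₂) : supLimStat U ε w = supLimStat U ε w' := by
  unfold supLimStat
  congr 1
  ext x
  refine exists_congr fun u => and_congr_right fun hu => exists_congr fun p =>
    and_congr_right fun hp => ?_
  obtain ⟨j₁, j₂, -, h1, -, h2, rfl⟩ := hp
  have hu' := hU hu
  have h3 : (j₁ : ℝ) * ε ≤ u := by
    rw [← le_div_iff₀ hε]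
    exact (Nat.le_floor_iff (div_nonneg hu'.1 hε.le)).1 h1
  have h4 : (j₂ : ℝ) * ε ≤ 1 - u := by
    rw [← le_div_iff₀ hε]
    exact (Nat.le_floor_iff (div_nonneg (sub_nonneg.2 hu'.2) hε.le)).1 h2
  have h5 : 0 ≤ (j₁ : ℝ) * ε := by positivity
  have h6 : 0 ≤ (j₂ : ℝ) * ε := by positivity
  rw [h _ _ _ (by simp only; linarith) (by simp only; linarith) (by simp only; linarith)
    (by simp only; linarith)]

end Path

end SNCP

namespace SNCP

/-! ### Convergence in distribution along continuously convergent functionals -/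

theorem frequently_prod_nhds {E : Type*} [TopologicalSpace E] {S : ℕ → Set E} {x : E} (h : ∀ k, x ∈ closure (⋃ m ≥ k, S m)) :
    ∃ᶠ p : ℕ × E in atTop ×ˢ 𝓝 x, p.2 ∈ S p.1 := by
  rw [Filter.frequently_iff]
  intro U hU
  obtain ⟨s, hs, t, ht, hst⟩ := Filter.mem_prod_iff.1 hU
  obtain ⟨k, hk⟩ := Filter.mem_atTop_sets.1 hs
  obtain ⟨y, hyt, hy⟩ := mem_closure_iff_nhds.1 (h k) t ht
  obtain ⟨m, hm, hym⟩ := Set.mem_iUnion₂.1 hy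
  exact ⟨(m, y), hst ⟨hk m hm, hyt⟩, hym⟩

section Portmanteau

variable {Ω Ω' E : Type*} [MeasurableSpace Ω] [MeasurableSpace Ω'] {P : Measure Ω}
  [IsProbabilityMeasure P] {P' : Measure Ω'} [IsProbabilityMeasure P'] [TopologicalSpace E]
  [MeasurableSpace E] [BorelSpace E] [HasOuterApproxClosed E] {X : ℕ → Ω → E} {Z : Ω' → E}

/-- The closed tails `C k` contain all `S n` with `n ≥ k`. The portmanteau inequality holds for each
fixed `k`, and continuity from above lets `k` grow. This serves as a continuous mapping theorem for
functionals varying with `n`; the sets `S n` need not be measurable. -/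
theorem limsup_measure_mem_le (h : TendstoInDistribution X atTop Z (fun _ => P) P')
    (S : ℕ → Set E) {T : Set Ω'}
    (hT : ∀ᵐ ω' ∂P', (∃ᶠ p : ℕ × E in atTop ×ˢ 𝓝 (Z ω'), p.2 ∈ S p.1) → ω' ∈ T) :
    limsup (fun n => P {ω | X n ω ∈ S n}) atTop ≤ P' T := by
  set C : ℕ → Set E := fun k => closure (⋃ m ≥ k, S m) with hC
  have hCc : ∀ k, IsClosed (C k) := fun k => isClosed_closure
  have hCanti : Antitone C := fun k l hkl => closure_mono <| Set.iUnion₂_subset fun m hm =>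
    Set.subset_iUnion₂_of_subset m (hkl.trans hm) le_rfl
  have hle : ∀ k, limsup (fun n => P {ω | X n ω ∈ S n}) atTop ≤ P'.map Z (C k) := by
    intro k
    have h1 := ProbabilityMeasure.limsup_measure_closed_le_of_tendsto h.tendsto (hCc k)
    refine (limsup_le_limsup ?_).trans h1
    filter_upwards [eventually_ge_atTop k] with n hn
    change _ ≤ P.map (X n) (C k)
    rw [Measure.map_apply_of_aemeasurable (h.forall_aemeasurable n) (hCc k).measurableSet]
    exact measure_mono fun ω hω => subset_closure (Set.mem_iUnion₂.2 ⟨n, hn, hω⟩)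
  have : IsProbabilityMeasure (P'.map Z) := Measure.isProbabilityMeasure_map h.aemeasurable_limit
  have hlim := tendsto_measure_iInter_atTop (μ := P'.map Z)
    (fun k => (hCc k).measurableSet.nullMeasurableSet) hCanti ⟨0, measure_ne_top _ _⟩
  refine (ge_of_tendsto' hlim hle).trans ?_
  rw [Measure.map_apply_of_aemeasurable h.aemeasurable_limit
    (MeasurableSet.iInter fun k => (hCc k).measurableSet)]
  refine measure_mono_ae ?_
  filter_upwards [hT] with ω' hω' hmem
  exact hω' (frequently_prod_nhds fun k => Set.mem_iInter.1 hmem k)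

theorem tendsto_measure_one_of_eventually (h : TendstoInDistribution X atTop Z (fun _ => P) P')
    {G : ℕ → Set E} (hG : ∀ᵐ ω' ∂P', ∀ᶠ p : ℕ × E in atTop ×ˢ 𝓝 (Z ω'), p.2 ∈ G p.1) :
    Tendsto (fun n => P {ω | X n ω ∈ G n}) atTop (𝓝 1) := by
  have h1 := limsup_measure_mem_le h (fun n => (G n)ᶜ) (T := ∅) (by
    filter_upwards [hG] with ω' hω' hf
    exact (hf (hω'.mono fun p hp hn => hn hp)).elim)
  rw [measure_empty] at h1
  have h2 : Tendsto (fun n => P {ω | X n ω ∈ (G n)ᶜ}) atTop (𝓝 0) :=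
    tendsto_of_le_liminf_of_limsup_le bot_le h1
  have h3 : Tendsto (fun n => 1 - P {ω | X n ω ∈ (G n)ᶜ}) atTop (𝓝 1) := by
    have := ENNReal.Tendsto.sub (tendsto_const_nhds (x := (1 : ℝ≥0∞)) (f := atTop)) h2
      (Or.inl ENNReal.one_ne_top)
    rwa [tsub_zero] at this
  refine tendsto_of_tendsto_of_tendsto_of_le_of_le h3 tendsto_const_nhds (fun n => ?_)
    fun n => prob_le_one
  -- Subadditivity replaces the complement formula, because `G n` is not assumed measurable.
  rw [tsub_le_iff_right, ← measure_univ (μ := P)]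
  refine (measure_mono fun ω _ => ?_).trans (measure_union_le _ _)
  exact Classical.em _

theorem tendstoInDistribution_of_tendsto (h : TendstoInDistribution X atTop Z (fun _ => P) P')
    {g : ℕ → E → ℝ} {Y : ℕ → Ω → ℝ} {W : Ω' → ℝ} (hY : ∀ n, AEMeasurable (Y n) P)
    (hYX : ∀ n ω, Y n ω = g n (X n ω)) (hW : AEMeasurable W P')
    (hg : ∀ᵐ ω' ∂P', Tendsto (fun p : ℕ × E => g p.1 p.2) (atTop ×ˢ 𝓝 (Z ω')) (𝓝 (W ω'))) :
    TendstoInDistribution Y atTop W (fun _ => P) P' := by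
  refine ⟨hY, hW, tendsto_of_forall_isClosed_limsup_le' fun F hF => ?_⟩
  change limsup (fun n => P.map (Y n) F) atTop ≤ P'.map W F
  rw [Measure.map_apply_of_aemeasurable hW hF.measurableSet]
  have h1 : ∀ n, P.map (Y n) F = P {ω | X n ω ∈ g n ⁻¹' F} := fun n => by
    rw [Measure.map_apply_of_aemeasurable (hY n) hF.measurableSet]
    congr 1
    ext ω
    simp only [Set.mem_preimage, Set.mem_ofPred_eq, hYX]
  simp only [h1]
  refine limsup_measure_mem_le h (fun n => g n ⁻¹' F) ?_
  filter_upwards [hg] with ω' hω' hfreq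
  exact hF.mem_of_frequently_of_tendsto hfreq hω'

end Portmanteau

/-! ### The limit theorems -/

section Main

variable {Ω Ω' : Type*} [MeasurableSpace Ω] [MeasurableSpace Ω'] {P : Measure Ω}
  {P' : Measure Ω'} {d : ℕ} {ε : ℝ} {B : Fin d → ℝ≥0 → Ω' → ℝ}

/-- Taking pairs of a sample size and a path as the index lets both vary jointly, as the mapping
theorem requires. -/
theorem Cadlag.contConv_prod {x : Cadlag d} (hx : Continuous x.toFun) :
    ContConv ((atTop : Filter ℕ) ×ˢ 𝓝 x) (fun p => p.2.extend) x.extend := fun s =>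
  (contConv_extend hx s).comp (tendsto_snd.prodMap tendsto_id)

theorem extend_brownianPath (hB : IsBrownianVec B P') (A : Matrix (Fin d) (Fin d) ℝ) (ω : Ω')
    {s : ℝ} (hs : s ∈ Set.Icc (0 : ℝ) 1) : (brownianPath hB A ω).extend s =
      A.mulVec fun a => B a s.toNNReal ω := by
  rw [Cadlag.extend, Set.projIcc_of_mem _ hs]
  have : unitInterval.toNNReal ⟨s, hs⟩ = s.toNNReal := by
    ext
    rw [Real.coe_toNNReal _ hs.1]
    rfl
  simp only [brownianPath, Cadlag.ofContinuous, this]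

theorem continuous_brownianPath (hB : IsBrownianVec B P') (A : Matrix (Fin d) (Fin d) ℝ) (ω : Ω') :
    Continuous (brownianPath hB A ω).toFun :=
  Continuous.matrix_mulVec continuous_const
    (continuous_pi fun a => (hB.cont a ω).comp unitInterval.toNNReal_continuous)

theorem nondegenerate_brownianPath (hB : IsBrownianVec B P') {A : Matrix (Fin d) (Fin d) ℝ}
    (hA : A.det ≠ 0) {ω : Ω'} (hω : Nondegenerate fun s a => B a s.toNNReal ω) :
    Nondegenerate (brownianPath hB A ω).extend := by
  intro p q hp hpq hq x b₀ b₁ hx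
  refine hω.mulVec hA p q hp hpq hq x b₀ b₁ fun s hs => ?_
  rw [← hx s hs, extend_brownianPath hB A ω ⟨hp.trans hs.1, hs.2.trans hq⟩]

theorem supLimStat_brownianPath (hB : IsBrownianVec B P') {A : Matrix (Fin d) (Fin d) ℝ}
    (hA : A.det ≠ 0) (hε : 0 < ε) {U : Set ℝ} (hU : U ⊆ Set.Icc 0 1) (ω : Ω') :
    supLimStat U ε (brownianPath hB A ω).extend =
      supLimStat U ε fun s a => B a s.toNNReal ω := by
  refine supLimStat_congr hU hε fun u₁ u u₂ h0 h1 h2 h3 => ?_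
  have hw : Continuous fun (s : ℝ) (a : Fin d) => B a s.toNNReal ω :=
    continuous_pi fun a => (hB.cont a ω).comp continuous_real_toNNReal
  rw [← limStat_mulVec hA hw]
  exact limStat_congr h1 h2 fun s hs =>
    extend_brownianPath hB A ω ⟨h0.trans hs.1, hs.2.trans h3⟩

theorem tendsto_globalMaxStat_pathData {x : Cadlag d} (hx : Continuous x.toFun)
    (hnd : Nondegenerate x.extend) (hε : 0 < ε) (hε' : ε < 1 / 2) (θ : ℕ → Fin d → ℝ) :
    Tendsto (fun p : ℕ × Cadlag d =>
      globalMaxStat (fun t => pathData p.1 p.2 t + θ p.1) p.1 (windowSize ε p.1))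
      (atTop ×ˢ 𝓝 x) (𝓝 (supLimStat (Set.Icc ε (1 - ε)) ε x.extend)) :=
  (Cadlag.contConv_prod hx).tendsto_globalMaxStat (Cadlag.continuous_extend hx) hnd tendsto_fst
    hε hε' (Eventually.of_forall fun _ _ _ _ => rfl)

variable [IsProbabilityMeasure P']

/-- The supremum runs over uncountably many `u`; it is measurable as the almost sure limit of the
discrete statistics computed from the Brownian path itself. -/
theorem aemeasurable_supLimStat (hB : IsBrownianVec B P') (hε : 0 < ε) (hε' : ε < 1 / 2) :
    AEMeasurable (fun ω => supLimStat (Set.Icc ε (1 - ε)) ε fun s a => B a s.toNNReal ω) P' := by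
  have hU : Set.Icc ε (1 - ε) ⊆ Set.Icc 0 1 := Set.Icc_subset_Icc hε.le (by linarith)
  have h1 : (1 : Matrix (Fin d) (Fin d) ℝ).det ≠ 0 := by simp
  refine aemeasurable_of_tendsto_metrizable_ae atTop (f := fun n ω => globalMaxStat
    (fun t => pathData n (brownianPath hB 1 ω) t + 0) n (windowSize ε n)) (fun n => ?_) ?_
  · refine (measurable_globalMaxStat n (windowSize ε n)).comp_aemeasurable ?_
    refine aemeasurable_pi_lambda _ fun t => AEMeasurable.add_const ?_ _
    have hm : ∀ s, AEMeasurable (fun ω => (brownianPath hB 1 ω).extend s) P' := fun s => by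
      refine aemeasurable_pi_lambda _ fun a => ?_
      simp only [Cadlag.extend, brownianPath, Cadlag.ofContinuous, Matrix.one_mulVec]
      exact (hB.coord a).aemeasurable _
    have h := (hm ((t : ℝ) / n)).sub (hm (((t : ℝ) - 1) / n))
    exact h.const_smul (Real.sqrt n)
  · filter_upwards [hB.ae_nondegenerate] with ω hω
    rw [← supLimStat_brownianPath hB h1 hε hU]
    have h := tendsto_globalMaxStat_pathData (continuous_brownianPath hB 1 ω)
      (nondegenerate_brownianPath hB h1 hω) hε hε' fun _ => 0
    have h' : Tendsto (fun n : ℕ => (n, brownianPath hB 1 ω)) atTop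
        (atTop ×ˢ 𝓝 (brownianPath hB 1 ω)) := tendsto_id.prodMk tendsto_const_nhds
    simpa only [Function.comp_def] using h.comp h'

theorem ae_supLimStat_Ioo (hB : IsBrownianVec B P') (hε : 0 < ε) (hε' : ε < 1 / 2)
    (hq : ∀ q : ℕ, (q : ℝ) * ε ≠ 1) :
    (fun ω => supLimStat (Set.Icc ε (1 - ε)) ε fun s a => B a s.toNNReal ω) =ᵐ[P']
      fun ω => supLimStat (Set.Ioo ε (1 - ε)) ε fun s a => B a s.toNNReal ω := by
  filter_upwards [hB.ae_nondegenerate] with ω hω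
  exact (supLimStat_Ioo (continuous_pi fun a => (hB.cont a ω).comp continuous_real_toNNReal) hω
    hε hε' hq).symm

variable [IsProbabilityMeasure P]

theorem tendstoInDistribution_globalMaxStat (hε : 0 < ε) (hε' : ε < 1 / 2)
    {X : ℕ → Ω → Fin d → ℝ} (hX : ∀ t, 1 ≤ t → AEMeasurable (X t) P) (hB : IsBrownianVec B P')
    {A : Matrix (Fin d) (Fin d) ℝ} (hA : A.det ≠ 0)
    (h : TendstoInDistribution (fun (n : ℕ) ω => partialSumPath (fun t => X t ω) n) atTop
      (brownianPath hB A) (fun _ => P) P') (θ : ℕ → Fin d → ℝ) :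
    TendstoInDistribution
      (fun (n : ℕ) ω => globalMaxStat (fun t => X t ω + θ n) n (windowSize ε n)) atTop
      (fun ω' => supLimStat (Set.Icc ε (1 - ε)) ε (fun s a => B a s.toNNReal ω'))
      (fun _ => P) P' := by
  have hU : Set.Icc ε (1 - ε) ⊆ Set.Icc 0 1 := Set.Icc_subset_Icc hε.le (by linarith)
  refine tendstoInDistribution_of_tendsto h
    (g := fun n x => globalMaxStat (fun t => pathData n x t + θ n) n (windowSize ε n))
    (fun n => ?_) (fun n ω => ?_) (aemeasurable_supLimStat hB hε hε') ?_
  -- Nothing is known about `X 0`, but the statistic reads only the indices `1, …, n`.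
  · have h1 : (fun ω => globalMaxStat (fun t => X t ω + θ n) n (windowSize ε n)) =
        fun ω => globalMaxStat (fun t => if 1 ≤ t then X t ω + θ n else 0) n (windowSize ε n) := by
      funext ω
      exact globalMaxStat_congr (fun t ht _ => (if_pos ht).symm) _
    rw [h1]
    refine (measurable_globalMaxStat n (windowSize ε n)).comp_aemeasurable
      (aemeasurable_pi_lambda _ fun t => ?_)
    by_cases ht : 1 ≤ t
    · simp only [ht, if_true]
      exact (hX t ht).add_const _
    · simp only [ht, if_false]
      exact aemeasurable_const
  · exact globalMaxStat_congr (fun t h1 h2 => by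
      rw [pathData_partialSumPath (fun t => X t ω) h1 h2]) _
  · filter_upwards [hB.ae_nondegenerate] with ω hω
    rw [← supLimStat_brownianPath hB hA hε hU]
    exact tendsto_globalMaxStat_pathData (continuous_brownianPath hB A ω)
      (nondegenerate_brownianPath hB hA hω) hε hε' θ

theorem MeanChange.tendsto_measure_estimatesCorrect {m : ℕ} {k : ℕ → Fin (m + 2) → ℕ}
    {τ : Fin (m + 2) → ℝ} {θ : ℕ → Fin (m + 1) → Fin d → ℝ} {δ : ℕ → ℝ} {η : Fin m → Fin d → ℝ}
    (M : MeanChange ε k τ θ δ η) (hε : 0 < ε) {X : ℕ → Ω → Fin d → ℝ} (hB : IsBrownianVec B P')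
    {A : Matrix (Fin d) (Fin d) ℝ} (hA : A.det ≠ 0)
    (h : TendstoInDistribution (fun (n : ℕ) ω => partialSumPath (fun t => X t ω) n) atTop
      (brownianPath hB A) (fun _ => P) P')
    {r : ℕ → ℝ} (hr : ∀ n, 0 < r n) (hr' : Tendsto (fun n => r n / n) atTop (𝓝 0))
    (hrate : Tendsto (fun n : ℕ => (n : ℝ) / (r n ^ 2 * δ n ^ 2)) atTop (𝓝 0)) {κ : ℝ}
    (hκ₀ : 0 < κ) (hκ₁ : κ < 1) :
    Tendsto (fun n : ℕ => P {ω | EstimatesCorrect ε (piecewiseShift (k n) (θ n) fun t => X t ω) n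
      (((n : ℝ) * δ n ^ 2) ^ κ) (k n) (r n)}) atTop (𝓝 1) := by
  have h1 := tendsto_measure_one_of_eventually h (G := fun n => {x | EstimatesCorrect ε
    (piecewiseShift (k n) (θ n) (pathData n x)) n (((n : ℝ) * δ n ^ 2) ^ κ) (k n) (r n)}) (by
      filter_upwards [hB.ae_nondegenerate] with ω hω
      have hc := continuous_brownianPath hB A ω
      exact M.eventually_correct (Cadlag.contConv_prod hc) (Cadlag.continuous_extend hc)
        (nondegenerate_brownianPath hB hA hω) tendsto_fst hε
        (Eventually.of_forall fun _ _ _ _ => rfl) hr hr' hrate hκ₀ hκ₁)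
  refine h1.congr fun n => ?_
  congr 1
  ext ω
  refine estimatesCorrect_congr (fun t ht htn => ?_) _ _ _ _
  simp only [piecewiseShift, pathData_partialSumPath (fun t => X t ω) ht htn]

end Main

end SNCP

/-! ### The main theorem -/

theorem theorem3
    {Ω Ω' : Type*} [MeasurableSpace Ω] [MeasurableSpace Ω']
    (P : Measure Ω) [IsProbabilityMeasure P] (P' : Measure Ω') [IsProbabilityMeasure P']
    (d : ℕ) (hd : 1 ≤ d) (ε : ℝ) (hε : 0 < ε) (hε' : ε < 1 / 2)
    -- the noise: a stationary mean zero sequence `X 1, X 2, …`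
    (X : ℕ → Ω → Fin d → ℝ) (hstat : SNCP.IsStationary X P)
    (hint : ∀ t, 1 ≤ t → Integrable (X t) P) (hmean : ∀ t, 1 ≤ t → ∫ ω, X t ω ∂P = 0)
    -- the invariance principle, in `D([0,1], ℝ^d)`
    (B : Fin d → ℝ≥0 → Ω' → ℝ) (hB : SNCP.IsBrownianVec B P')
    (SX : Matrix (Fin d) (Fin d) ℝ) (hSX : SX.PosDef)
    (hinv : TendstoInDistribution (fun (n : ℕ) ω => SNCP.partialSumPath (fun t => X t ω) n)
      atTop (SNCP.brownianPath hB (CFC.sqrt SX)) (fun _ => P) P') :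
    -- (i) no change-point
    (∀ θ : ℕ → Fin d → ℝ,
      TendstoInDistribution
        (fun (n : ℕ) ω =>
          SNCP.globalMaxStat (fun t => X t ω + θ n) n (SNCP.windowSize ε n))
        atTop
        (fun ω' => SNCP.supLimStat (Set.Icc ε (1 - ε)) ε (fun s a => B a s.toNNReal ω'))
        (fun _ => P) P' ∧
      ((∀ q : ℕ, (q : ℝ) * ε ≠ 1) →
        TendstoInDistribution
          (fun (n : ℕ) ω =>
            SNCP.globalMaxStat (fun t => X t ω + θ n) n (SNCP.windowSize ε n))
          atTop
          (fun ω' => SNCP.supLimStat (Set.Ioo ε (1 - ε)) ε (fun s a => B a s.toNNReal ω'))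
          (fun _ => P) P')) ∧
    -- (ii) multiple change-points
    (∀ (m : ℕ) (k : ℕ → Fin (m + 2) → ℕ) (τ : Fin (m + 2) → ℝ)
      (θ : ℕ → Fin (m + 1) → Fin d → ℝ) (δ : ℕ → ℝ) (η : Fin m → Fin d → ℝ)
      (κ : ℝ) (ι : ℕ → ℝ),
      (∀ n, k n 0 = 0) → (∀ n, k n (Fin.last (m + 1)) = n) →
      (∀ᶠ n in atTop, StrictMono (k n)) →
      τ 0 = 0 → τ (Fin.last (m + 1)) = 1 →
      (∀ i, Tendsto (fun n => (k n i : ℝ) / n) atTop (𝓝 (τ i))) →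
      (∀ i : Fin (m + 1), ε < τ i.succ - τ i.castSucc) →
      (∀ i, η i ≠ 0) →
      (∀ n (i : Fin m), θ n i.succ - θ n i.castSucc = δ n • η i) →
      Tendsto (fun n : ℕ => (n : ℝ) * δ n ^ 2) atTop atTop →
      1 / 2 < κ → κ < 1 →
      (∀ n, 0 < ι n) →
      Tendsto (fun n => ι n / n) atTop (𝓝 0) →
      Tendsto (fun n : ℕ => (n : ℝ) / (ι n ^ 2 * δ n ^ 2)) atTop (𝓝 0) →
      Tendsto
        (fun n : ℕ => P {ω |
          (∃ S, SNCP.IsEstimate ε (SNCP.piecewiseShift (k n) (θ n) fun t => X t ω) n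
            (((n : ℝ) * δ n ^ 2) ^ κ) S) ∧
          ∀ S, SNCP.IsEstimate ε (SNCP.piecewiseShift (k n) (θ n) fun t => X t ω) n
              (((n : ℝ) * δ n ^ 2) ^ κ) S →
            ∃ hS : S.card = m, ∀ i : Fin m,
              |(S.orderEmbOfFin hS i : ℝ) - (k n i.succ.castSucc : ℝ)| ≤ ι n})
        atTop (𝓝 1)) := by
  -- The square of this determinant is the positive determinant of `SX`.
  have hA : (CFC.sqrt SX).det ≠ 0 := by
    intro h
    have hdet := hSX.det_pos
    rw [← CFC.sqrt_mul_sqrt_self SX hSX.posSemidef.nonneg, Matrix.det_mul, h, mul_zero] at hdet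
    exact lt_irrefl _ hdet
  refine ⟨fun θ => ?_, ?_⟩
  · have h := SNCP.tendstoInDistribution_globalMaxStat hε hε'
      (fun t ht => (hint t ht).aestronglyMeasurable.aemeasurable) hB hA hinv θ
    exact ⟨h, fun hq => h.congr (fun _ => ae_eq_rfl) (SNCP.ae_supLimStat_Ioo hB hε hε' hq)⟩
  · intro m k τ θ δ η κ ι hk₀ hk₁ hmono hτ₀ hτ₁ hτ hgap hη hjump hsignal hκ₀ hκ₁ hι hι' hrate
    have M : SNCP.MeanChange ε k τ θ δ η :=
      ⟨hk₀, hk₁, hmono, hτ₀, hτ₁, hτ, hgap, hη, hjump, hsignal⟩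
    exact M.tendsto_measure_estimatesCorrect hε hB hA hinv hι hι' hrate (by linarith) hκ₁
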